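/- All graphs are finite, simple and undirected; $V(G)$, $E(G)$ and $\Delta(G)$ denote the vertex set, edge set and maximum degree of $G$. A graph is $K_{3,3}$-minor-free if $K_{3,3}$ cannot be obtained from a subgraph of it by contracting edges. A rectilinear drawing of $G$ represents the vertices by distinct points of the plane and each edge by the straight line segment between its endpoints, such that an edge contains no vertex other than its own endpoints, and no three edges have a common point other than a common endpoint. A crossing is a point of intersection of two distinct edges that is not a common endpoint of them. The rectilinear crossing number $\mathrm{rcr}(G)$ is the minimum number of crossings in a rectilinear drawing of $G$. (1) For every integer $\Delta\ge 0$ there is a constant $c=c(\Delta)$ such that every $K_{3,3}$-minor-free graph $G$ with maximum degree at most $\Delta$ satisfies $\mathrm{rcr}(G)\le c\,|V(G)|$. (2) Every $K_{3,3}$-minor-free graph $G$ has a rectilinear drawing in which each edge crosses at most $2\,\Delta(G)$ other edges, and $$\mathrm{rcr}(G)\;\le\;\Delta(G)\,|E(G)|\;\le\;\Delta(G)\,(3|V(G)|-5).$$ -/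

import Mathlib

namespace RectilinearCrossing

/-- `H` is a minor of `G`: there are pairwise disjoint (nonempty) connected branch sets in `G`,
one for each vertex of `H`, such that the branch sets of adjacent vertices of `H` are joined by
an edge of `G`. -/
def IsMinor {W V : Type*} (H : SimpleGraph W) (G : SimpleGraph V) : Prop :=
  ∃ B : W → Set V,
    (∀ w, (G.induce (B w)).Connected) ∧
    (∀ a b, a ≠ b → Disjoint (B a) (B b)) ∧
    (∀ a b, H.Adj a b → ∃ x ∈ B a, ∃ y ∈ B b, G.Adj x y)

/-- `G` has no `K_{3,3}` minor. -/
def K33MinorFree {V : Type*} (G : SimpleGraph V) : Prop :=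
  ¬ IsMinor (completeBipartiteGraph (Fin 3) (Fin 3)) G

/-- The Euclidean plane. -/
abbrev Plane : Type := EuclideanSpace ℝ (Fin 2)

/-- The closed straight segment that represents the edge `e` when each vertex `v` is placed at
the point `pos v`. -/
def edgeSegment {V : Type*} (pos : V → Plane) (e : Sym2 V) : Set Plane :=
  Sym2.lift ⟨fun v w => segment ℝ (pos v) (pos w), fun v w => segment_symm ℝ (pos v) (pos w)⟩ e

/-- A rectilinear drawing of `G`: distinct vertices are distinct points, the only vertices on
the segment of an edge are its endpoints, and three distinct edges have no common
point except a common endpoint. -/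
structure RectilinearDrawing {V : Type*} (G : SimpleGraph V) where
  pos : V → Plane
  pos_injective : Function.Injective pos
  mem_of_pos_mem : ∀ e ∈ G.edgeSet, ∀ v, pos v ∈ edgeSegment pos e → v ∈ e
  no_three : ∀ e₁ ∈ G.edgeSet, ∀ e₂ ∈ G.edgeSet, ∀ e₃ ∈ G.edgeSet,
    e₁ ≠ e₂ → e₁ ≠ e₃ → e₂ ≠ e₃ →
    ∀ x ∈ edgeSegment pos e₁ ∩ edgeSegment pos e₂ ∩ edgeSegment pos e₃,
      ∃ v, v ∈ e₁ ∧ v ∈ e₂ ∧ v ∈ e₃ ∧ pos v = x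

namespace RectilinearDrawing

variable {V : Type*} {G : SimpleGraph V}

/-- The distinct edges `e` and `f` of `G` cross at the point `x`: it lies on both segments and
is not a common endpoint. -/
def CrossAt (D : RectilinearDrawing G) (e f : Sym2 V) (x : Plane) : Prop :=
  e ∈ G.edgeSet ∧ f ∈ G.edgeSet ∧ e ≠ f ∧
    x ∈ edgeSegment D.pos e ∧ x ∈ edgeSegment D.pos f ∧
    ¬ ∃ v, v ∈ e ∧ v ∈ f ∧ D.pos v = x

/-- The edges `e` and `f` cross. -/
def Cross (D : RectilinearDrawing G) (e f : Sym2 V) : Prop :=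
  ∃ x, D.CrossAt e f x

/-- The set of crossings of the drawing. -/
def crossings (D : RectilinearDrawing G) : Set Plane :=
  {x | ∃ e f, D.CrossAt e f x}

end RectilinearDrawing

/-- The rectilinear crossing number: the minimum number of crossings in a rectilinear drawing
(a value in `ℕ∞`, so that it would be `⊤` if there were no drawing). -/
noncomputable def rcr {V : Type*} (G : SimpleGraph V) : ℕ∞ :=
  ⨅ D : RectilinearDrawing G, D.crossings.encard

end RectilinearCrossing

/-! A `K_{3,3}`-minor-free graph is almost planar: it is assembled from planar pieces and copies of
`K₅` glued at no more than two vertices. This gives a straight-line placement in which at most two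
vertices share a position and edges without a common end position are disjoint (`bagDrawable`,
`PlaneMap`, `FibresLeTwo`). Disjointness of segments is an open condition, so after a perturbation
to general position two edges cross only if an end of one and an end of the other used to coincide
(`exists_drawing`). A vertex has at most one such twin. Hence every edge crossing `uv` is incident
with the twin of `u` or the twin of `v`, which bounds the crossings on an edge by `2Δ`; every
crossing is counted from both of its edges, which bounds their total number by `Δ|E|`.

The placement is found by induction. A part attached at one or two vertices goes into a thin empty
triangle at a vertex or along an edge (`Slot`, `BagDrawable.glue`); if its two attachment vertices
already share a position, the part is drawn with them contracted. A `K₅` is a plane `K₄` with one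
vertex doubled. What remains is `RootedGraph.drawable`: a 3-connected `K_{3,3}`-minor-free graph
other than `K₅` has a plane straight-line drawing with prescribed outer roots. Take an edge `xy`
between vertices that are not roots. If some `{x, y, z}` separates the graph, complete both sides by
a triangle and insert one drawing into that triangle of the other. If not, contract `xy`, draw, and
split the vertex again.

Splitting works when the neighbours of `x` and of `y` do not alternate around the contracted vertex
and have at most two members in common (`exists_split_direction`). Suppose they alternate as `a₁,
b₁, a₂, b₂`. Disjoint connected sets joining `a₁` to `a₂` and `b₁` to `b₂` are excluded in a plane
drawing by counting triangles modulo two (`not_alternating`); without such sets there is a rooted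
four-cycle minor (`exists_rootedC4`), which together with `x` and `y` is a `K_{3,3}` minor. Three
common neighbours lead to a `K_{3,3}` minor or to `K₅` (`HasK33.of_three_common`).

For the bound `3n - 5` on the number of edges, every edge of a minimal counterexample lies in three
triangles. Around a vertex of degree at most five this forces either a `K_{3,3}` minor or a `K₅`. In
the latter case, either the whole graph is `K₅`, or a piece hangs off the `K₅` at no more than two
vertices and induction applies to both pieces. -/

namespace RectilinearCrossing

/-! ### Connected sets, `K_{3,3}` models and contraction. -/

section Connectivity

variable {V W : Type*}

/-- The set `A` is connected in `G`: every partition of `A` into two nonempty parts is crossed by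
an edge. -/
def Conn (G : SimpleGraph V) (A : Set V) : Prop :=
  ∀ M ⊆ A, M.Nonempty → (A \ M).Nonempty → ∃ u ∈ M, ∃ v ∈ A \ M, G.Adj u v

variable {G H : SimpleGraph V} {A B U : Set V}

/-- Otherwise the members of `A` that satisfy `P` form a cut that no edge crosses. This replaces
walks throughout. -/
lemma Conn.induction (h : Conn G A) {u : V} (hu : u ∈ A) {P : V → Prop} (h0 : P u)
    (hs : ∀ x ∈ A, ∀ y ∈ A, G.Adj x y → P x → P y) : ∀ v ∈ A, P v := by
  by_contra! hc
  obtain ⟨v, hv, hPv⟩ := hc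
  obtain ⟨x, hx, y, hy, hxy⟩ := h {x ∈ A | P x} (fun x hx => hx.1) ⟨u, hu, h0⟩
    ⟨v, hv, fun h => hPv h.2⟩
  exact hy.2 ⟨hy.1, hs x hx.1 y hy.1 hxy hx.2⟩

lemma Conn.mono (h : Conn G A) (hGH : ∀ u ∈ A, ∀ v ∈ A, G.Adj u v → H.Adj u v) : Conn H A := by
  intro M hM h1 h2
  obtain ⟨u, hu, v, hv, huv⟩ := h M hM h1 h2
  exact ⟨u, hu, v, hv, hGH u (hM hu) v hv.1 huv⟩

lemma Conn.of_subsingleton (h : A.Subsingleton) : Conn G A := by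
  rintro M hM ⟨u, hu⟩ ⟨v, hv⟩
  exact absurd (h (hM hu) hv.1 ▸ hu) hv.2

lemma conn_singleton (u : V) : Conn G {u} := Conn.of_subsingleton Set.subsingleton_singleton

/-- An uncrossed cut has each of `A`, `B` entirely on one side, and `a`, `b` force these sides to
agree. The alternative `a = b` serves overlapping sets. -/
lemma Conn.union (hA : Conn G A) (hB : Conn G B) {a b : V} (ha : a ∈ A) (hb : b ∈ B)
    (hab : a = b ∨ G.Adj a b) : Conn G (A ∪ B) := by
  rintro M hM ⟨u, hu⟩ ⟨v, hv⟩
  by_contra! hc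
  have key : ∀ C ⊆ A ∪ B, Conn G C → ∀ x ∈ C, ∀ y ∈ C, x ∈ M → y ∈ M := by
    intro C hC hCc x hx y hy hxM
    refine hCc.induction hx (P := fun z => z ∈ M) hxM ?_ y hy
    intro s _ t ht hst hs
    by_contra htM
    exact hc s hs t ⟨hC ht, htM⟩ hst
  have hab' : a ∈ M ↔ b ∈ M := by
    rcases hab with rfl | hab
    · rfl
    · constructor
      · intro h; by_contra hb'
        exact hc a h b ⟨Or.inr hb, hb'⟩ hab
      · intro h; by_contra ha'
        exact hc b h a ⟨Or.inl ha, ha'⟩ hab.symm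
  have kA := key A Set.subset_union_left hA
  have kB := key B Set.subset_union_right hB
  have haM : a ∈ M := by
    rcases hM hu with h | h
    · exact kA u h a ha hu
    · exact hab'.2 (kB u h b hb hu)
  rcases hv.1 with h | h
  · exact hv.2 (kA a ha v h haM)
  · exact hv.2 (kB b hb v h (hab'.1 haM))

/-- Every vertex of `A` lies in a connected component of `A`. -/
lemma exists_component (G : SimpleGraph V) {A : Set V} {u : V} (hu : u ∈ A) :
    ∃ K ⊆ A, u ∈ K ∧ Conn G K ∧ ∀ x ∈ K, ∀ y ∈ A, G.Adj x y → y ∈ K := by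
  -- The intersection of all subsets of `A` that contain `u` and are closed under adjacency in `A`.
  let K : Set V := {v | ∀ M ⊆ A, u ∈ M → (∀ x ∈ M, ∀ y ∈ A, G.Adj x y → y ∈ M) → v ∈ M}
  have hKA : K ⊆ A := fun v hv => hv A subset_rfl hu fun _ _ y hy _ => hy
  have huK : u ∈ K := fun M _ h _ => h
  have hcl : ∀ x ∈ K, ∀ y ∈ A, G.Adj x y → y ∈ K := fun x hx y hy hxy M hM h1 h2 =>
    h2 x (hx M hM h1 h2) y hy hxy
  refine ⟨K, hKA, huK, ?_, hcl⟩
  rintro M hM ⟨a, ha⟩ ⟨b, hb⟩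
  by_contra! hc
  -- If `M` is not left by an edge, then `M` or `K \ M`, whichever contains `u`, is itself closed
  -- and so contains `K`.
  by_cases huM : u ∈ M
  · exact hb.2 (hb.1 M (hM.trans hKA) huM fun x hx y hy hxy => by
      by_contra hyM
      exact hc x hx y ⟨hcl x (hM hx) y hy hxy, hyM⟩ hxy)
  · exact ((hM ha) (K \ M) (Set.sdiff_subset.trans hKA) ⟨huK, huM⟩ fun x hx y hy hxy =>
      ⟨hcl x hx.1 y hy hxy, fun hyM => hc y hyM x hx hxy.symm⟩).2 ha

/-- `Conn` holds for the empty set as well, hence the separate nonemptiness. -/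
lemma connected_induce_iff : (G.induce A).Connected ↔ A.Nonempty ∧ Conn G A := by
  constructor
  · intro h
    refine ⟨Set.nonempty_coe_sort.1 h.nonempty, ?_⟩
    rintro M hM ⟨a, ha⟩ ⟨b, hb⟩
    by_contra! hc
    obtain ⟨w⟩ := h.preconnected ⟨a, hM ha⟩ ⟨b, hb.1⟩
    have : ∀ (x y : A) (_ : (G.induce A).Walk x y), x.1 ∈ M → y.1 ∈ M := by
      intro x y w
      induction w with
      | nil => exact id
      | @cons u v z huv _ ih =>
        intro hu
        refine ih ?_
        by_contra hv
        exact hc u.1 hu v.1 ⟨v.2, hv⟩ huv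
    exact hb.2 (this _ _ w ha)
  · rintro ⟨⟨u, hu⟩, h⟩
    have : Nonempty A := ⟨⟨u, hu⟩⟩
    refine SimpleGraph.Connected.mk ?_
    have key : ∀ v ∈ A, ∀ hv : v ∈ A, (G.induce A).Reachable ⟨u, hu⟩ ⟨v, hv⟩ := by
      refine h.induction hu (fun _ => SimpleGraph.Reachable.refl _) ?_
      intro x hx y hy hxy ih hy'
      exact (ih hx).trans (SimpleGraph.Adj.reachable (by exact hxy))
    intro a b
    exact (key a a.2 a.2).symm.trans (key b b.2 b.2)

/-- All edges of `G` have their endpoints in `U`. -/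
def LivesIn (G : SimpleGraph V) (U : Set V) : Prop := ∀ ⦃u v⦄, G.Adj u v → u ∈ U

lemma LivesIn.right (h : LivesIn G U) {u v : V} (huv : G.Adj u v) : v ∈ U := h huv.symm

/-- A `K_{3,3}` minor, with its branch sets listed by sides. -/
def HasK33 (G : SimpleGraph V) : Prop :=
  ∃ X Y : Fin 3 → Set V,
    (∀ i, (X i).Nonempty ∧ Conn G (X i)) ∧ (∀ i, (Y i).Nonempty ∧ Conn G (Y i)) ∧
    (∀ i j, i ≠ j → Disjoint (X i) (X j)) ∧ (∀ i j, i ≠ j → Disjoint (Y i) (Y j)) ∧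
    (∀ i j, Disjoint (X i) (Y j)) ∧ ∀ i j, ∃ x ∈ X i, ∃ y ∈ Y j, G.Adj x y

lemma k33MinorFree_iff : K33MinorFree G ↔ ¬ HasK33 G := by
  unfold K33MinorFree
  rw [not_iff_not]
  constructor
  · rintro ⟨B, h1, h2, h3⟩
    refine ⟨fun i => B (Sum.inl i), fun i => B (Sum.inr i), fun i => connected_induce_iff.1 (h1 _),
      fun i => connected_induce_iff.1 (h1 _), fun i j hij => h2 _ _ (by simpa using hij),
      fun i j hij => h2 _ _ (by simpa using hij), fun i j => h2 _ _ (by simp),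
      fun i j => h3 _ _ (by simp)⟩
  · rintro ⟨X, Y, hX, hY, hXX, hYY, hXY, hE⟩
    refine ⟨Sum.elim X Y, ?_, ?_, ?_⟩
    · rintro (i | i)
      · exact connected_induce_iff.2 (hX i)
      · exact connected_induce_iff.2 (hY i)
    · rintro (i | i) (j | j) hij
      · exact hXX i j (by simpa using hij)
      · exact hXY i j
      · exact (hXY j i).symm
      · exact hYY i j (by simpa using hij)
    · rintro (i | i) (j | j) hij
      · simp at hij
      · exact hE i j
      · obtain ⟨x, hx, y, hy, hxy⟩ := hE j i
        exact ⟨y, hy, x, hx, hxy.symm⟩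
      · simp at hij

/-- A `K_{3,3}` minor from six explicitly given branch sets. -/
lemma HasK33.of_sets {X₀ X₁ X₂ Y₀ Y₁ Y₂ : Set V}
    (hX : ∀ S ∈ [X₀, X₁, X₂, Y₀, Y₁, Y₂], S.Nonempty ∧ Conn G S)
    (hd : [X₀, X₁, X₂, Y₀, Y₁, Y₂].Pairwise Disjoint)
    (hE : ∀ S ∈ [X₀, X₁, X₂], ∀ T ∈ [Y₀, Y₁, Y₂], ∃ x ∈ S, ∃ y ∈ T, G.Adj x y) :
    HasK33 G := by
  simp only [List.pairwise_cons, List.mem_cons, List.not_mem_nil, or_false, forall_eq_or_imp,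
    forall_eq, List.Pairwise.nil, and_true, IsEmpty.forall_iff, implies_true] at hX hd hE
  obtain ⟨x0, x1, x2, y0, y1, y2⟩ := hX
  obtain ⟨⟨d1, d2, d3, d4, d5⟩, ⟨d6, d7, d8, d9⟩, ⟨d10, d11, d12⟩, ⟨d13, d14⟩, d15⟩ := hd
  obtain ⟨⟨e1, e2, e3⟩, ⟨e4, e5, e6⟩, e7, e8, e9⟩ := hE
  refine ⟨![X₀, X₁, X₂], ![Y₀, Y₁, Y₂], ?_, ?_, ?_, ?_, ?_, ?_⟩
  · exact Fin.cons x0 (Fin.cons x1 (Fin.cons x2 (fun i => i.elim0)))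
  · exact Fin.cons y0 (Fin.cons y1 (Fin.cons y2 (fun i => i.elim0)))
  · intro i j hij
    match i, j, hij with
    | 0, 1, _ => exact d1
    | 0, 2, _ => exact d2
    | 1, 2, _ => exact d6
    | 1, 0, _ => exact d1.symm
    | 2, 0, _ => exact d2.symm
    | 2, 1, _ => exact d6.symm
    | 0, 0, h | 1, 1, h | 2, 2, h => exact absurd rfl h
  · intro i j hij
    match i, j, hij with
    | 0, 1, _ => exact d13
    | 0, 2, _ => exact d14
    | 1, 2, _ => exact d15
    | 1, 0, _ => exact d13.symm
    | 2, 0, _ => exact d14.symm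
    | 2, 1, _ => exact d15.symm
    | 0, 0, h | 1, 1, h | 2, 2, h => exact absurd rfl h
  · intro i j
    match i, j with
    | 0, 0 => exact d3
    | 0, 1 => exact d4
    | 0, 2 => exact d5
    | 1, 0 => exact d7
    | 1, 1 => exact d8
    | 1, 2 => exact d9
    | 2, 0 => exact d10
    | 2, 1 => exact d11
    | 2, 2 => exact d12
  · intro i j
    match i, j with
    | 0, 0 => exact e1
    | 0, 1 => exact e2
    | 0, 2 => exact e3
    | 1, 0 => exact e4
    | 1, 1 => exact e5
    | 1, 2 => exact e6
    | 2, 0 => exact e7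
    | 2, 1 => exact e8
    | 2, 2 => exact e9

/-- Minors are transitive: a `K_{3,3}` minor of `G'` lifts along a model of `G'` in `G`. -/
lemma HasK33.of_model {G' : SimpleGraph W} {U : Set W} (hU : LivesIn G' U) (R : W → Set V)
    (hR : ∀ v ∈ U, (R v).Nonempty ∧ Conn G (R v))
    (hd : ∀ u ∈ U, ∀ v ∈ U, u ≠ v → Disjoint (R u) (R v))
    (hE : ∀ u v, G'.Adj u v → ∃ x ∈ R u, ∃ y ∈ R v, G.Adj x y) (h : HasK33 G') : HasK33 G := by
  obtain ⟨X, Y, hX, hY, hXX, hYY, hXY, hXE⟩ := h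
  -- Branch sets cannot leave `U`: each one contains an end of an edge, and all edges stay in `U`.
  -- So `R` is only ever used where it is controlled.
  have hsub : ∀ S : Set W, Conn G' S → ∀ u ∈ S, u ∈ U → S ⊆ U := by
    intro S hS u hu huU v hv
    exact hS.induction hu (P := fun z => z ∈ U) huU (fun x _ y _ hxy _ => hU hxy.symm) v hv
  have hXU : ∀ i, X i ⊆ U := fun i => by
    obtain ⟨x, hx, y, hy, hxy⟩ := hXE i 0
    exact hsub _ (hX i).2 x hx (hU hxy)
  have hYU : ∀ i, Y i ⊆ U := fun i => by
    obtain ⟨x, hx, y, hy, hxy⟩ := hXE 0 i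
    exact hsub _ (hY i).2 y hy (hU hxy.symm)
  have hc : ∀ S ⊆ U, S.Nonempty ∧ Conn G' S → (⋃ v ∈ S, R v).Nonempty ∧ Conn G (⋃ v ∈ S, R v) := by
    rintro S hSU ⟨⟨s, hs⟩, hS⟩
    obtain ⟨r, hr⟩ := (hR s (hSU hs)).1
    refine ⟨⟨r, Set.mem_biUnion hs hr⟩, ?_⟩
    rintro M hM ⟨a, ha⟩ ⟨b, hb⟩
    by_contra! hcut
    have hin : ∀ v ∈ S, ∀ x ∈ R v, ∀ y ∈ R v, x ∈ M → y ∈ M := by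
      intro v hv x hx y hy hxM
      refine (hR v (hSU hv)).2.induction hx (P := fun z => z ∈ M) hxM ?_ y hy
      intro s hs t ht hst hsM
      by_contra htM
      exact hcut s hsM t ⟨Set.mem_biUnion hv ht, htM⟩ hst
    obtain ⟨va, hva, haR⟩ := Set.mem_iUnion₂.1 (hM ha)
    obtain ⟨vb, hvb, hbR⟩ := Set.mem_iUnion₂.1 hb.1
    have : ∀ v ∈ S, ∀ x ∈ R v, x ∈ M := by
      refine hS.induction hva (fun x hx => hin va hva a haR x hx ha) ?_
      intro u hu v hv huv ih x hx
      obtain ⟨s, hs, t, ht, hst⟩ := hE u v huv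
      have htM : t ∈ M := by
        by_contra htM
        exact hcut s (ih s hs) t ⟨Set.mem_biUnion hv ht, htM⟩ hst
      exact hin v hv t ht x hx htM
    exact hb.2 (this vb hvb b hbR)
  have hdis : ∀ S ⊆ U, ∀ T ⊆ U, Disjoint S T → Disjoint (⋃ v ∈ S, R v) (⋃ v ∈ T, R v) := by
    intro S hS T hT hST
    rw [Set.disjoint_left]
    intro a ha hb
    obtain ⟨va, hva, haR⟩ := Set.mem_iUnion₂.1 ha
    obtain ⟨vb, hvb, hbR⟩ := Set.mem_iUnion₂.1 hb
    by_cases hab : va = vb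
    · exact Set.disjoint_left.1 hST hva (hab ▸ hvb)
    · exact Set.disjoint_left.1 (hd va (hS hva) vb (hT hvb) hab) haR hbR
  refine ⟨fun i => ⋃ v ∈ X i, R v, fun i => ⋃ v ∈ Y i, R v, fun i => hc _ (hXU i) (hX i),
    fun i => hc _ (hYU i) (hY i), fun i j hij => hdis _ (hXU i) _ (hXU j) (hXX i j hij),
    fun i j hij => hdis _ (hYU i) _ (hYU j) (hYY i j hij),
    fun i j => hdis _ (hXU i) _ (hYU j) (hXY i j), fun i j => ?_⟩
  obtain ⟨x, hx, y, hy, hxy⟩ := hXE i j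
  obtain ⟨s, hs, t, ht, hst⟩ := hE x y hxy
  exact ⟨s, Set.mem_biUnion hx hs, t, Set.mem_biUnion hy ht, hst⟩

lemma HasK33.mono (hGH : G ≤ H) (h : HasK33 G) : HasK33 H :=
  h.of_model (U := Set.univ) (fun _ _ _ => trivial) (fun v => {v})
    (fun v _ => ⟨Set.singleton_nonempty v, conn_singleton v⟩)
    (fun u _ v _ huv => by simpa using huv) (fun u v huv => ⟨u, rfl, v, rfl, hGH huv⟩)

/-- The subgraph of `G` induced by `U`, on the same vertex type. -/
def restr (G : SimpleGraph V) (U : Set V) : SimpleGraph V where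
  Adj u v := G.Adj u v ∧ u ∈ U ∧ v ∈ U
  symm := ⟨fun _ _ h => ⟨h.1.symm, h.2.2, h.2.1⟩⟩
  loopless := ⟨fun _ h => G.loopless.irrefl _ h.1⟩

lemma restr_le : restr G U ≤ G := fun _ _ h => h.1

lemma restr_livesIn : LivesIn (restr G U) U := fun _ _ h => h.2.1

/-- The graph obtained from `G` by contracting the edge `xy` to the vertex `x`; the vertex `y`
becomes isolated. -/
def contract (G : SimpleGraph V) (x y : V) : SimpleGraph V where
  Adj u v := u ≠ v ∧ u ≠ y ∧ v ≠ y ∧ (G.Adj u v ∨ (u = x ∧ G.Adj y v) ∨ (v = x ∧ G.Adj y u))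
  symm := ⟨fun _ _ h => ⟨h.1.symm, h.2.2.1, h.2.1, by
    rcases h.2.2.2 with h | h | h
    · exact Or.inl h.symm
    · exact Or.inr (Or.inr h)
    · exact Or.inr (Or.inl h)⟩⟩
  loopless := ⟨fun _ h => h.1 rfl⟩

lemma contract_adj {x y u v : V} : (contract G x y).Adj u v ↔ u ≠ v ∧ u ≠ y ∧ v ≠ y ∧
    (G.Adj u v ∨ (u = x ∧ G.Adj y v) ∨ (v = x ∧ G.Adj y u)) := Iff.rfl

lemma contract_livesIn (h : LivesIn G U) {x y : V} (hx : x ∈ U) :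
    LivesIn (contract G x y) (U \ {y}) := by
  rintro u v ⟨-, hu, hv, h1 | ⟨rfl, h1⟩ | ⟨rfl, h1⟩⟩
  · exact ⟨h h1, hu⟩
  · exact ⟨hx, hu⟩
  · exact ⟨h h1.symm, hu⟩

/-- The branch set `{x, y}` at `x` and singletons elsewhere model the contraction in `G`. -/
lemma HasK33.of_contract {x y : V} (hxy : G.Adj x y) (h : HasK33 (contract G x y)) : HasK33 G := by
  classical
  refine h.of_model (U := {v | v ≠ y}) (fun u v huv => (contract_adj.1 huv).2.1)
    (fun v => if v = x then {x, y} else {v}) ?_ ?_ ?_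
  · intro v hv
    split_ifs with h
    · exact ⟨by simp, (conn_singleton x).union (conn_singleton y) rfl rfl (Or.inr hxy)⟩
    · exact ⟨by simp, conn_singleton v⟩
  · intro u hu v hv huv
    simp only [Set.mem_ofPred_eq] at hu hv
    split_ifs with h1 h2 h2
    · exact absurd (h1.trans h2.symm) huv
    · simp only [Set.disjoint_singleton_right, Set.mem_insert_iff, Set.mem_singleton_iff]; tauto
    · simp only [Set.disjoint_singleton_left, Set.mem_insert_iff, Set.mem_singleton_iff]; tauto
    · simpa using huv
  · rintro u v ⟨huv, hu, hv, h1 | ⟨rfl, h1⟩ | ⟨rfl, h1⟩⟩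
    · refine ⟨u, ?_, v, ?_, h1⟩ <;> split_ifs with h <;> simp [h]
    · refine ⟨y, by simp, v, ?_, h1⟩
      split_ifs with h <;> simp [h]
    · refine ⟨u, ?_, y, by simp, h1.symm⟩
      split_ifs with h <;> simp [h]

/-- A cut in the contraction lifts to a cut of `A` with `y` on the side of `x`; an edge across the
lifted cut survives, with `y` renamed to `x`. -/
lemma Conn.contracted {x y : V} (h : Conn G A) (hxy : y ∈ A → x ∈ A) (hxv : x ≠ y) :
    Conn (contract G x y) (A \ {y}) := by
  rintro M hM ⟨a, ha⟩ ⟨b, hb⟩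
  by_cases hxM : x ∈ M
  · obtain ⟨u, hu, v, hv, huv⟩ := h (M ∪ ({y} ∩ A))
      (Set.union_subset (hM.trans Set.sdiff_subset) Set.inter_subset_right) ⟨a, Or.inl ha⟩
      ⟨b, hb.1.1, fun h => h.elim hb.2 fun h => hb.1.2 h.1⟩
    have hvM : v ∉ M := fun h => hv.2 (Or.inl h)
    have hvy : v ≠ y := fun h => hv.2 (Or.inr ⟨h, hv.1⟩)
    rcases hu with hu | hu
    · exact ⟨u, hu, v, ⟨⟨hv.1, hvy⟩, hvM⟩, huv.ne, (hM hu).2, hvy, Or.inl huv⟩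
    · obtain rfl : u = y := hu.1
      exact ⟨x, hxM, v, ⟨⟨hv.1, hvy⟩, hvM⟩, fun h => hvM (h ▸ hxM), (hM hxM).2, hvy,
        Or.inr (Or.inl ⟨rfl, huv⟩)⟩
  · obtain ⟨u, hu, v, hv, huv⟩ := h M (hM.trans Set.sdiff_subset) ⟨a, ha⟩ ⟨b, hb.1.1, hb.2⟩
    by_cases hvy : v = y
    · subst v
      exact ⟨u, hu, x, ⟨⟨hxy hv.1, hxv⟩, hxM⟩, fun h => hxM (h ▸ hu), (hM hu).2, hxv,
        Or.inr (Or.inr ⟨rfl, huv.symm⟩)⟩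
    · exact ⟨u, hu, v, ⟨⟨hv.1, hvy⟩, hv.2⟩, huv.ne, (hM hu).2, hvy, Or.inl huv⟩

end Connectivity

end RectilinearCrossing


namespace RectilinearCrossing

/-! ### Two disjoint connections or a rooted four-cycle minor. -/

section RootedCycle

variable {V : Type*} {G H : SimpleGraph V}

/-- The preimage of the vertex set `X` of `contract G x y` in `G`. -/
def expand (x y : V) (X : Set V) : Set V := {t | t ∈ X ∨ (t = y ∧ x ∈ X)}

lemma expand_adj {x y : V} {S T : Set V}
    (h : ∃ s ∈ S, ∃ t ∈ T, (contract G x y).Adj s t) :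
    ∃ s ∈ expand x y S, ∃ t ∈ expand x y T, G.Adj s t := by
  obtain ⟨s, hs, t, ht, -, -, -, h | ⟨rfl, h⟩ | ⟨rfl, h⟩⟩ := h
  · exact ⟨s, Or.inl hs, t, Or.inl ht, h⟩
  · exact ⟨y, Or.inr ⟨rfl, hs⟩, t, Or.inl ht, h⟩
  · exact ⟨s, Or.inl hs, y, Or.inr ⟨rfl, ht⟩, h.symm⟩

lemma disjoint_expand {x y : V} {S T : Set V} (hS : y ∉ S) (hT : y ∉ T) (h : Disjoint S T) :
    Disjoint (expand x y S) (expand x y T) := by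
  rw [Set.disjoint_left] at *
  rintro a (ha | ⟨rfl, ha⟩) (hb | ⟨hb, hb'⟩)
  · exact h ha hb
  · exact hS (hb ▸ ha)
  · exact hT hb
  · exact h ha hb'

/-- The edge `xy` keeps both ends on one side of an uncrossed cut, which therefore descends to an
uncrossed cut of `X`. -/
lemma Conn.of_contract {x y : V} (hxy : G.Adj x y) {X : Set V} (h : Conn (contract G x y) X)
    (hy : y ∉ X) : Conn G (expand x y X) := by
  rintro M hM ⟨a, ha⟩ ⟨b, hb⟩
  by_contra! hc
  have hxyM : x ∈ X → (x ∈ M ↔ y ∈ M) := fun hx =>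
    ⟨fun h => by_contra fun h' => hc x h y ⟨Or.inr ⟨rfl, hx⟩, h'⟩ hxy,
      fun h => by_contra fun h' => hc y h x ⟨Or.inl hx, h'⟩ hxy.symm⟩
  have key : ∀ c ∈ X, c ∈ M → ∀ d ∈ X, d ∈ M := by
    intro c hc1 hcM
    refine h.induction hc1 hcM ?_
    rintro s hs t ht ⟨-, -, -, h1 | ⟨rfl, h1⟩ | ⟨rfl, h1⟩⟩ hsM
    · by_contra htM
      exact hc s hsM t ⟨Or.inl ht, htM⟩ h1
    · by_contra htM
      exact hc y ((hxyM hs).1 hsM) t ⟨Or.inl ht, htM⟩ h1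
    · refine (hxyM ht).2 ?_
      by_contra htM
      exact hc s hsM y ⟨Or.inr ⟨rfl, ht⟩, htM⟩ h1.symm
  have ha' : ∃ c ∈ X, c ∈ M := by
    rcases hM ha with h1 | ⟨rfl, h1⟩
    · exact ⟨a, h1, ha⟩
    · exact ⟨x, h1, (hxyM h1).2 ha⟩
  obtain ⟨c, hcX, hcM⟩ := ha'
  rcases hb.1 with h1 | ⟨rfl, h1⟩
  · exact hb.2 (key c hcX hcM b h1)
  · exact hb.2 ((hxyM h1).1 (key c hcX hcM x h1))

/-- Four disjoint connected sets around the terminals, cyclically adjacent in the order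
`a₁, b₁, a₂, b₂`. -/
def RootedC4 (G : SimpleGraph V) (Q : Set V) (a₁ a₂ b₁ b₂ : V) : Prop :=
  ∃ A₁ A₂ B₁ B₂ : Set V, (∀ S ∈ [A₁, A₂, B₁, B₂], S ⊆ Q ∧ Conn G S) ∧
    a₁ ∈ A₁ ∧ a₂ ∈ A₂ ∧ b₁ ∈ B₁ ∧ b₂ ∈ B₂ ∧ [A₁, A₂, B₁, B₂].Pairwise Disjoint ∧
    ∀ S ∈ [A₁, A₂], ∀ T ∈ [B₁, B₂], ∃ x ∈ S, ∃ y ∈ T, G.Adj x y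

lemma RootedC4.mono {Q : Set V} {a₁ a₂ b₁ b₂ : V} (hGH : G ≤ H) (h : RootedC4 G Q a₁ a₂ b₁ b₂) :
    RootedC4 H Q a₁ a₂ b₁ b₂ := by
  obtain ⟨A₁, A₂, B₁, B₂, h1, h2, h3, h4, h5, h6, h7⟩ := h
  refine ⟨A₁, A₂, B₁, B₂, fun S hS => ⟨(h1 S hS).1, (h1 S hS).2.mono fun u _ v _ => @hGH u v⟩,
    h2, h3, h4, h5, h6, fun S hS T hT => ?_⟩
  obtain ⟨x, hx, y, hy, hxy⟩ := h7 S hS T hT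
  exact ⟨x, hx, y, hy, hGH hxy⟩

lemma RootedC4.of_contract {Q : Set V} {a₁ a₂ b₁ b₂ x y : V} (hxy : G.Adj x y) (hy : y ∈ Q)
    (h : RootedC4 (contract G x y) (Q \ {y}) a₁ a₂ b₁ b₂) : RootedC4 G Q a₁ a₂ b₁ b₂ := by
  obtain ⟨A₁, A₂, B₁, B₂, h1, h2, h3, h4, h5, h6, h7⟩ := h
  have hyS : ∀ S ∈ [A₁, A₂, B₁, B₂], y ∉ S := fun S hS hyS => ((h1 S hS).1 hyS).2 rfl
  refine ⟨expand x y A₁, expand x y A₂, expand x y B₁, expand x y B₂, ?_, Or.inl h2, Or.inl h3,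
    Or.inl h4, Or.inl h5, ?_, ?_⟩
  · intro T hT
    obtain ⟨S, hS, rfl⟩ : ∃ S ∈ [A₁, A₂, B₁, B₂], expand x y S = T := by
      rw [← List.mem_map]; exact hT
    refine ⟨?_, (h1 S hS).2.of_contract hxy (hyS S hS)⟩
    rintro t (ht | ⟨rfl, -⟩)
    · exact ((h1 S hS).1 ht).1
    · exact hy
  · refine List.Pairwise.map (l := [A₁, A₂, B₁, B₂]) (expand x y) (S := Disjoint)
      (R := fun S T => y ∉ S ∧ y ∉ T ∧ Disjoint S T) (fun S T h => disjoint_expand h.1 h.2.1 h.2.2) ?_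
    exact h6.imp_of_mem fun {S T} hS hT h => ⟨hyS S hS, hyS T hT, h⟩
  · intro S' hS' T' hT'
    obtain ⟨S, hS, rfl⟩ : ∃ S ∈ [A₁, A₂], expand x y S = S' := by
      rw [← List.mem_map]; exact hS'
    obtain ⟨T, hT, rfl⟩ : ∃ S ∈ [B₁, B₂], expand x y S = T' := by
      rw [← List.mem_map]; exact hT'
    exact expand_adj (h7 S hS T hT)

/-- In a graph without cut vertices, an edge whose ends separate the graph can be deleted without
creating cut vertices. -/
lemma conn_deleteEdge {Q : Set V} (h2 : ∀ z, Conn G (Q \ {z})) {u v : V} (hu : u ∈ Q) (hv : v ∈ Q)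
    (hn : ¬ Conn G (Q \ {u, v})) (z : V) : Conn (G.deleteEdges {s(u, v)}) (Q \ {z}) := by
  have hadj : ∀ s t, G.Adj s t → ¬ (s = u ∧ t = v) → ¬ (s = v ∧ t = u) →
      (G.deleteEdges {s(u, v)}).Adj s t := by
    intro s t hst h1 h2
    rw [SimpleGraph.deleteEdges_adj]
    exact ⟨hst, by simp only [Set.mem_singleton_iff, Sym2.eq_iff]; tauto⟩
  -- `Y` is a side of the separation by `{u, v}` that does not contain `z`.
  obtain ⟨Y, hYQ, hYne, hzY, hYcl⟩ : ∃ Y ⊆ Q \ {u, v}, Y.Nonempty ∧ z ∉ Y ∧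
      ∀ s ∈ Y, ∀ t ∈ Q \ {u, v}, G.Adj s t → t ∈ Y := by
    unfold Conn at hn
    push Not at hn
    obtain ⟨M, hM, hM1, hM2, hM3⟩ := hn
    by_cases hz : z ∈ M
    · refine ⟨(Q \ {u, v}) \ M, Set.sdiff_subset, hM2, fun h => h.2 hz, ?_⟩
      exact fun s hs t ht hst => ⟨ht, fun htM => hM3 t htM s hs hst.symm⟩
    · refine ⟨M, hM, hM1, hz, fun s hs t ht hst => ?_⟩
      by_contra htM
      exact hM3 s hs t ⟨ht, htM⟩ hst
  -- `Y` provides a detour from `u` to `v` that avoids `z`, so no uncrossed cut `P` separates them.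
  -- If `P` meets `Y`, connectivity without `u` gives an edge from `Y ∩ P` to `v` or to the rest of
  -- `Y`; if not, connectivity without `v` gives an edge from `u` to `Y`.
  have main : ∀ u v : V, u ∈ Q → v ∈ Q → u ≠ v → v ≠ z →
      (Y ⊆ Q \ {u, v}) → (∀ s ∈ Y, ∀ t ∈ Q \ {u, v}, G.Adj s t → t ∈ Y) →
      (∀ s t, G.Adj s t → ¬ (s = u ∧ t = v) → ¬ (s = v ∧ t = u) →
        (G.deleteEdges {s(u, v)}).Adj s t) →
      ∀ P ⊆ Q \ {z}, u ∈ P → v ∉ P →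
        (∀ s ∈ P, ∀ t ∈ Q \ {z}, t ∉ P → ¬ (G.deleteEdges {s(u, v)}).Adj s t) → False := by
    intro u v hu hv huv hvz hYQ hYcl hadj P hP huP hvP hc
    by_cases hYP : ∃ y ∈ Y, y ∈ P
    · obtain ⟨y, hyY, hyP⟩ := hYP
      have hyu : y ≠ u := fun h => (hYQ hyY).2 (by simp [h])
      obtain ⟨s, hs, t, ht, hst⟩ := h2 u (Y ∩ P)
        (fun s hs => ⟨(hYQ hs.1).1, fun h => (hYQ hs.1).2 (by simp [Set.mem_singleton_iff.1 h])⟩)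
        ⟨y, hyY, hyP⟩ ⟨v, ⟨hv, huv.symm⟩, fun h => hvP h.2⟩
      have htu : t ≠ u := ht.1.2
      have hsu : s ≠ u := fun h => (hYQ hs.1).2 (by simp [h])
      have hst' := hadj s t hst (fun h => hsu h.1) (fun h => htu h.2)
      by_cases htv : t = v
      · subst htv
        exact hc s hs.2 t ⟨hv, hvz⟩ hvP hst'
      · have htY : t ∈ Y := hYcl s hs.1 t ⟨ht.1.1, by simp [htu, htv]⟩ hst
        refine hc s hs.2 t ⟨ht.1.1, fun h => hzY ?_⟩ (fun h => ht.2 ⟨htY, h⟩) hst'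
        rwa [← Set.mem_singleton_iff.1 h]
    · push Not at hYP
      obtain ⟨y, hyY⟩ := hYne
      obtain ⟨s, hs, t, ht, hst⟩ := h2 v Y
        (fun s hs => ⟨(hYQ hs).1, fun h => (hYQ hs).2 (by simp [Set.mem_singleton_iff.1 h])⟩)
        ⟨y, hyY⟩ ⟨u, ⟨hu, huv⟩, fun h => (hYQ h).2 (by simp)⟩
      have htv : t ≠ v := ht.1.2
      have hsv : s ≠ v := fun h => (hYQ hs).2 (by simp [h])
      have htu : t = u := by
        by_contra htu
        exact ht.2 (hYcl s hs t ⟨ht.1.1, by simp [htu, htv]⟩ hst)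
      subst htu
      refine hc t huP s ⟨(hYQ hs).1, fun h => hzY ?_⟩ (hYP s hs)
        (hadj s t hst (fun h => htv h.2) fun h => hsv h.1).symm
      rwa [← Set.mem_singleton_iff.1 h]
  rintro P hP ⟨a, ha⟩ ⟨b, hb⟩
  by_contra! hc
  obtain ⟨s, hs, t, ht, hst⟩ := h2 z P hP ⟨a, ha⟩ ⟨b, hb⟩
  by_cases h1 : s = u ∧ t = v
  · obtain ⟨rfl, rfl⟩ := h1
    exact main s t hu hv hst.ne ht.1.2 hYQ hYcl hadj P hP hs ht.2
      fun x hx y hy hyP => hc x hx y ⟨hy, hyP⟩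
  by_cases h3 : s = v ∧ t = u
  · obtain ⟨rfl, rfl⟩ := h3
    rw [Set.pair_comm] at hYQ hYcl
    rw [Sym2.eq_swap] at hc hadj
    exact main s t hv hu hst.ne ht.1.2 hYQ hYcl (fun x y hxy h1 h2 => hadj x y hxy h2 h1) P hP hs
      ht.2 fun x hx y hy hyP => hc x hx y ⟨hy, hyP⟩
  · exact hc s hs t ht (hadj s t hst h1 h3)

/-- Four terminals in a graph without cut vertices: either there are disjoint connected sets
joining `a₁` to `a₂` and `b₁` to `b₂`, or there is a rooted four-cycle minor. -/
theorem exists_rootedC4 [Finite V] (n : ℕ) : ∀ (G : SimpleGraph V) (Q : Set V), Q.ncard = n →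
    (∀ z, Conn G (Q \ {z})) → ∀ a₁ ∈ Q, ∀ a₂ ∈ Q, ∀ b₁ ∈ Q, ∀ b₂ ∈ Q,
    [a₁, a₂, b₁, b₂].Nodup →
    (∀ X ⊆ Q, ∀ Y ⊆ Q, Conn G X → Conn G Y → Disjoint X Y → a₁ ∈ X → a₂ ∈ X → b₁ ∈ Y → b₂ ∈ Y →
      False) → RootedC4 G Q a₁ a₂ b₁ b₂ := by
  induction n with
  | zero =>
    intro G Q hQ h2 a₁ ha₁
    rw [Set.ncard_eq_zero (Set.toFinite Q)] at hQ
    simp [hQ] at ha₁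
  | succ n ih =>
    intro G' Q hQ h2' a₁ ha₁ a₂ ha₂ b₁ hb₁ b₂ hb₂ hnd hlink'
    -- In an edge-minimal graph without cut vertices the ends of an edge never separate, by
    -- `conn_deleteEdge`. Hence every edge can be contracted without creating a cut vertex.
    obtain ⟨G, hGG', hG⟩ : ∃ G ≤ G', Minimal (fun G => ∀ z, Conn G (Q \ {z})) G :=
      exists_minimal_le_of_wellFoundedLT _ G' h2'
    have h2 : ∀ z, Conn G (Q \ {z}) := hG.prop
    have hlink : ∀ X ⊆ Q, ∀ Y ⊆ Q, Conn G X → Conn G Y → Disjoint X Y → a₁ ∈ X → a₂ ∈ X → b₁ ∈ Y →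
        b₂ ∈ Y → False := fun X hX Y hY hXc hYc => hlink' X hX Y hY
      (hXc.mono fun u _ v _ => @hGG' u v) (hYc.mono fun u _ v _ => @hGG' u v)
    refine RootedC4.mono hGG' ?_
    have hnd' := hnd
    simp only [List.nodup_cons, List.mem_cons, List.not_mem_nil, or_false, not_or, List.nodup_nil,
      and_true, not_false_eq_true] at hnd'
    obtain ⟨⟨h12, h13, h14⟩, ⟨h23, h24⟩, h34⟩ := hnd'
    by_cases hterm : ∃ v ∈ Q, v ∉ [a₁, a₂, b₁, b₂]
    · obtain ⟨v, hvQ, hv⟩ := hterm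
      simp only [List.mem_cons, List.not_mem_nil, or_false, not_or] at hv
      obtain ⟨v', hv', u, hu, hvu⟩ := h2 a₁ {v} (by simpa [hvQ] using hv.1) ⟨v, rfl⟩
        ⟨a₂, ⟨ha₂, Ne.symm h12⟩, Ne.symm hv.2.1⟩
      obtain rfl : v' = v := hv'
      have hcon : Conn G (Q \ {u, v'}) := by
        by_contra hn
        have hdel := conn_deleteEdge h2 hu.1.1 hvQ hn
        have hle := hG.le_of_le hdel (SimpleGraph.deleteEdges_le _)
        have := hle hvu.symm
        simp [SimpleGraph.deleteEdges_adj] at this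
      refine RootedC4.of_contract hvu.symm hvQ (ih (contract G u v') (Q \ {v'}) ?_ ?_
        a₁ ⟨ha₁, Ne.symm hv.1⟩ a₂ ⟨ha₂, Ne.symm hv.2.1⟩ b₁ ⟨hb₁, Ne.symm hv.2.2.1⟩
        b₂ ⟨hb₂, Ne.symm hv.2.2.2⟩ hnd ?_)
      · rw [Set.ncard_sdiff_singleton_of_mem hvQ, hQ]; rfl
      · intro z
        by_cases hz : z = u
        · subst hz
          have : (Q \ {v'}) \ {z} = Q \ {z, v'} := by ext t; simp; tauto
          rw [this]
          refine hcon.mono fun s hs t ht hst => ⟨hst.ne, ?_, ?_, Or.inl hst⟩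
          · rintro rfl; exact hs.2 (by simp)
          · rintro rfl; exact ht.2 (by simp)
        · have : (Q \ {v'}) \ {z} = (Q \ {z}) \ {v'} := by ext t; simp; tauto
          rw [this]
          exact (h2 z).contracted (fun _ => ⟨hu.1.1, Ne.symm hz⟩) hvu.ne.symm
      · intro X hX Y hY hXc hYc hXY h1 h2 h3 h4
        have hvX : v' ∉ X := fun h => (hX h).2 rfl
        have hvY : v' ∉ Y := fun h => (hY h).2 rfl
        have hsub : ∀ X ⊆ Q \ {v'}, expand u v' X ⊆ Q := by
          rintro X hX t (ht | ⟨rfl, -⟩)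
          · exact (hX ht).1
          · exact hvQ
        exact hlink _ (hsub X hX) _ (hsub Y hY) (hXc.of_contract hvu.symm hvX)
          (hYc.of_contract hvu.symm hvY) (disjoint_expand hvX hvY hXY) (Or.inl h1) (Or.inl h2)
          (Or.inl h3) (Or.inl h4)
    · push Not at hterm
      simp only [List.mem_cons, List.not_mem_nil, or_false] at hterm
      -- Only the four terminals are left. No cut vertex means that every terminal has a neighbour
      -- besides any given `z`, so a terminal not adjacent to its partner is adjacent to both
      -- others. Since `a₁a₂` and `b₁b₂` are not both edges, the four-cycle is present.
      have hfind : ∀ s ∈ Q, ∀ z ∈ Q, s ≠ z → (∃ r ∈ Q, r ≠ s ∧ r ≠ z) →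
          ∃ t ∈ Q, t ≠ z ∧ t ≠ s ∧ G.Adj s t := by
        rintro s hs z hz hsz ⟨r, hr, hrs, hrz⟩
        obtain ⟨s', hs', t, ht, hst⟩ := h2 z {s} (by simpa [hs] using hsz) ⟨s, rfl⟩
          ⟨r, ⟨hr, hrz⟩, hrs⟩
        obtain rfl : s' = s := hs'
        exact ⟨t, ht.1.1, ht.1.2, hst.ne.symm, hst⟩
      have hkey : ∀ s ∈ Q, ∀ r ∈ Q, ∀ z ∈ Q, ∀ t ∈ Q, [s, r, z, t].Nodup → ¬ G.Adj s r →
          (∀ v ∈ Q, v = s ∨ v = r ∨ v = z ∨ v = t) → G.Adj s t := by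
        intro s hs r hr z hz t ht hnd hsr hall
        simp only [List.nodup_cons, List.mem_cons, List.not_mem_nil, or_false, not_or,
          List.nodup_nil, and_true, not_false_eq_true] at hnd
        obtain ⟨t', ht', h1, h2, h3⟩ := hfind s hs z hz hnd.1.2.1 ⟨r, hr, Ne.symm hnd.1.1, hnd.2.1.1⟩
        rcases hall t' ht' with rfl | rfl | rfl | rfl
        · exact absurd rfl h2
        · exact absurd h3 hsr
        · exact absurd rfl h1
        · exact h3
      have hE : G.Adj a₁ b₁ ∧ G.Adj a₁ b₂ ∧ G.Adj a₂ b₁ ∧ G.Adj a₂ b₂ := by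
        by_cases haa : G.Adj a₁ a₂
        · have hbb : ¬ G.Adj b₁ b₂ := fun hbb => hlink {a₁, a₂} (by simp [Set.insert_subset_iff, *])
            {b₁, b₂} (by simp [Set.insert_subset_iff, *])
            ((conn_singleton a₁).union (conn_singleton a₂) rfl rfl (Or.inr haa))
            ((conn_singleton b₁).union (conn_singleton b₂) rfl rfl (Or.inr hbb))
            (by simp [Set.disjoint_left]; tauto) (by simp) (by simp) (by simp) (by simp)
          have hbb' : ¬ G.Adj b₂ b₁ := fun h => hbb h.symm
          refine ⟨(hkey b₁ hb₁ b₂ hb₂ a₂ ha₂ a₁ ha₁ ?_ hbb ?_).symm,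
            (hkey b₂ hb₂ b₁ hb₁ a₂ ha₂ a₁ ha₁ ?_ hbb' ?_).symm,
            (hkey b₁ hb₁ b₂ hb₂ a₁ ha₁ a₂ ha₂ ?_ hbb ?_).symm,
            (hkey b₂ hb₂ b₁ hb₁ a₁ ha₁ a₂ ha₂ ?_ hbb' ?_).symm⟩
          all_goals first
            | (intro v hv; have := hterm v hv; tauto)
            | (simp; grind)
        · have haa' : ¬ G.Adj a₂ a₁ := fun h => haa h.symm
          refine ⟨hkey a₁ ha₁ a₂ ha₂ b₂ hb₂ b₁ hb₁ ?_ haa ?_,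
            hkey a₁ ha₁ a₂ ha₂ b₁ hb₁ b₂ hb₂ ?_ haa ?_,
            hkey a₂ ha₂ a₁ ha₁ b₂ hb₂ b₁ hb₁ ?_ haa' ?_,
            hkey a₂ ha₂ a₁ ha₁ b₁ hb₁ b₂ hb₂ ?_ haa' ?_⟩
          all_goals first
            | (intro v hv; have := hterm v hv; tauto)
            | (simp; grind)
      refine ⟨{a₁}, {a₂}, {b₁}, {b₂}, ?_, rfl, rfl, rfl, rfl, ?_, ?_⟩
      · simp [ha₁, ha₂, hb₁, hb₂, conn_singleton]
      · simp; tauto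
      · simpa [and_assoc] using hE

end RootedCycle

end RectilinearCrossing


namespace RectilinearCrossing

/-! ### Sources of `K_{3,3}` minors in 3-connected graphs. -/

section ThreeConnected

variable {V : Type*} {G H : SimpleGraph V}

/-- The sides are `{x}, B₁, B₂` and `{y}, A₁, A₂`: the cycle gives four of the nine adjacencies, the
terminals another four, and `xy` the last. -/
lemma HasK33.of_rootedC4 {Q : Set V} {x y a₁ a₂ b₁ b₂ : V} (hx : x ∉ Q) (hy : y ∉ Q)
    (hxy : G.Adj x y) (ha₁ : G.Adj x a₁) (ha₂ : G.Adj x a₂) (hb₁ : G.Adj y b₁) (hb₂ : G.Adj y b₂)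
    (h : RootedC4 G Q a₁ a₂ b₁ b₂) : HasK33 G := by
  obtain ⟨A₁, A₂, B₁, B₂, h1, m1, m2, m3, m4, h6, h7⟩ := h
  simp only [List.pairwise_cons, List.mem_cons, List.not_mem_nil, or_false, forall_eq_or_imp,
    forall_eq, List.Pairwise.nil, and_true, IsEmpty.forall_iff, implies_true] at h1 h6 h7
  obtain ⟨⟨s1, c1⟩, ⟨s2, c2⟩, ⟨s3, c3⟩, s4, c4⟩ := h1
  obtain ⟨⟨d1, d2, d3⟩, ⟨d4, d5⟩, d6⟩ := h6
  obtain ⟨⟨e1, e2⟩, e3, e4⟩ := h7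
  have sw : ∀ {S T : Set V}, (∃ x ∈ S, ∃ y ∈ T, G.Adj x y) → ∃ x ∈ T, ∃ y ∈ S, G.Adj x y := by
    rintro S T ⟨x, hx, y, hy, h⟩
    exact ⟨y, hy, x, hx, h.symm⟩
  refine HasK33.of_sets (X₀ := {x}) (X₁ := B₁) (X₂ := B₂) (Y₀ := {y}) (Y₁ := A₁) (Y₂ := A₂)
    ?_ ?_ ?_
  · simp only [List.mem_cons, List.not_mem_nil, or_false, forall_eq_or_imp, forall_eq]
    exact ⟨⟨⟨x, rfl⟩, conn_singleton x⟩, ⟨⟨_, m3⟩, c3⟩, ⟨⟨_, m4⟩, c4⟩, ⟨⟨y, rfl⟩, conn_singleton y⟩,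
      ⟨⟨_, m1⟩, c1⟩, ⟨_, m2⟩, c2⟩
  · simp only [List.pairwise_cons, List.mem_cons, List.not_mem_nil, or_false, forall_eq_or_imp,
      forall_eq, List.Pairwise.nil, and_true, IsEmpty.forall_iff, implies_true,
      Set.disjoint_singleton_left, Set.disjoint_singleton_right, Set.mem_singleton_iff]
    exact ⟨⟨fun h => hx (s3 h), fun h => hx (s4 h), hxy.ne, fun h => hx (s1 h), fun h => hx (s2 h)⟩,
      ⟨d6, fun h => hy (s3 h), d2.symm, d4.symm⟩, ⟨fun h => hy (s4 h), d3.symm, d5.symm⟩,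
      ⟨fun h => hy (s1 h), fun h => hy (s2 h)⟩, d1⟩
  · simp only [List.mem_cons, List.not_mem_nil, or_false, forall_eq_or_imp, forall_eq]
    exact ⟨⟨⟨x, rfl, y, rfl, hxy⟩, ⟨x, rfl, _, m1, ha₁⟩, ⟨x, rfl, _, m2, ha₂⟩⟩,
      ⟨⟨_, m3, y, rfl, hb₁.symm⟩, sw e1, sw e3⟩, ⟨_, m4, y, rfl, hb₂.symm⟩, sw e2, sw e4⟩

/-- Three connected sets adjacent to the same three further vertices give a `K_{3,3}` minor. -/
lemma HasK33.of_three {A B C : Set V} {x y z : V} (hA : Conn G A) (hB : Conn G B) (hC : Conn G C)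
    (hAB : Disjoint A B) (hAC : Disjoint A C) (hBC : Disjoint B C)
    (hxy : x ≠ y) (hxz : x ≠ z) (hyz : y ≠ z)
    (hd : ∀ S ∈ [A, B, C], ∀ t ∈ [x, y, z], t ∉ S ∧ ∃ s ∈ S, G.Adj s t) : HasK33 G := by
  simp only [List.mem_cons, List.not_mem_nil, or_false, forall_eq_or_imp, forall_eq] at hd
  obtain ⟨⟨⟨a1, a1'⟩, ⟨a2, a2'⟩, a3, a3'⟩, ⟨⟨b1, b1'⟩, ⟨b2, b2'⟩, b3, b3'⟩, ⟨c1, c1'⟩, ⟨c2, c2'⟩,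
    c3, c3'⟩ := hd
  have ne : ∀ {S : Set V} {t : V}, (∃ s ∈ S, G.Adj s t) → S.Nonempty := fun ⟨s, hs, _⟩ => ⟨s, hs⟩
  have ad : ∀ {S : Set V} {t : V}, (∃ s ∈ S, G.Adj s t) → ∃ s ∈ S, ∃ t' ∈ ({t} : Set V), G.Adj s t' :=
    fun ⟨s, hs, h⟩ => ⟨s, hs, _, rfl, h⟩
  refine HasK33.of_sets (X₀ := A) (X₁ := B) (X₂ := C) (Y₀ := {x}) (Y₁ := {y}) (Y₂ := {z}) ?_ ?_ ?_
  · simp only [List.mem_cons, List.not_mem_nil, or_false, forall_eq_or_imp, forall_eq]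
    exact ⟨⟨ne a1', hA⟩, ⟨ne b1', hB⟩, ⟨ne c1', hC⟩, ⟨⟨x, rfl⟩, conn_singleton x⟩,
      ⟨⟨y, rfl⟩, conn_singleton y⟩, ⟨z, rfl⟩, conn_singleton z⟩
  · simp only [List.pairwise_cons, List.mem_cons, List.not_mem_nil, or_false, forall_eq_or_imp,
      forall_eq, List.Pairwise.nil, and_true, IsEmpty.forall_iff, implies_true,
      Set.disjoint_singleton_left, Set.disjoint_singleton_right, Set.mem_singleton_iff]
    exact ⟨⟨hAB, hAC, a1, a2, a3⟩, ⟨hBC, b1, b2, b3⟩, ⟨c1, c2, c3⟩, ⟨Ne.symm hxy |>.symm, hxz⟩, hyz⟩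
  · simp only [List.mem_cons, List.not_mem_nil, or_false, forall_eq_or_imp, forall_eq]
    exact ⟨⟨ad a1', ad a2', ad a3'⟩, ⟨ad b1', ad b2', ad b3'⟩, ad c1', ad c2', ad c3'⟩

/-- If the edge `xy` can be contracted and `x`, `y` have three common neighbours, then there is a
`K_{3,3}` minor, unless `U` spans a `K₅`. -/
lemma HasK33.of_three_common {U : Set V} (h3 : ∀ s t, Conn G (U \ {s, t})) {x y : V}
    (hxU : x ∈ U) (hyU : y ∈ U) (hxy : G.Adj x y)
    (h2 : ∀ z, Conn G ((U \ {x, y}) \ {z})) {c : Fin 3 → V} (hc : Function.Injective c)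
    (hcU : ∀ i, c i ∈ U) (hxc : ∀ i, G.Adj x (c i)) (hyc : ∀ i, G.Adj y (c i))
    (hne : U ≠ {x, y, c 0, c 1, c 2}) : HasK33 G := by
  have hcx : ∀ i, c i ≠ x := fun i => (hxc i).ne.symm
  have hcy : ∀ i, c i ≠ y := fun i => (hyc i).ne.symm
  obtain ⟨d, hdU, hd⟩ : ∃ d ∈ U, d ∉ ({x, y, c 0, c 1, c 2} : Set V) := by
    by_contra! hcon
    refine hne (Set.Subset.antisymm hcon ?_)
    simp [Set.insert_subset_iff, hxU, hyU, hcU]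
  simp only [Set.mem_insert_iff, Set.mem_singleton_iff, not_or] at hd
  -- A component `D` of the rest. If it sees all three `c i`, then `x`, `y`, `D` form one side of a
  -- `K_{3,3}`.
  obtain ⟨D, hDsub, hdD, hDc, hDcl⟩ := exists_component G
    (A := (U \ {x, y}) \ Set.range c) (u := d) ⟨⟨hdU, by simp [hd]⟩, by
      rintro ⟨i, rfl⟩
      match i with
      | 0 => exact hd.2.2.1 rfl
      | 1 => exact hd.2.2.2.1 rfl
      | 2 => exact hd.2.2.2.2 rfl⟩
  have hxD : x ∉ D := fun h => (hDsub h).1.2 (by simp)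
  have hyD : y ∉ D := fun h => (hDsub h).1.2 (by simp)
  have hcD : ∀ i, c i ∉ D := fun i h => (hDsub h).2 ⟨i, rfl⟩
  by_cases hall : ∀ i, ∃ s ∈ D, G.Adj s (c i)
  · have h01 : c 0 ≠ c 1 := hc.ne (by decide)
    have h02 : c 0 ≠ c 2 := hc.ne (by decide)
    have h12 : c 1 ≠ c 2 := hc.ne (by decide)
    refine HasK33.of_three (A := {x}) (B := {y}) (C := D) (x := c 0) (y := c 1) (z := c 2)
      (conn_singleton x) (conn_singleton y) hDc (by simpa using hxy.ne) (by simpa using hxD)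
      (by simpa using hyD) h01 h02 h12 ?_
    simp only [List.mem_cons, List.not_mem_nil, or_false, forall_eq_or_imp, forall_eq,
      Set.mem_singleton_iff, exists_eq_left]
    simp only [hcx, hcy, hcD, hxc, hyc, hall, not_false_eq_true, and_true]
  · push Not at hall
    obtain ⟨k, hk⟩ := hall
    obtain ⟨i, j, hij, hik, hjk, hcov⟩ : ∃ i j : Fin 3, i ≠ j ∧ i ≠ k ∧ j ≠ k ∧
        ∀ l, l = i ∨ l = j ∨ l = k :=
      (by decide : ∀ k : Fin 3, ∃ i j : Fin 3, i ≠ j ∧ i ≠ k ∧ j ≠ k ∧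
        ∀ l, l = i ∨ l = j ∨ l = k) k
    have hDcl' : ∀ s ∈ D, ∀ t ∈ U, G.Adj s t → t ∈ D ∨ t = x ∨ t = y ∨ t = c i ∨ t = c j := by
      intro s hs t ht hst
      by_contra! hcon
      obtain ⟨n1, n2, n3, n4, n5⟩ := hcon
      refine n1 (hDcl s hs t ⟨⟨ht, by simp [n2, n3]⟩, ?_⟩ hst)
      rintro ⟨l, rfl⟩
      rcases hcov l with rfl | rfl | rfl
      · exact n4 rfl
      · exact n5 rfl
      · exact hk s hs hst
    have hDadj : ∀ i j, (∀ l : Fin 3, l = i ∨ l = j ∨ l = k) → i ≠ j → i ≠ k → j ≠ k →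
        (∀ s ∈ D, ∀ t ∈ U, G.Adj s t → t ∈ D ∨ t = x ∨ t = y ∨ t = c i ∨ t = c j) →
        ∃ s ∈ D, G.Adj s (c i) := by
      intro i j _ hij hik hjk hDcl'
      obtain ⟨s, hs, t, ht, hst⟩ := h2 (c j) D
        (fun s hs => ⟨(hDsub hs).1, fun h => hcD j (Set.mem_singleton_iff.1 h ▸ hs)⟩) ⟨d, hdD⟩
        ⟨c i, ⟨⟨hcU i, by simp [hcx, hcy]⟩, hc.ne hij⟩, hcD i⟩
      rcases hDcl' s hs t ht.1.1.1 hst with h | h | h | h | h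
      · exact absurd h ht.2
      · exact absurd (by simp [h]) ht.1.1.2
      · exact absurd (by simp [h]) ht.1.1.2
      · exact ⟨s, hs, h ▸ hst⟩
      · exact absurd h ht.1.2
    have hDi := hDadj i j hcov hij hik hjk hDcl'
    have hDj := hDadj j i (fun l => by have := hcov l; tauto) hij.symm hjk hik
      (fun s hs t ht hst => by have := hDcl' s hs t ht hst; tauto)
    -- `D` misses `c k`, so it sees `c i` and `c j` because there is no cut vertex in `U \ {x, y}`.
    -- The component `K` of `c k` after deleting `c i`, `c j` sees both for the same reason, and it
    -- is disjoint from `D`.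
    obtain ⟨K, hKsub, hkK, hKc, hKcl⟩ := exists_component G
      (A := (U \ {x, y}) \ {c i, c j}) (u := c k)
      ⟨⟨hcU k, by simp [hcx, hcy]⟩, by simp [hc.eq_iff, hik.symm, hjk.symm]⟩
    have hKadj : ∀ i j, i ≠ j → (∀ s ∈ K, s ∈ U \ {x, y} ∧ s ≠ c i ∧ s ≠ c j) →
        (∀ s ∈ K, ∀ t ∈ U \ {x, y}, t ≠ c i → t ≠ c j → G.Adj s t → t ∈ K) →
        ∃ s ∈ K, G.Adj s (c i) := by
      intro i j hij hKsub hKcl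
      obtain ⟨s, hs, t, ht, hst⟩ := h2 (c j) K
        (fun s hs => ⟨(hKsub s hs).1, (hKsub s hs).2.2⟩) ⟨c k, hkK⟩
        ⟨c i, ⟨⟨hcU i, by simp [hcx, hcy]⟩, hc.ne hij⟩, fun h => (hKsub _ h).2.1 rfl⟩
      by_cases hti : t = c i
      · exact ⟨s, hs, hti ▸ hst⟩
      · exact absurd (hKcl s hs t ht.1.1 hti ht.1.2 hst) ht.2
    have hKs : ∀ s ∈ K, s ∈ U \ {x, y} ∧ s ≠ c i ∧ s ≠ c j := fun s hs =>
      ⟨(hKsub hs).1, by simpa using (hKsub hs).2⟩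
    have hKi := hKadj i j hij hKs fun s hs t ht h1 h2 hst => hKcl s hs t ⟨ht, by simp [h1, h2]⟩ hst
    have hKj := hKadj j i hij.symm (fun s hs => ⟨(hKs s hs).1, (hKs s hs).2.2, (hKs s hs).2.1⟩)
      fun s hs t ht h1 h2 hst => hKcl s hs t ⟨ht, by simp [h1, h2]⟩ hst
    have hKx : x ∉ K := fun h => (hKs x h).1.2 (by simp)
    have hKy : y ∉ K := fun h => (hKs y h).1.2 (by simp)
    have hDK : Disjoint D K := by
      rw [Set.disjoint_left]
      intro t htD htK
      have : ∀ s ∈ D, s ∈ K := by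
        refine hDc.induction htD htK fun s hs r hr hsr hsK => hKcl s hsK r ⟨(hDsub hr).1, ?_⟩ hsr
        rintro (h | h)
        · exact hcD i (h ▸ hr)
        · exact hcD j (h ▸ hr)
      have : ∀ s ∈ K, s ∈ D := by
        refine hKc.induction htK htD fun s hs r hr hsr hsD => ?_
        rcases hDcl' s hsD r (hKs r hr).1.1 hsr with h | h | h | h | h
        · exact h
        · exact absurd (h ▸ hr) hKx
        · exact absurd (h ▸ hr) hKy
        · exact absurd h (hKs r hr).2.1
        · exact absurd h (hKs r hr).2.2
      exact hcD k (this _ hkK)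
    -- By 3-connectivity `D` is not cut off by `c i`, `c j` alone. If it sees `x`, then `D`, `{y}`,
    -- `K` are all adjacent to `c i`, `c j`, `x`; the case of `y` is symmetric.
    have hDxy : (∃ s ∈ D, G.Adj s x) ∨ ∃ s ∈ D, G.Adj s y := by
      obtain ⟨s, hs, t, ht, hst⟩ := h3 (c i) (c j) D
        (fun s hs => ⟨(hDsub hs).1.1, by
          rintro (h | h)
          · exact hcD i (h ▸ hs)
          · exact hcD j (h ▸ hs)⟩) ⟨d, hdD⟩
        ⟨c k, ⟨hcU k, by simp [hc.eq_iff, hik.symm, hjk.symm]⟩, hcD k⟩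
      rcases hDcl' s hs t ht.1.1 hst with h | h | h | h | h
      · exact absurd h ht.2
      · exact Or.inl ⟨s, hs, h ▸ hst⟩
      · exact Or.inr ⟨s, hs, h ▸ hst⟩
      · exact absurd (by simp [h]) ht.1.2
      · exact absurd (by simp [h]) ht.1.2
    have fin : ∀ x y : V, G.Adj x y → (∃ s ∈ D, G.Adj s x) → x ∉ D → y ∉ D → x ∉ K → y ∉ K →
        (∀ i, G.Adj x (c i)) → (∀ i, G.Adj y (c i)) → HasK33 G := by
      intro x y hxy hDx hxD hyD hKx hKy hxc hyc
      refine HasK33.of_three (A := D) (B := {y}) (C := K) (x := c i) (y := c j) (z := x)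
        hDc (conn_singleton y) hKc (by simpa using hyD) hDK (by simpa using hKy) (hc.ne hij)
        (hxc i).ne.symm (hxc j).ne.symm ?_
      simp only [List.mem_cons, List.not_mem_nil, or_false, forall_eq_or_imp, forall_eq,
        Set.mem_singleton_iff, exists_eq_left]
      exact ⟨⟨⟨hcD i, hDi⟩, ⟨hcD j, hDj⟩, hxD, hDx⟩,
        ⟨⟨(hyc i).ne.symm, hyc i⟩, ⟨(hyc j).ne.symm, hyc j⟩, hxy.ne, hxy.symm⟩,
        ⟨fun h => (hKs _ h).2.1 rfl, hKi⟩, ⟨fun h => (hKs _ h).2.2 rfl, hKj⟩, hKx,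
        c k, hkK, (hxc k).symm⟩
    rcases hDxy with h | h
    · exact fin x y hxy h hxD hyD hKx hKy hxc hyc
    · exact fin y x hxy.symm h hyD hxD hKy hKx hyc hxc

end ThreeConnected

end RectilinearCrossing


namespace RectilinearCrossing

/-! ### Orientation determinants, general position and open conditions. -/

section Geometry

/-- Twice the signed area of the triangle `abc`. -/
def det3 (a b c : ℝ × ℝ) : ℝ := (b.1 - a.1) * (c.2 - a.2) - (b.2 - a.2) * (c.1 - a.1)

lemma mem_seg {a b m : ℝ × ℝ} : m ∈ segment ℝ a b ↔
    ∃ t : ℝ, 0 ≤ t ∧ t ≤ 1 ∧ m.1 = (1 - t) * a.1 + t * b.1 ∧ m.2 = (1 - t) * a.2 + t * b.2 := by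
  rw [segment_eq_image]
  constructor
  · rintro ⟨t, ht, rfl⟩
    exact ⟨t, ht.1, ht.2, by simp, by simp⟩
  · rintro ⟨t, h0, h1, h2, h3⟩
    exact ⟨t, ⟨h0, h1⟩, Prod.ext (by simp [h2]) (by simp [h3])⟩

lemma det3_cycle (a b c : ℝ × ℝ) : det3 a b c = det3 b c a := by unfold det3; ring

lemma det3_swap (a b c : ℝ × ℝ) : det3 a b c = - det3 b a c := by unfold det3; ring

lemma det3_swap' (a b c : ℝ × ℝ) : det3 a b c = - det3 a c b := by unfold det3; ring

/-- The condition for the lines `ab`, `cd`, `ef` to be concurrent or parallel, as the vanishing of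
a determinant. -/
def conc (a b c d e f : ℝ × ℝ) : ℝ :=
  (a.2 - b.2) * ((d.1 - c.1) * (e.1 * f.2 - e.2 * f.1) - (f.1 - e.1) * (c.1 * d.2 - c.2 * d.1))
  - (b.1 - a.1) * ((c.2 - d.2) * (e.1 * f.2 - e.2 * f.1) - (e.2 - f.2) * (c.1 * d.2 - c.2 * d.1))
  + (a.1 * b.2 - a.2 * b.1) * ((c.2 - d.2) * (f.1 - e.1) - (e.2 - f.2) * (d.1 - c.1))

lemma det3_eq_zero_of_mem_segment {a b m : ℝ × ℝ} (h : m ∈ segment ℝ a b) : det3 a b m = 0 := by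
  obtain ⟨t, -, -, h1, h2⟩ := mem_seg.1 h
  unfold det3
  rw [h1, h2]; ring

/-- The rows of the determinant are the coefficients of the three lines, and `(m.1, m.2, 1)` is a
kernel vector. The multipliers are the cofactors of the column of constants. -/
lemma conc_eq_zero {a b c d e f m : ℝ × ℝ} (h1 : det3 a b m = 0) (h2 : det3 c d m = 0)
    (h3 : det3 e f m = 0) : conc a b c d e f = 0 := by
  unfold det3 at h1 h2 h3
  unfold conc
  linear_combination ((c.2 - d.2) * (f.1 - e.1) - (e.2 - f.2) * (d.1 - c.1)) * h1
    - ((a.2 - b.2) * (f.1 - e.1) - (e.2 - f.2) * (b.1 - a.1)) * h2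
    + ((a.2 - b.2) * (d.1 - c.1) - (c.2 - d.2) * (b.1 - a.1)) * h3

section Generic

variable {ι : Type*} [Fintype ι]

/-- By the identity theorem an analytic function that is not identically zero vanishes on no open
set. -/
lemma isOpen_dense_ne_zero {E : Type*} [NormedAddCommGroup E] [NormedSpace ℝ E] {F : E → ℝ}
    (hF : ∀ q, AnalyticAt ℝ F q) {q₀ : E} (h0 : F q₀ ≠ 0) :
    IsOpen {q | F q ≠ 0} ∧ Dense {q | F q ≠ 0} := by
  refine ⟨isOpen_ne_fun (continuous_iff_continuousAt.2 fun q => (hF q).continuousAt)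
    continuous_const, ?_⟩
  intro q
  by_contra hq
  rw [mem_closure_iff_frequently] at hq
  have hev : F =ᶠ[nhds q] 0 := by
    simp only [Set.mem_ofPred_eq, Filter.not_frequently, not_not] at hq
    exact hq
  have := AnalyticOnNhd.eq_of_eventuallyEq (fun x _ => hF x) (fun x _ => analyticAt_const) hev
  exact h0 (congrFun this q₀)

/-- Points in general position: distinct abscissae, no three collinear, no three connecting lines
of six of them concurrent. -/
def Generic (q : ι → ℝ × ℝ) : Prop :=
  (∀ i j, i ≠ j → (q i).1 ≠ (q j).1) ∧
  (∀ i j k, i ≠ j → i ≠ k → j ≠ k → det3 (q i) (q j) (q k) ≠ 0) ∧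
  ∀ s : Fin 6 → ι, Function.Injective s →
    conc (q (s 0)) (q (s 1)) (q (s 2)) (q (s 3)) (q (s 4)) (q (s 5)) ≠ 0

/-- General position is the nonvanishing of finitely many polynomials; each of them only needs one
placement where it is nonzero. -/
lemma dense_generic : Dense {q : ι → ℝ × ℝ | Generic q} := by
  classical
  have a1 : ∀ (i : ι) (q : ι → ℝ × ℝ), AnalyticAt ℝ (fun q : ι → ℝ × ℝ => (q i).1) q := fun i q =>
    ((ContinuousLinearMap.fst ℝ ℝ ℝ).comp
      (ContinuousLinearMap.proj (R := ℝ) (φ := fun _ : ι => ℝ × ℝ) i)).analyticAt q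
  have a2 : ∀ (i : ι) (q : ι → ℝ × ℝ), AnalyticAt ℝ (fun q : ι → ℝ × ℝ => (q i).2) q := fun i q =>
    ((ContinuousLinearMap.snd ℝ ℝ ℝ).comp
      (ContinuousLinearMap.proj (R := ℝ) (φ := fun _ : ι => ℝ × ℝ) i)).analyticAt q
  let T₂ := {x : ι × ι // x.1 ≠ x.2}
  let T₃ := {x : ι × ι × ι // x.1 ≠ x.2.1 ∧ x.1 ≠ x.2.2 ∧ x.2.1 ≠ x.2.2}
  let T₆ := {s : Fin 6 → ι // Function.Injective s}
  let F : T₂ ⊕ T₃ ⊕ T₆ → (ι → ℝ × ℝ) → ℝ := fun t q => match t with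
    | Sum.inl x => (q x.1.1).1 - (q x.1.2).1
    | Sum.inr (Sum.inl x) => det3 (q x.1.1) (q x.1.2.1) (q x.1.2.2)
    | Sum.inr (Sum.inr s) =>
      conc (q (s.1 0)) (q (s.1 1)) (q (s.1 2)) (q (s.1 3)) (q (s.1 4)) (q (s.1 5))
  have hF : ∀ t, IsOpen {q | F t q ≠ 0} ∧ Dense {q | F t q ≠ 0} := by
    rintro (⟨⟨i, j⟩, hij⟩ | ⟨⟨i, j, k⟩, hij, hik, hjk⟩ | ⟨s, hs⟩)
    · refine isOpen_dense_ne_zero (q₀ := fun l => if l = i then (1, 0) else (0, 0))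
        (fun q => (a1 i q).sub (a1 j q)) ?_
      simp [F, Ne.symm hij]
    · refine isOpen_dense_ne_zero
        (q₀ := fun l => if l = i then (0, 0) else if l = j then (1, 0) else (0, 1))
        (fun q => (((a1 j q).sub (a1 i q)).mul ((a2 k q).sub (a2 i q))).sub
          (((a2 j q).sub (a2 i q)).mul ((a1 k q).sub (a1 i q)))) ?_
      simp [F, det3, Ne.symm hij, Ne.symm hik, Ne.symm hjk]
    -- The three lines become the sides of the triangle with corners `(0, 0)`, `(1, 0)`, `(0, 1)`.
    -- Coinciding points do no harm here.
    · refine isOpen_dense_ne_zero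
        (q₀ := fun l => if l = s 0 then (0, 0) else if l = s 1 then (0, 1) else
          if l = s 2 then (0, 0) else if l = s 3 then (1, 0) else if l = s 4 then (1, 0) else (0, 1))
        (fun q => ?_) ?_
      · have b : ∀ i, AnalyticAt ℝ (fun q : ι → ℝ × ℝ => (q (s i)).1) q := fun i => a1 _ q
        have c : ∀ i, AnalyticAt ℝ (fun q : ι → ℝ × ℝ => (q (s i)).2) q := fun i => a2 _ q
        have l1 : ∀ i j, AnalyticAt ℝ (fun q : ι → ℝ × ℝ => (q (s i)).2 - (q (s j)).2) q :=
          fun i j => (c i).sub (c j)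
        have l2 : ∀ i j, AnalyticAt ℝ (fun q : ι → ℝ × ℝ => (q (s i)).1 - (q (s j)).1) q :=
          fun i j => (b i).sub (b j)
        have l3 : ∀ i j, AnalyticAt ℝ
            (fun q : ι → ℝ × ℝ => (q (s i)).1 * (q (s j)).2 - (q (s i)).2 * (q (s j)).1) q :=
          fun i j => ((b i).mul (c j)).sub ((c i).mul (b j))
        exact (((l1 0 1).mul (((l2 3 2).mul (l3 4 5)).sub ((l2 5 4).mul (l3 2 3)))).sub
          ((l2 1 0).mul (((l1 2 3).mul (l3 4 5)).sub ((l1 4 5).mul (l3 2 3))))).add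
          ((l3 0 1).mul (((l1 2 3).mul (l2 5 4)).sub ((l1 4 5).mul (l2 3 2))))
      · simp [F, conc, hs.eq_iff]
  have hd := dense_iInter_of_isOpen (fun t => (hF t).1) (fun t => (hF t).2)
  refine hd.mono fun q hq => ?_
  rw [Set.mem_iInter] at hq
  exact ⟨fun i j hij => sub_ne_zero.1 (hq (Sum.inl ⟨(i, j), hij⟩)),
    fun i j k hij hik hjk => hq (Sum.inr (Sum.inl ⟨(i, j, k), hij, hik, hjk⟩)),
    fun s hs => hq (Sum.inr (Sum.inr ⟨s, hs⟩))⟩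

/-- Any placement with an open property can be perturbed to one in general position. -/
lemma exists_generic {O : Set (ι → ℝ × ℝ)} (hO : IsOpen O) {p : ι → ℝ × ℝ} (hp : p ∈ O) :
    ∃ p' ∈ O, Generic p' := by
  obtain ⟨q, hq, hqO⟩ := dense_generic.exists_mem_open hO ⟨p, hp⟩
  exact ⟨q, hqO, hq⟩

/-- Points that coincide can be kept together in a perturbation to general position. -/
lemma exists_perturbation {O : Set (ι → ℝ × ℝ)} (hO : IsOpen O) {p : ι → ℝ × ℝ} (hp : p ∈ O) :
    ∃ p' ∈ O, (∀ u v, p' u = p' v ↔ p u = p v) ∧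
      ∀ u v w, p' u ≠ p' v → p' u ≠ p' w → p' v ≠ p' w → det3 (p' u) (p' v) (p' w) ≠ 0 := by
  classical
  -- Perturbing positions instead of vertices keeps coincident vertices together.
  let Φ : (Set.range p → ℝ × ℝ) → (ι → ℝ × ℝ) := fun q v => q ⟨p v, v, rfl⟩
  have hΦ : Continuous Φ := by fun_prop
  have : Fintype (Set.range p) := Fintype.ofFinite _
  obtain ⟨q, hqO, hq⟩ := exists_generic (hO.preimage hΦ) (p := fun x => x.1) (by exact hp)
  have hinj : Function.Injective q := fun i j hij => by
    by_contra h
    exact hq.1 i j h (by rw [hij])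
  refine ⟨Φ q, hqO, fun u v => ?_, fun u v w h1 h2 h3 => ?_⟩
  · exact hinj.eq_iff.trans Subtype.ext_iff
  · exact hq.2.1 _ _ _ (fun h => h1 (congrArg q h)) (fun h => h2 (congrArg q h))
      (fun h => h3 (congrArg q h))

end Generic

/-- Disjointness of segments is an open condition. -/
lemma isOpen_disjoint_segment :
    IsOpen {x : (ℝ × ℝ) × (ℝ × ℝ) × (ℝ × ℝ) × (ℝ × ℝ) |
      Disjoint (segment ℝ x.1 x.2.1) (segment ℝ x.2.2.1 x.2.2.2)} := by
  let I := Set.Icc (0 : ℝ) 1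
  -- The pairs of parameters range over a compact set, so the projection of the closed set of
  -- coincidences is closed.
  let C : Set ((I × I) × ((ℝ × ℝ) × (ℝ × ℝ) × (ℝ × ℝ) × (ℝ × ℝ))) :=
    {y | (1 - y.1.1.1) • y.2.1 + y.1.1.1 • y.2.2.1 =
      (1 - y.1.2.1) • y.2.2.2.1 + y.1.2.1 • y.2.2.2.2}
  have hC : IsClosed C := isClosed_eq (by fun_prop) (by fun_prop)
  have := isClosedMap_snd_of_compactSpace C hC
  rw [← isOpen_compl_iff] at this
  convert this using 1
  ext x
  simp only [segment_eq_image, Set.mem_compl_iff, Set.mem_image, Set.mem_ofPred_eq, Set.disjoint_left]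
  constructor
  · rintro h ⟨y, hy, rfl⟩
    exact h ⟨y.1.1.1, y.1.1.2, hy⟩ ⟨y.1.2.1, y.1.2.2, rfl⟩
  · rintro h _ ⟨s, hs, rfl⟩ ⟨t, ht, hst⟩
    exact h ⟨((⟨s, hs⟩, ⟨t, ht⟩), x), hst.symm, rfl⟩

lemma isOpen_disjoint_segment' {X : Type*} [TopologicalSpace X] {a b c d : X → ℝ × ℝ}
    (ha : Continuous a) (hb : Continuous b) (hc : Continuous c) (hd : Continuous d) :
    IsOpen {x | Disjoint (segment ℝ (a x) (b x)) (segment ℝ (c x) (d x))} :=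
  isOpen_disjoint_segment.preimage (ha.prodMk (hb.prodMk (hc.prodMk hd)))

/-- The point `q` lies in the interior of the nondegenerate triangle `abc`. -/
def InTri (a b c q : ℝ × ℝ) : Prop :=
  0 < det3 q b c * det3 a b c ∧ 0 < det3 a q c * det3 a b c ∧ 0 < det3 a b q * det3 a b c

lemma continuous_det3 {X : Type*} [TopologicalSpace X] {a b c : X → ℝ × ℝ}
    (ha : Continuous a) (hb : Continuous b) (hc : Continuous c) :
    Continuous fun x => det3 (a x) (b x) (c x) := by
  unfold det3; fun_prop

lemma isOpen_inTri {X : Type*} [TopologicalSpace X] {a b c q : X → ℝ × ℝ}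
    (ha : Continuous a) (hb : Continuous b) (hc : Continuous c) (hq : Continuous q) :
    IsOpen {x | InTri (a x) (b x) (c x) (q x)} := by
  have h0 := continuous_det3 ha hb hc
  exact (isOpen_lt continuous_const ((continuous_det3 hq hb hc).mul h0)).inter
    ((isOpen_lt continuous_const ((continuous_det3 ha hq hc).mul h0)).inter
      (isOpen_lt continuous_const ((continuous_det3 ha hb hq).mul h0)))

/-- `q` lies in the closed triangle `abc`, which is assumed to be nondegenerate where this is
used. -/
def InCTri (a b c q : ℝ × ℝ) : Prop :=
  0 ≤ det3 q b c * det3 a b c ∧ 0 ≤ det3 a q c * det3 a b c ∧ 0 ≤ det3 a b q * det3 a b c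

variable {a b c q r : ℝ × ℝ}

lemma InTri.inCTri (h : InTri a b c q) : InCTri a b c q := ⟨h.1.le, h.2.1.le, h.2.2.le⟩

lemma InTri.det_ne (h : InTri a b c q) : det3 a b c ≠ 0 := fun h0 => by
  simpa [h0] using h.1

lemma det3_sum (a b c q : ℝ × ℝ) : det3 q b c + det3 a q c + det3 a b q = det3 a b c := by
  unfold det3; ring

/-- Barycentric coordinates. -/
lemma bary (a b c q : ℝ × ℝ) :
    det3 a b c * q.1 = det3 q b c * a.1 + det3 a q c * b.1 + det3 a b q * c.1 ∧
    det3 a b c * q.2 = det3 q b c * a.2 + det3 a q c * b.2 + det3 a b q * c.2 := by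
  unfold det3; constructor <;> ring

lemma det3_bary (a b c q u v : ℝ × ℝ) :
    det3 a b c * det3 q u v = det3 q b c * det3 a u v + det3 a q c * det3 b u v +
      det3 a b q * det3 c u v := by
  unfold det3; ring

lemma det3_comb₃ (u v m : ℝ × ℝ) {x y : ℝ × ℝ} {t : ℝ} (h1 : m.1 = (1 - t) * x.1 + t * y.1)
    (h2 : m.2 = (1 - t) * x.2 + t * y.2) :
    det3 u v m = (1 - t) * det3 u v x + t * det3 u v y := by
  unfold det3; rw [h1, h2]; ring

lemma det3_comb₂ (u v m : ℝ × ℝ) {x y : ℝ × ℝ} {t : ℝ} (h1 : m.1 = (1 - t) * x.1 + t * y.1)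
    (h2 : m.2 = (1 - t) * x.2 + t * y.2) :
    det3 u m v = (1 - t) * det3 u x v + t * det3 u y v := by
  unfold det3; rw [h1, h2]; ring

lemma det3_comb₁ (u v m : ℝ × ℝ) {x y : ℝ × ℝ} {t : ℝ} (h1 : m.1 = (1 - t) * x.1 + t * y.1)
    (h2 : m.2 = (1 - t) * x.2 + t * y.2) :
    det3 m u v = (1 - t) * det3 x u v + t * det3 y u v := by
  unfold det3; rw [h1, h2]; ring

lemma InCTri.segment {m : ℝ × ℝ} (hq : InCTri a b c q) (hr : InCTri a b c r)
    (hm : m ∈ segment ℝ q r) : InCTri a b c m := by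
  obtain ⟨t, h0, h1, h2, h3⟩ := mem_seg.1 hm
  have h0' : 0 ≤ 1 - t := by linarith
  obtain ⟨q1, q2, q3⟩ := hq
  obtain ⟨r1, r2, r3⟩ := hr
  refine ⟨?_, ?_, ?_⟩
  · rw [det3_comb₁ b c m h2 h3]; nlinarith [mul_nonneg h0' q1, mul_nonneg h0 r1]
  · rw [det3_comb₂ a c m h2 h3]; nlinarith [mul_nonneg h0' q2, mul_nonneg h0 r2]
  · rw [det3_comb₃ a b m h2 h3]; nlinarith [mul_nonneg h0' q3, mul_nonneg h0 r3]

end Geometry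

end RectilinearCrossing


namespace RectilinearCrossing

/-! ### Segments and points relative to triangles. -/

section Triangles

variable {a b c q r x y z u v m : ℝ × ℝ}

lemma InTri.rotate (h : InTri a b c q) : InTri b c a q := by
  unfold InTri at *
  rw [← det3_cycle a b c, ← det3_cycle a q c, ← det3_cycle a b q, ← det3_cycle q b c]
  tauto

lemma InCTri.rotate (h : InCTri a b c q) : InCTri b c a q := by
  unfold InCTri at *
  rw [← det3_cycle a b c, ← det3_cycle a q c, ← det3_cycle a b q, ← det3_cycle q b c]
  tauto

lemma InCTri.swap (h : InCTri a b c q) : InCTri b a c q := by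
  unfold InCTri at *
  rw [det3_swap b a c, det3_swap q a c, det3_swap b q c, det3_swap b a q]
  simp only [neg_mul_neg]
  tauto

lemma inCTri_left : InCTri a b c a := by
  unfold InCTri
  refine ⟨mul_self_nonneg _, ?_, ?_⟩ <;> simp [det3]

lemma inCTri_mid : InCTri a b c b := (inCTri_left (a := b) (b := c) (c := a)).rotate.rotate

lemma inCTri_right : InCTri a b c c := (inCTri_left (a := c) (b := a) (c := b)).rotate

/-- Affine functionals are averaged by barycentric coordinates. -/
lemma det3_sq_mul (x y z q u v : ℝ × ℝ) (k : ℝ) :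
    det3 x y z ^ 2 * (det3 q u v * k) = (det3 q y z * det3 x y z) * (det3 x u v * k) +
      (det3 x q z * det3 x y z) * (det3 y u v * k) +
      (det3 x y q * det3 x y z) * (det3 z u v * k) := by
  have := det3_bary x y z q u v
  linear_combination (det3 x y z * k) * this

/-- The point `q` has positive barycentric coordinates in `xyz`, so a side functional of `abc` that
is nonnegative at `x`, `y` and positive at `z` is positive at `q`. One strictly interior corner
suffices, and the other two may be corners of `abc`. -/
lemma InTri.trans (hx : InCTri a b c x) (hy : InCTri a b c y) (hz : InTri a b c z)
    (hq : InTri x y z q) : InTri a b c q := by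
  have hD : 0 < det3 x y z ^ 2 := by have := hq.det_ne; positivity
  have key : ∀ u v : ℝ × ℝ, 0 ≤ det3 x u v * det3 a b c → 0 ≤ det3 y u v * det3 a b c →
      0 < det3 z u v * det3 a b c → 0 < det3 q u v * det3 a b c := by
    intro u v h1 h2 h3
    refine pos_of_mul_pos_right (a := det3 x y z ^ 2) ?_ hD.le
    rw [det3_sq_mul]
    have := mul_nonneg hq.1.le h1
    have := mul_nonneg hq.2.1.le h2
    have := mul_pos hq.2.2 h3
    linarith
  obtain ⟨x1, x2, x3⟩ := hx
  obtain ⟨y1, y2, y3⟩ := hy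
  obtain ⟨z1, z2, z3⟩ := hz
  rw [det3_cycle a x c] at x2
  rw [det3_cycle a y c] at y2
  rw [det3_cycle a z c] at z2
  rw [← det3_cycle x a b] at x3
  rw [← det3_cycle y a b] at y3
  rw [← det3_cycle z a b] at z3
  refine ⟨key b c x1 y1 z1, ?_, ?_⟩
  · rw [det3_cycle a q c]; exact key c a x2 y2 z2
  · rw [← det3_cycle q a b]; exact key a b x3 y3 z3

/-- The functional of the side `ca` vanishes at `a` but is positive at `x` and `y`, so these have
weight zero in `a`. This keeps an outer root out of an inner triangle, even if the third corner of
that triangle is a root. -/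
lemma eq_of_corner_mem (hD : det3 x y z ≠ 0) (hx : InTri a b c x) (hy : InTri a b c y)
    (hz : InCTri a b c z) (ha : InCTri x y z a) : a = z := by
  have hD' : 0 < det3 x y z ^ 2 := by positivity
  have key := det3_sq_mul x y z a c a (det3 a b c)
  obtain ⟨-, x2, -⟩ := hx
  obtain ⟨-, y2, -⟩ := hy
  obtain ⟨-, z2, -⟩ := hz
  rw [det3_cycle a x c] at x2
  rw [det3_cycle a y c] at y2
  rw [det3_cycle a z c] at z2
  have h0 : det3 a c a = 0 := by unfold det3; ring
  rw [h0] at key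
  obtain ⟨a1, a2, a3⟩ := ha
  have p1 := mul_nonneg a1 x2.le
  have p2 := mul_nonneg a2 y2.le
  have p3 := mul_nonneg a3 z2
  have e1 : det3 a y z = 0 := by
    have : det3 a y z * det3 x y z * (det3 x c a * det3 a b c) = 0 := by linarith
    rcases mul_eq_zero.1 this with h | h
    · exact (mul_eq_zero.1 h).resolve_right hD
    · exact absurd h x2.ne'
  have e2 : det3 x a z = 0 := by
    have : det3 x a z * det3 x y z * (det3 y c a * det3 a b c) = 0 := by linarith
    rcases mul_eq_zero.1 this with h | h
    · exact (mul_eq_zero.1 h).resolve_right hD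
    · exact absurd h y2.ne'
  have e3 := det3_sum x y z a
  obtain ⟨b1, b2⟩ := bary x y z a
  rw [e1, e2] at b1 b2 e3
  simp only [zero_mul, zero_add] at b1 b2 e3
  rw [e3] at b1 b2
  exact Prod.ext (mul_left_cancel₀ hD b1) (mul_left_cancel₀ hD b2)

/-- A point of the closed triangle on the line of a side lies on that side. -/
lemma mem_side (hD : det3 x y z ≠ 0) (hm : InCTri x y z m) (h0 : det3 m y z = 0) :
    m ∈ segment ℝ y z := by
  have hD' : 0 < det3 x y z ^ 2 := by positivity
  obtain ⟨-, h2, h3⟩ := hm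
  have hs := det3_sum x y z m
  obtain ⟨b1, b2⟩ := bary x y z m
  rw [h0] at hs b1 b2
  refine mem_seg.2 ⟨det3 x y m / det3 x y z, ?_, ?_, ?_, ?_⟩
  · rw [div_eq_mul_inv]
    have : det3 x y m * (det3 x y z)⁻¹ = (det3 x y m * det3 x y z) / det3 x y z ^ 2 := by
      field_simp
    rw [this]; positivity
  · have : 1 - det3 x y m / det3 x y z = (det3 x m z * det3 x y z) / det3 x y z ^ 2 := by
      field_simp; linarith
    have h5 : 0 ≤ (det3 x m z * det3 x y z) / det3 x y z ^ 2 := by positivity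
    linarith
  · field_simp; linear_combination b1 + y.1 * hs
  · field_simp; linear_combination b2 + y.2 * hs

/-- A segment can enter a triangle only through its boundary. -/
lemma not_mem_tri_of_disjoint (hD : det3 x y z ≠ 0) (hu : ¬ InCTri x y z u)
    (h1 : Disjoint (segment ℝ u v) (segment ℝ x y)) (h2 : Disjoint (segment ℝ u v) (segment ℝ y z))
    (h3 : Disjoint (segment ℝ u v) (segment ℝ z x)) :
    ∀ m ∈ segment ℝ u v, ¬ InCTri x y z m := by
  intro m hm hmT
  let g : ℝ → ℝ × ℝ := fun t => (1 - t) • u + t • m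
  have hg : Continuous g := by fun_prop
  -- The smallest oriented barycentric coordinate along the way from `u` to `m`. It changes sign,
  -- and at a zero the point is on a side.
  let f : ℝ → ℝ := fun t => min (det3 (g t) y z * det3 x y z)
    (min (det3 x (g t) z * det3 x y z) (det3 x y (g t) * det3 x y z))
  have hf : Continuous f := by
    have h0 : Continuous fun _ : ℝ => det3 x y z := continuous_const
    exact ((continuous_det3 hg continuous_const continuous_const).mul h0).min
      (((continuous_det3 continuous_const hg continuous_const).mul h0).min
        ((continuous_det3 continuous_const continuous_const hg).mul h0))
  have hf0 : f 0 ≤ 0 := by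
    have : g 0 = u := by simp [g]
    simp only [f, this]
    by_contra! h
    simp only [lt_min_iff] at h
    exact hu ⟨h.1.le, h.2.1.le, h.2.2.le⟩
  have hf1 : 0 ≤ f 1 := by
    have : g 1 = m := by simp [g]
    simp only [f, this]
    exact le_min hmT.1 (le_min hmT.2.1 hmT.2.2)
  obtain ⟨t, ht, htf⟩ := intermediate_value_Icc (zero_le_one) hf.continuousOn ⟨hf0, hf1⟩
  have hgt : g t ∈ segment ℝ u v := by
    have h : g t ∈ segment ℝ u m := by
      rw [segment_eq_image]; exact ⟨t, ht, rfl⟩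
    exact (convex_segment u v).segment_subset (left_mem_segment ℝ u v) hm h
  have hT : InCTri x y z (g t) := by
    have h : 0 ≤ f t := htf.ge
    simp only [f, le_min_iff] at h
    exact h
  have hz : det3 (g t) y z = 0 ∨ det3 x (g t) z = 0 ∨ det3 x y (g t) = 0 := by
    by_contra! hne
    have : 0 < f t := by
      simp only [f, lt_min_iff]
      exact ⟨lt_of_le_of_ne hT.1 (mul_ne_zero hne.1 hD).symm,
        lt_of_le_of_ne hT.2.1 (mul_ne_zero hne.2.1 hD).symm,
        lt_of_le_of_ne hT.2.2 (mul_ne_zero hne.2.2 hD).symm⟩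
    exact this.ne' htf
  rcases hz with hz | hz | hz
  · exact Set.disjoint_left.1 h2 hgt (mem_side hD hT hz)
  · refine Set.disjoint_left.1 h3 hgt (mem_side (x := y) ?_ hT.rotate ?_)
    · rwa [← det3_cycle]
    · rwa [det3_cycle x (g t) z] at hz
  · refine Set.disjoint_left.1 h1 hgt (mem_side (x := z) ?_ hT.rotate.rotate ?_)
    · rwa [det3_cycle]
    · rwa [det3_cycle]

/-- If the segment met the triangle before reaching `x`, then `u` would lie in the angle at `x` but
beyond the side `yz`, so the segment would cross `yz`. -/
lemma eq_corner_of_mem_tri (hD : det3 x y z ≠ 0) (hu : ¬ InCTri x y z u)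
    (hd : Disjoint (segment ℝ u x) (segment ℝ y z)) (hm : m ∈ segment ℝ u x)
    (hmT : InCTri x y z m) : m = x := by
  obtain ⟨t, h0, h1, e1, e2⟩ := mem_seg.1 hm
  by_contra hmx
  have ht : 0 < 1 - t := by
    rcases lt_or_eq_of_le h1 with h | h
    · linarith
    · exact absurd (Prod.ext (by simp [e1, h]) (by simp [e2, h])) hmx
  have hD' : 0 < det3 x y z ^ 2 := by positivity
  obtain ⟨-, m2, m3⟩ := hmT
  rw [det3_comb₂ x z m e1 e2] at m2
  rw [det3_comb₃ x y m e1 e2] at m3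
  have z1 : det3 x x z = 0 := by unfold det3; ring
  have z2 : det3 x y x = 0 := by unfold det3; ring
  rw [z1, mul_zero, add_zero, mul_assoc] at m2
  rw [z2, mul_zero, add_zero, mul_assoc] at m3
  have u2 := nonneg_of_mul_nonneg_right m2 ht
  have u3 := nonneg_of_mul_nonneg_right m3 ht
  have u1 : det3 u y z * det3 x y z < 0 := by
    by_contra! h
    exact hu ⟨h, u2, u3⟩
  set α := det3 u y z * det3 x y z with hα
  have hpos : 0 < det3 x y z ^ 2 - α := by linarith
  -- The parameter at which the coordinate belonging to `x` vanishes: it is affine, with value `α <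
  -- 0` at `u` and `det3 x y z ^ 2` at `x`.
  let s := -α / (det3 x y z ^ 2 - α)
  have hs0 : 0 ≤ s := div_nonneg (by linarith) hpos.le
  have hs1 : s ≤ 1 := by rw [div_le_one hpos]; linarith
  have hs1' : 0 ≤ 1 - s := by linarith
  let w : ℝ × ℝ := ((1 - s) * u.1 + s * x.1, (1 - s) * u.2 + s * x.2)
  have hw : w ∈ segment ℝ u x := mem_seg.2 ⟨s, hs0, hs1, rfl, rfl⟩
  have w1 : det3 w y z = 0 := by
    rw [det3_comb₁ (t := s) (x := u) (y := x) y z w rfl rfl]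
    have : det3 x y z * ((1 - s) * det3 u y z + s * det3 x y z) = 0 := by
      have h : (1 - s) * α + s * det3 x y z ^ 2 = 0 := by
        simp only [s]; field_simp; ring
      rw [hα] at h
      linear_combination h
    exact (mul_eq_zero.1 this).resolve_left hD
  have hwT : InCTri x y z w := by
    refine ⟨by rw [w1, zero_mul], ?_, ?_⟩
    · rw [det3_comb₂ (t := s) (x := u) (y := x) x z w rfl rfl, z1, mul_zero, add_zero, mul_assoc]
      positivity
    · rw [det3_comb₃ (t := s) (x := u) (y := x) x y w rfl rfl, z2, mul_zero, add_zero, mul_assoc]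
      positivity
  exact Set.disjoint_left.1 hd hw (mem_side hD hwT w1)

/-- A corner of a triangle is an extreme point. -/
lemma corner_notMem_segment (hD : det3 x y z ≠ 0) (hq : InCTri x y z q) (hr : InCTri x y z r)
    (hqx : q ≠ x) (hrx : r ≠ x) : x ∉ segment ℝ q r := by
  have hD' : 0 < det3 x y z ^ 2 := by positivity
  -- The coordinate belonging to `x` attains its maximum over the triangle only at `x`.
  have key : ∀ q, InCTri x y z q → q ≠ x → det3 q y z * det3 x y z < det3 x y z ^ 2 := by
    intro q hq hqx
    have hs := det3_sum x y z q
    obtain ⟨h1, h2, h3⟩ := hq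
    by_contra! h
    have hsum : det3 q y z * det3 x y z + det3 x q z * det3 x y z + det3 x y q * det3 x y z =
        det3 x y z ^ 2 := by rw [← add_mul, ← add_mul, hs]; ring
    have e2 : det3 x q z = 0 := (mul_eq_zero.1 (by linarith : det3 x q z * det3 x y z = 0)).resolve_right hD
    have e3 : det3 x y q = 0 := (mul_eq_zero.1 (by linarith : det3 x y q * det3 x y z = 0)).resolve_right hD
    obtain ⟨b1, b2⟩ := bary x y z q
    rw [e2, e3] at hs b1 b2
    simp only [zero_mul, add_zero] at b1 b2 hs
    rw [hs] at b1 b2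
    exact hqx (Prod.ext (mul_left_cancel₀ hD b1) (mul_left_cancel₀ hD b2))
  intro hx
  obtain ⟨t, h0, h1, e1, e2⟩ := mem_seg.1 hx
  have hk := det3_comb₁ y z x e1 e2
  have kq := key q hq hqx
  have kr := key r hr hrx
  have : det3 x y z ^ 2 = (1 - t) * (det3 q y z * det3 x y z) + t * (det3 r y z * det3 x y z) := by
    linear_combination det3 x y z * hk
  rcases eq_or_lt_of_le h0 with h | h
  · rw [← h] at this; linarith
  · nlinarith [mul_nonneg (by linarith : 0 ≤ 1 - t) (by linarith :
      0 ≤ det3 x y z ^ 2 - det3 q y z * det3 x y z), mul_pos h (by linarith :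
      0 < det3 x y z ^ 2 - det3 r y z * det3 x y z)]

/-- Two nondegenerate triangles are related by an affine map. -/
lemma exists_affine {a' b' c' : ℝ × ℝ} (hD : det3 a b c ≠ 0) (hD' : det3 a' b' c' ≠ 0) :
    ∃ L : ℝ × ℝ → ℝ × ℝ, L a = a' ∧ L b = b' ∧ L c = c' ∧ Function.Injective L ∧
      (∀ p q, segment ℝ (L p) (L q) = L '' segment ℝ p q) ∧
      (∀ q, InTri a b c q → InTri a' b' c' (L q)) := by
  let L : ℝ × ℝ → ℝ × ℝ := fun q =>
    ((det3 q b c * a'.1 + det3 a q c * b'.1 + det3 a b q * c'.1) / det3 a b c,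
      (det3 q b c * a'.2 + det3 a q c * b'.2 + det3 a b q * c'.2) / det3 a b c)
  -- `L` preserves barycentric coordinates and so scales all signed areas by the same factor.
  -- Injectivity and the inclusion of interiors follow from this.
  have hdet : ∀ p q r, det3 (L p) (L q) (L r) = det3 a' b' c' / det3 a b c * det3 p q r := by
    intro p q r
    simp only [L]
    have h1 : det3 a b c = det3 p b c + det3 a p c + det3 a b p := (det3_sum a b c p).symm
    have h2 : det3 a b c = det3 q b c + det3 a q c + det3 a b q := (det3_sum a b c q).symm
    have h3 : det3 a b c = det3 r b c + det3 a r c + det3 a b r := (det3_sum a b c r).symm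
    obtain ⟨p1, p2⟩ := bary a b c p
    obtain ⟨q1, q2⟩ := bary a b c q
    obtain ⟨r1, r2⟩ := bary a b c r
    have hp : det3 p b c = det3 a b c - det3 a p c - det3 a b p := by linarith
    have hq : det3 q b c = det3 a b c - det3 a q c - det3 a b q := by linarith
    have hr : det3 r b c = det3 a b c - det3 a r c - det3 a b r := by linarith
    rw [hp, hq, hr]
    have key : det3 a b c * det3 p q r = (det3 a q c - det3 a p c) * (det3 a b r - det3 a b p) -
        (det3 a b q - det3 a b p) * (det3 a r c - det3 a p c) := by
      unfold det3; ring
    rw [div_mul_eq_mul_div, eq_div_iff hD]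
    have h' : det3 a' b' c' * det3 p q r = det3 a' b' c' * ((det3 a q c - det3 a p c) *
        (det3 a b r - det3 a b p) -
        (det3 a b q - det3 a b p) * (det3 a r c - det3 a p c)) / det3 a b c := by
      rw [← key]; field_simp
    rw [h']
    generalize det3 a b c = D at *
    generalize det3 a p c = s1 at *
    generalize det3 a q c = s2 at *
    generalize det3 a r c = s3 at *
    generalize det3 a b p = t1 at *
    generalize det3 a b q = t2 at *
    generalize det3 a b r = t3 at *
    unfold det3
    field_simp
    ring
  have hk : det3 a' b' c' / det3 a b c ≠ 0 := div_ne_zero hD' hD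
  have za : det3 a a c = 0 ∧ det3 a b a = 0 := by unfold det3; constructor <;> ring
  have zb : det3 b b c = 0 ∧ det3 a b b = 0 := by unfold det3; constructor <;> ring
  have zc : det3 c b c = 0 ∧ det3 a c c = 0 := by unfold det3; constructor <;> ring
  have La : L a = a' := by
    simp only [L, za.1, za.2]
    exact Prod.ext (by field_simp; simp) (by field_simp; simp)
  have Lb : L b = b' := by
    simp only [L, zb.1, zb.2]
    exact Prod.ext (by field_simp; simp) (by field_simp; simp)
  have Lc : L c = c' := by
    simp only [L, zc.1, zc.2]
    exact Prod.ext (by field_simp; simp) (by field_simp; simp)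
  refine ⟨L, La, Lb, Lc, ?_, ?_, ?_⟩
  · intro p q hpq
    have h1 : det3 p b c = det3 q b c := by
      have h1 := hdet p b c; have h2 := hdet q b c
      rw [hpq, h2] at h1; exact (mul_left_cancel₀ hk h1).symm
    have h2 : det3 a p c = det3 a q c := by
      have h1 := hdet a p c; have h2 := hdet a q c
      rw [hpq, h2] at h1; exact (mul_left_cancel₀ hk h1).symm
    have h3 : det3 a b p = det3 a b q := by
      have h1 := hdet a b p; have h2 := hdet a b q
      rw [hpq, h2] at h1; exact (mul_left_cancel₀ hk h1).symm
    obtain ⟨p1, p2⟩ := bary a b c p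
    obtain ⟨q1, q2⟩ := bary a b c q
    rw [h1, h2, h3, ← q1] at p1
    rw [h1, h2, h3, ← q2] at p2
    exact Prod.ext (mul_left_cancel₀ hD p1) (mul_left_cancel₀ hD p2)
  · intro p q
    have hcomb : ∀ t : ℝ, (1 - t) • L p + t • L q = L ((1 - t) • p + t • q) := by
      intro t
      have e1 : ((1 - t) • p + t • q).1 = (1 - t) * p.1 + t * q.1 := by simp
      have e2 : ((1 - t) • p + t • q).2 = (1 - t) * p.2 + t * q.2 := by simp
      simp only [L]
      rw [det3_comb₁ b c _ e1 e2, det3_comb₂ a c _ e1 e2, det3_comb₃ a b _ e1 e2]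
      refine Prod.ext ?_ ?_ <;> simp <;> field_simp <;> ring
    simp only [segment_eq_image, Set.image_image, hcomb]
  · rintro q ⟨h1, h2, h3⟩
    refine ⟨?_, ?_, ?_⟩
    · rw [← La, ← Lb, ← Lc, hdet, hdet]
      have : 0 < (det3 a' b' c' / det3 a b c) ^ 2 := by positivity
      nlinarith [mul_pos this h1]
    · rw [← La, ← Lb, ← Lc, hdet, hdet]
      have : 0 < (det3 a' b' c' / det3 a b c) ^ 2 := by positivity
      nlinarith [mul_pos this h2]
    · rw [← La, ← Lb, ← Lc, hdet, hdet]
      have : 0 < (det3 a' b' c' / det3 a b c) ^ 2 := by positivity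
      nlinarith [mul_pos this h3]

end Triangles

end RectilinearCrossing


namespace RectilinearCrossing

/-! ### Angles around a vertex and the direction for splitting it. -/

section Directions

/-- The determinant of two plane vectors. -/
def det2 (u v : ℝ × ℝ) : ℝ := u.1 * v.2 - u.2 * v.1

lemma det3_eq_det2 (w u v : ℝ × ℝ) : det3 w u v = det2 (u - w) (v - w) := by
  unfold det3 det2; simp

/-- The ray from `w` through `b` lies strictly between the rays through `u` and `v`. -/
def InCone (w u v b : ℝ × ℝ) : Prop :=
  0 < det3 w u b * det3 w u v ∧ 0 < det3 w b v * det3 w u v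

/-- Angles of vectors, measured from the direction opposite to `B`. -/
lemma exists_angle {B : ℝ × ℝ} (hB : B ≠ 0) : ∃ g : ℝ × ℝ → ℝ, g B = Real.pi ∧
    (∀ U, det2 B U ≠ 0 → -Real.pi < g U ∧ g U < Real.pi) ∧
    (∀ U V, U ≠ 0 → V ≠ 0 → ∃ k > 0, det2 U V = k * Real.sin (g V - g U)) ∧
    ∀ δ : ℝ, ∃ d : ℝ × ℝ, ∀ U, U ≠ 0 → ∃ k > 0, det2 U d = k * Real.sin (δ - g U) := by
  let C : ℝ × ℝ → ℂ := fun U => ⟨U.1, U.2⟩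
  -- Rotates `B` onto the negative real axis, so that the branch cut of `Complex.arg` runs along
  -- `B`.
  let Z : ℝ × ℝ → ℂ := fun U => -((starRingEnd ℂ) (C B) * C U)
  have hN : 0 < B.1 ^ 2 + B.2 ^ 2 := by
    by_contra! h
    have h1 : B.1 = 0 := by nlinarith [sq_nonneg B.1, sq_nonneg B.2]
    have h2 : B.2 = 0 := by nlinarith [sq_nonneg B.1, sq_nonneg B.2]
    exact hB (Prod.ext h1 h2)
  have hre : ∀ U, (Z U).re = -(B.1 * U.1 + B.2 * U.2) := fun U => by simp [Z, C]
  have him : ∀ U, (Z U).im = -(B.1 * U.2 - B.2 * U.1) := fun U => by simp [Z, C]; ring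
  have hZ : ∀ U, U ≠ 0 → Z U ≠ 0 := by
    intro U hU h
    have h1 := hre U
    have h2 := him U
    rw [h] at h1 h2
    simp only [Complex.zero_re, Complex.zero_im] at h1 h2
    have e1 : (B.1 ^ 2 + B.2 ^ 2) * U.1 = 0 := by linear_combination B.1 * h1 - B.2 * h2
    have e2 : (B.1 ^ 2 + B.2 ^ 2) * U.2 = 0 := by linear_combination B.2 * h1 + B.1 * h2
    exact hU (Prod.ext ((mul_eq_zero.1 e1).resolve_left hN.ne')
      ((mul_eq_zero.1 e2).resolve_left hN.ne'))
  have hcross : ∀ U V, (B.1 ^ 2 + B.2 ^ 2) * det2 U V = (Z U).re * (Z V).im - (Z U).im * (Z V).re := by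
    intro U V
    rw [hre, hre, him, him, det2]; ring
  have hcos : ∀ z : ℂ, z.re = ‖z‖ * Real.cos z.arg := fun z => (Complex.norm_mul_cos_arg z).symm
  have hsin : ∀ z : ℂ, z.im = ‖z‖ * Real.sin z.arg := fun z => (Complex.norm_mul_sin_arg z).symm
  refine ⟨fun U => (Z U).arg, ?_, ?_, ?_, ?_⟩
  · refine Complex.arg_eq_pi_iff.2 ⟨?_, ?_⟩
    · rw [hre]; nlinarith
    · rw [him]; ring
  · intro U hU
    refine ⟨Complex.neg_pi_lt_arg _, lt_of_le_of_ne (Complex.arg_le_pi _) fun h => hU ?_⟩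
    have := (Complex.arg_eq_pi_iff.1 h).2
    rw [him] at this
    unfold det2; linarith
  · intro U V hU hV
    refine ⟨‖Z U‖ * ‖Z V‖ / (B.1 ^ 2 + B.2 ^ 2), ?_, ?_⟩
    · have := norm_pos_iff.2 (hZ U hU)
      have := norm_pos_iff.2 (hZ V hV)
      positivity
    · have := hcross U V
      rw [hcos (Z U), hcos (Z V), hsin (Z U), hsin (Z V)] at this
      rw [Real.sin_sub]
      field_simp
      linear_combination this
  · intro δ
    -- This is `-B` rotated by `δ`, so `Z d` has argument `δ`.
    let d : ℝ × ℝ := (-(B.1 * Real.cos δ - B.2 * Real.sin δ), -(B.1 * Real.sin δ + B.2 * Real.cos δ))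
    refine ⟨d, fun U hU => ⟨‖Z U‖, norm_pos_iff.2 (hZ U hU), ?_⟩⟩
    have h1 := hre U
    have h2 := him U
    rw [hcos] at h1
    rw [hsin] at h2
    rw [Real.sin_sub]
    unfold det2
    simp only [d]
    linear_combination (-Real.sin δ) * h1 + Real.cos δ * h2

/-- If `c - a < π`, then `c < π` makes `sin c` positive and `c > π` forces `0 < a < π`; for `c = π`
the two sines agree. The case `c - a > π` is the same with signs reversed. -/
lemma sin_split {a c h : ℝ} (hh : 0 < h) (hhp : h < Real.pi) (ha : -h ≤ a) (ha' : a ≤ h)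
    (hc : h ≤ c) (hc' : c ≤ 2 * Real.pi - h) (hne : Real.sin (c - a) ≠ 0) :
    0 < Real.sin c * Real.sin (c - a) ∨ 0 < Real.sin a * Real.sin (c - a) := by
  have neg : ∀ x, Real.pi < x → x < 2 * Real.pi → Real.sin x < 0 := fun x h1 h2 => by
    have := Real.sin_pos_of_pos_of_lt_pi (x := x - Real.pi) (by linarith) (by linarith)
    rw [Real.sin_sub_pi] at this; linarith
  have h1 : c - a ≠ 0 := fun h => hne (by rw [h, Real.sin_zero])
  have h2 : c - a ≠ Real.pi := fun h => hne (by rw [h, Real.sin_pi])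
  have h3 : c - a ≠ 2 * Real.pi := fun h => hne (by rw [h, Real.sin_two_pi])
  have h1' : 0 < c - a := lt_of_le_of_ne (by linarith) h1.symm
  have h3' : c - a < 2 * Real.pi := lt_of_le_of_ne (by linarith) h3
  rcases lt_or_gt_of_ne h2 with hlt | hgt
  · have s := Real.sin_pos_of_pos_of_lt_pi h1' hlt
    rcases lt_trichotomy c Real.pi with h | h | h
    · exact Or.inl (mul_pos (Real.sin_pos_of_pos_of_lt_pi (by linarith) h) s)
    · right
      rw [h, Real.sin_pi_sub] at s ⊢
      positivity
    · exact Or.inr (mul_pos (Real.sin_pos_of_pos_of_lt_pi (by linarith) (by linarith)) s)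
  · have s := neg _ hgt h3'
    rcases lt_trichotomy c Real.pi with h | h | h
    · exact Or.inr (mul_pos_of_neg_of_neg
        (Real.sin_neg_of_neg_of_neg_pi_lt (by linarith) (by linarith)) s)
    · right
      rw [h, Real.sin_pi_sub] at s ⊢
      exact mul_pos_of_neg_of_neg s s
    · exact Or.inl (mul_pos_of_neg_of_neg (neg c h (by linarith)) s)

/-- The displacement goes opposite to the bisector of the arc `[m, M]`. Centring at the bisector
leads to `sin_split`, after a reflection when `t` lies below the arc. -/
lemma exists_split_angle {m M : ℝ} (hmM : m < M) (h2 : M - m < 2 * Real.pi) :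
    ∃ δ : ℝ, ∀ s t : ℝ, m ≤ s → s ≤ M → (M ≤ t ∧ t ≤ m + 2 * Real.pi ∨ M - 2 * Real.pi ≤ t ∧ t ≤ m) →
      Real.sin (t - s) ≠ 0 →
      Real.sin (t - δ) * Real.sin (t - s) < 0 ∨ 0 < Real.sin (δ - s) * Real.sin (t - s) := by
  refine ⟨(m + M) / 2 + Real.pi, fun s t hs1 hs2 ht hne => ?_⟩
  have e1 : Real.sin (t - ((m + M) / 2 + Real.pi)) = - Real.sin (t - (m + M) / 2) := by
    rw [← sub_sub, Real.sin_sub_pi]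
  have e2 : Real.sin ((m + M) / 2 + Real.pi - s) = Real.sin (s - (m + M) / 2) := by
    rw [show (m + M) / 2 + Real.pi - s = Real.pi - (s - (m + M) / 2) by ring, Real.sin_pi_sub]
  rw [e1, e2]
  rcases ht with ⟨h3, h4⟩ | ⟨h3, h4⟩
  · have := sin_split (a := s - (m + M) / 2) (c := t - (m + M) / 2) (h := (M - m) / 2)
      (by linarith) (by linarith) (by linarith) (by linarith) (by linarith) (by linarith)
      (by rwa [sub_sub_sub_cancel_right])
    rw [sub_sub_sub_cancel_right] at this
    rcases this with h | h
    · left; linarith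
    · right; linarith
  · have := sin_split (a := -(s - (m + M) / 2)) (c := -(t - (m + M) / 2)) (h := (M - m) / 2)
      (by linarith) (by linarith) (by linarith) (by linarith) (by linarith) (by linarith)
      (by rw [show -(t - (m + M) / 2) - -(s - (m + M) / 2) = -(t - s) by ring, Real.sin_neg]
          exact neg_ne_zero.2 hne)
    rw [show -(t - (m + M) / 2) - -(s - (m + M) / 2) = -(t - s) by ring, Real.sin_neg, Real.sin_neg,
      Real.sin_neg, neg_mul_neg, neg_mul_neg] at this
    rcases this with h | h
    · left; linarith
    · right; linarith

variable {V : Type*}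

/-- If the rays from `w` to `X` and to `Y` do not alternate and have at most two rays in common,
then there is a direction `d` such that displacing the origin of the rays to `Y` from `w` in
direction `d` makes them disjoint from the rays to `X`. -/
theorem exists_split_direction [Finite V] (p : V → ℝ × ℝ) (w : ℝ × ℝ) (X Y : Set V)
    (hX : X.Nontrivial) (hY : Y.Nontrivial)
    (hgen : ∀ u ∈ X ∪ Y, ∀ v ∈ X ∪ Y, u ≠ v → det3 w (p u) (p v) ≠ 0)
    (halt : ∀ a₁ ∈ X, ∀ a₂ ∈ X, ∀ b₁ ∈ Y, ∀ b₂ ∈ Y, a₁ ≠ a₂ → b₁ ≠ b₂ → a₁ ≠ b₁ → a₁ ≠ b₂ →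
      a₂ ≠ b₁ → a₂ ≠ b₂ → InCone w (p b₁) (p b₂) (p a₁) → InCone w (p b₁) (p b₂) (p a₂))
    (hthree : ∀ c₁ ∈ X ∩ Y, ∀ c₂ ∈ X ∩ Y, ∀ c₃ ∈ X ∩ Y, c₁ = c₂ ∨ c₁ = c₃ ∨ c₂ = c₃) :
    ∃ d : ℝ × ℝ, ∀ u ∈ X, ∀ v ∈ Y, u ≠ v →
      det2 d (p v - w) * det2 (p u - w) (p v - w) < 0 ∨
      0 < det2 (p u - w) d * det2 (p u - w) (p v - w) := by
  have hgen' : ∀ u ∈ X ∪ Y, ∀ v ∈ X ∪ Y, u ≠ v → det2 (p u - w) (p v - w) ≠ 0 := fun u hu v hv h =>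
    det3_eq_det2 w (p u) (p v) ▸ hgen u hu v hv h
  have hne : ∀ u ∈ X ∪ Y, p u - w ≠ 0 := by
    intro u hu h0
    obtain ⟨v, hv, hvu⟩ := hX.exists_ne u
    exact hgen' u hu v (Or.inl hv) hvu.symm (by rw [h0]; simp [det2])
  -- it suffices to find an angle function and separating bounds
  have fin : ∀ g : V → ℝ, ∀ m M : ℝ, m < M → M - m < 2 * Real.pi →
      (∀ u ∈ X ∪ Y, ∀ v ∈ X ∪ Y, ∃ k > 0, det2 (p u - w) (p v - w) = k * Real.sin (g v - g u)) →
      (∀ δ : ℝ, ∃ d : ℝ × ℝ, ∀ u ∈ X ∪ Y, ∃ k > 0, det2 (p u - w) d = k * Real.sin (δ - g u)) →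
      (∀ u ∈ X, m ≤ g u ∧ g u ≤ M) →
      (∀ v ∈ Y, M ≤ g v ∧ g v ≤ m + 2 * Real.pi ∨ M - 2 * Real.pi ≤ g v ∧ g v ≤ m) →
      ∃ d : ℝ × ℝ, ∀ u ∈ X, ∀ v ∈ Y, u ≠ v →
        det2 d (p v - w) * det2 (p u - w) (p v - w) < 0 ∨
        0 < det2 (p u - w) d * det2 (p u - w) (p v - w) := by
    intro g m M hmM hM2 hg hgd hgX hgY
    obtain ⟨δ, hδ⟩ := exists_split_angle hmM hM2
    obtain ⟨d, hd⟩ := hgd δ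
    refine ⟨d, fun u hu v hv huv => ?_⟩
    obtain ⟨k, hk, e⟩ := hg u (Or.inl hu) v (Or.inr hv)
    obtain ⟨k₁, hk₁, e₁⟩ := hd u (Or.inl hu)
    obtain ⟨k₂, hk₂, e₂⟩ := hd v (Or.inr hv)
    have hs : Real.sin (g v - g u) ≠ 0 := fun h =>
      hgen' u (Or.inl hu) v (Or.inr hv) huv (by rw [e, h, mul_zero])
    have e₃ : det2 d (p v - w) = k₂ * Real.sin (g v - δ) := by
      have : det2 d (p v - w) = - det2 (p v - w) d := by unfold det2; ring
      rw [this, e₂, ← neg_sub δ (g v), Real.sin_neg]; ring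
    rw [e, e₁, e₃]
    rcases hδ (g u) (g v) (hgX u hu).1 (hgX u hu).2 (hgY v hv) hs with h | h
    · left
      nlinarith [mul_pos_of_neg_of_neg (neg_lt_zero.2 (mul_pos hk₂ hk)) h]
    · right
      nlinarith [mul_pos (mul_pos hk₁ hk) h]
  have cone_angle : ∀ (g : V → ℝ) (b v a : V), b ∈ X ∪ Y → v ∈ X ∪ Y → a ∈ X ∪ Y → g b = Real.pi →
      (∀ u ∈ X ∪ Y, ∀ v ∈ X ∪ Y, ∃ k > 0, det2 (p u - w) (p v - w) = k * Real.sin (g v - g u)) →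
      (InCone w (p b) (p v) (p a) ↔ 0 < Real.sin (g a) * Real.sin (g v) ∧
        Real.sin (g v - g a) * Real.sin (g v) < 0) := by
    intro g b v a hb hv ha hgb hg
    obtain ⟨k₁, hk₁, e₁⟩ := hg b hb v hv
    obtain ⟨k₂, hk₂, e₂⟩ := hg b hb a ha
    obtain ⟨k₃, hk₃, e₃⟩ := hg a ha v hv
    unfold InCone
    rw [det3_eq_det2, det3_eq_det2, det3_eq_det2, e₁, e₂, e₃, hgb, Real.sin_sub_pi, Real.sin_sub_pi,
      show k₂ * -Real.sin (g a) * (k₁ * -Real.sin (g v)) =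
        (k₂ * k₁) * (Real.sin (g a) * Real.sin (g v)) by ring,
      show k₃ * Real.sin (g v - g a) * (k₁ * -Real.sin (g v)) =
        (k₃ * k₁) * (-(Real.sin (g v - g a) * Real.sin (g v))) by ring,
      mul_pos_iff_of_pos_left (mul_pos hk₂ hk₁), mul_pos_iff_of_pos_left (mul_pos hk₃ hk₁), neg_pos]
  -- angles below and above `g v` lie on different sides of the two rays to `b` and `v`
  have sides : ∀ s γ t : ℝ, -Real.pi < s → s < γ → γ < t → t < Real.pi → Real.sin γ ≠ 0 →
      ¬ ((0 < Real.sin s * Real.sin γ ∧ Real.sin (γ - s) * Real.sin γ < 0) ↔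
        (0 < Real.sin t * Real.sin γ ∧ Real.sin (γ - t) * Real.sin γ < 0)) := by
    intro s γ t h1 h2 h3 h4 h5
    have hγ : γ ≠ 0 := fun h => h5 (by rw [h, Real.sin_zero])
    rcases lt_or_gt_of_ne hγ with hn | hp
    · have sγ := Real.sin_neg_of_neg_of_neg_pi_lt hn (by linarith)
      have ss := Real.sin_neg_of_neg_of_neg_pi_lt (hn.trans' h2) h1
      have sd := Real.sin_pos_of_pos_of_lt_pi (x := γ - s) (by linarith) (by linarith)
      intro h
      obtain ⟨h6, h7⟩ := h.1 ⟨mul_pos_of_neg_of_neg ss sγ, mul_neg_of_pos_of_neg sd sγ⟩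
      have ht : t < 0 := by
        by_contra! ht
        have := Real.sin_nonneg_of_nonneg_of_le_pi ht h4.le
        nlinarith
      have := Real.sin_neg_of_neg_of_neg_pi_lt (x := γ - t) (by linarith) (by linarith)
      nlinarith
    · have sγ := Real.sin_pos_of_pos_of_lt_pi hp (by linarith)
      have st := Real.sin_pos_of_pos_of_lt_pi (hp.trans h3) h4
      have sd := Real.sin_neg_of_neg_of_neg_pi_lt (x := γ - t) (by linarith) (by linarith)
      intro h
      obtain ⟨h6, h7⟩ := h.2 ⟨mul_pos st sγ, mul_neg_of_neg_of_pos sd sγ⟩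
      have hs : 0 < s := by
        by_contra! hs
        have := Real.sin_nonpos_of_nonpos_of_neg_pi_le hs h1.le
        nlinarith
      have := Real.sin_pos_of_pos_of_lt_pi (x := γ - s) (by linarith) (by linarith)
      nlinarith
  -- With the branch cut along a ray to `b ∈ Y` outside `X`, the arc is bounded by the extreme
  -- angles of `X`, and non-alternation keeps the other rays to `Y` out of its interior. If `Y ⊆ X`,
  -- then `Y` is a pair `{b, y}` and the remaining rays to `X` are all on one side of it.
  by_cases hYX : ∃ b ∈ Y, b ∉ X
  · obtain ⟨b, hbY, hbX⟩ := hYX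
    obtain ⟨g₀, hgb, hgr, hg₀, hgd₀⟩ := exists_angle (hne b (Or.inr hbY))
    let g : V → ℝ := fun v => g₀ (p v - w)
    have hg : ∀ u ∈ X ∪ Y, ∀ v ∈ X ∪ Y, ∃ k > 0, det2 (p u - w) (p v - w) = k * Real.sin (g v - g u) :=
      fun u hu v hv => hg₀ _ _ (hne u hu) (hne v hv)
    have hrange : ∀ u ∈ X ∪ Y, u ≠ b → -Real.pi < g u ∧ g u < Real.pi := fun u hu hub =>
      hgr _ (hgen' b (Or.inr hbY) u hu hub.symm)
    have hXb : ∀ u ∈ X, u ≠ b := fun u hu h => hbX (h ▸ hu)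
    obtain ⟨um, hum, hmin⟩ := Set.exists_min_image X g (Set.toFinite X) hX.nonempty
    obtain ⟨uM, huM, hmax⟩ := Set.exists_max_image X g (Set.toFinite X) hX.nonempty
    have hmM : g um < g uM := by
      refine lt_of_le_of_ne (hmin uM huM) fun heq => ?_
      obtain ⟨v, hv, hvu⟩ := hX.exists_ne um
      obtain ⟨k, hk, e⟩ := hg um (Or.inl hum) v (Or.inl hv)
      have : g v = g um := le_antisymm ((hmax v hv).trans heq.ge) (hmin v hv)
      exact hgen' um (Or.inl hum) v (Or.inl hv) hvu.symm (by rw [e, this, sub_self, Real.sin_zero, mul_zero])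
    have r1 := hrange um (Or.inl hum) (hXb um hum)
    have r2 := hrange uM (Or.inl huM) (hXb uM huM)
    refine fin g (g um) (g uM) hmM (by linarith) hg ?_ (fun u hu => ⟨hmin u hu, hmax u hu⟩) ?_
    · intro δ
      obtain ⟨d, hd⟩ := hgd₀ δ
      exact ⟨d, fun u hu => hd _ (hne u hu)⟩
    · intro v hv
      by_cases hvb : v = b
      · left
        subst hvb
        exact ⟨by rw [show g v = Real.pi from hgb]; linarith, by
          rw [show g v = Real.pi from hgb]; linarith⟩
      · have r3 := hrange v (Or.inr hv) hvb
        by_contra! hcon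
        have hv1 : g um < g v := by
          by_contra! h
          exact absurd (hcon.2 (by linarith)) (by linarith)
        have hv2 : g v < g uM := by
          by_contra! h
          exact absurd (hcon.1 h) (by linarith)
        have n1 : um ≠ v := fun h => hv1.ne (by rw [h])
        have n2 : uM ≠ v := fun h => hv2.ne' (by rw [h])
        have n3 : um ≠ uM := fun h => hmM.ne (by rw [h])
        have hs : Real.sin (g v) ≠ 0 := by
          obtain ⟨k, hk, e⟩ := hg b (Or.inr hbY) v (Or.inr hv)
          rw [show g b = Real.pi from hgb, Real.sin_sub_pi] at e
          intro h
          exact hgen' b (Or.inr hbY) v (Or.inr hv) (Ne.symm hvb) (by rw [e, h]; ring)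
        refine sides (g um) (g v) (g uM) r1.1 hv1 hv2 r2.2 hs ?_
        rw [← cone_angle g b v um (Or.inr hbY) (Or.inr hv) (Or.inl hum) hgb hg,
          ← cone_angle g b v uM (Or.inr hbY) (Or.inr hv) (Or.inl huM) hgb hg]
        exact ⟨halt um hum uM huM b hbY v hv n3 (Ne.symm hvb) (hXb _ hum) n1 (hXb _ huM) n2,
          halt uM huM um hum b hbY v hv n3.symm (Ne.symm hvb) (hXb _ huM) n2 (hXb _ hum) n1⟩
  · push Not at hYX
    obtain ⟨b, hbY, y, hyY, hby⟩ := hY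
    have hYeq : ∀ v ∈ Y, v = b ∨ v = y := by
      intro v hv
      rcases hthree b ⟨hYX b hbY, hbY⟩ y ⟨hYX y hyY, hyY⟩ v ⟨hYX v hv, hv⟩ with h | h | h
      · exact absurd h hby
      · exact Or.inl h.symm
      · exact Or.inr h.symm
    obtain ⟨g₀, hgb, hgr, hg₀, hgd₀⟩ := exists_angle (hne b (Or.inr hbY))
    let g : V → ℝ := fun v => g₀ (p v - w)
    have hg : ∀ u ∈ X ∪ Y, ∀ v ∈ X ∪ Y, ∃ k > 0, det2 (p u - w) (p v - w) = k * Real.sin (g v - g u) :=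
      fun u hu v hv => hg₀ _ _ (hne u hu) (hne v hv)
    have hrange : ∀ u ∈ X ∪ Y, u ≠ b → -Real.pi < g u ∧ g u < Real.pi := fun u hu hub =>
      hgr _ (hgen' b (Or.inr hbY) u hu hub.symm)
    have ry := hrange y (Or.inr hyY) (Ne.symm hby)
    have hgd : ∀ δ : ℝ, ∃ d : ℝ × ℝ, ∀ u ∈ X ∪ Y, ∃ k > 0,
        det2 (p u - w) d = k * Real.sin (δ - g u) := by
      intro δ
      obtain ⟨d, hd⟩ := hgd₀ δ
      exact ⟨d, fun u hu => hd _ (hne u hu)⟩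
    have hgb' : g b = Real.pi := hgb
    by_cases hup : ∀ u ∈ X, u ≠ b → g y ≤ g u
    · refine fin g (g y) Real.pi ry.2 (by linarith) hg hgd (fun u hu => ?_) fun v hv => ?_
      · by_cases hub : u = b
        · subst hub; rw [hgb']; exact ⟨ry.2.le, le_rfl⟩
        · exact ⟨hup u hu hub, (hrange u (Or.inl hu) hub).2.le⟩
      · rcases hYeq v hv with rfl | rfl
        · left; rw [hgb']; exact ⟨le_rfl, by linarith⟩
        · right; exact ⟨by linarith, le_rfl⟩
    · push Not at hup
      obtain ⟨u₀, hu₀, hu₀b, hlt⟩ := hup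
      have hdown : ∀ u ∈ X, u ≠ b → g u ≤ g y := by
        intro u hu hub
        by_contra! hgt
        have n1 : u₀ ≠ y := fun h => hlt.ne (by rw [h])
        have n2 : u ≠ y := fun h => hgt.ne' (by rw [h])
        have n3 : u₀ ≠ u := fun h => (hlt.trans hgt).ne (by rw [h])
        have hs : Real.sin (g y) ≠ 0 := by
          obtain ⟨k, hk, e⟩ := hg b (Or.inr hbY) y (Or.inr hyY)
          rw [hgb', Real.sin_sub_pi] at e
          intro h
          exact hgen' b (Or.inr hbY) y (Or.inr hyY) hby (by rw [e, h]; ring)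
        refine sides (g u₀) (g y) (g u) (hrange u₀ (Or.inl hu₀) hu₀b).1 hlt hgt
          (hrange u (Or.inl hu) hub).2 hs ?_
        rw [← cone_angle g b y u₀ (Or.inr hbY) (Or.inr hyY) (Or.inl hu₀) hgb hg,
          ← cone_angle g b y u (Or.inr hbY) (Or.inr hyY) (Or.inl hu) hgb hg]
        exact ⟨halt u₀ hu₀ u hu b hbY y hyY n3 hby hu₀b n1 hub n2,
          halt u hu u₀ hu₀ b hbY y hyY n3.symm hby hub n2 hu₀b n1⟩
      classical
      -- Here `X` lies below `y`. Its member `b` must count as the lower end of the arc, so its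
      -- angle `π` is replaced by `-π`, which changes none of the sines.
      let g' : V → ℝ := Function.update g b (-Real.pi)
      have hg'b : g' b = -Real.pi := Function.update_self ..
      have hg'n : ∀ v, v ≠ b → g' v = g v := fun v hv => Function.update_of_ne hv _ _
      have hsin1 : ∀ v (t : ℝ), Real.sin (g' v - t) = Real.sin (g v - t) := by
        intro v t
        by_cases hv : v = b
        · subst hv
          rw [hg'b, hgb', show -Real.pi - t = (Real.pi - t) - 2 * Real.pi by ring, Real.sin_sub_two_pi]
        · rw [hg'n v hv]
      have hsin2 : ∀ v (t : ℝ), Real.sin (t - g' v) = Real.sin (t - g v) := by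
        intro v t
        rw [← neg_sub, Real.sin_neg, hsin1, ← Real.sin_neg, neg_sub]
      refine fin g' (-Real.pi) (g y) ry.1 (by linarith) (fun u hu v hv => ?_) (fun δ => ?_)
        (fun u hu => ?_) fun v hv => ?_
      · rw [hsin1, hsin2]; exact hg u hu v hv
      · obtain ⟨d, hd⟩ := hgd δ
        exact ⟨d, fun u hu => by rw [hsin2]; exact hd u hu⟩
      · by_cases hub : u = b
        · subst hub; rw [hg'b]; exact ⟨le_rfl, ry.1.le⟩
        · rw [hg'n u hub]
          exact ⟨(hrange u (Or.inl hu) hub).1.le, hdown u hu hub⟩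
      · rcases hYeq v hv with rfl | rfl
        · right; rw [hg'b]; exact ⟨by linarith, le_rfl⟩
        · left; rw [hg'n v hby.symm]; exact ⟨le_rfl, by linarith⟩

/-- The rays of `exists_split_direction` are indeed disjoint. -/
lemma disjoint_of_split {w d u v : ℝ × ℝ} {ε : ℝ} (hε : 0 < ε)
    (h : det2 d (v - w) * det2 (u - w) (v - w) < 0 ∨ 0 < det2 (u - w) d * det2 (u - w) (v - w)) :
    Disjoint (segment ℝ w u) (segment ℝ (w + ε • d) v) := by
  rw [Set.disjoint_left]
  intro m h1 h2
  obtain ⟨s, s0, s1, e1, e2⟩ := mem_seg.1 h1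
  obtain ⟨t, t0, t1, e3, e4⟩ := mem_seg.1 h2
  simp only [Prod.fst_add, Prod.snd_add, Prod.smul_fst, Prod.smul_snd, smul_eq_mul] at e3 e4
  set U := u - w with hU
  set W := v - w with hW
  have u1 : u.1 = w.1 + U.1 := by simp [hU]
  have u2 : u.2 = w.2 + U.2 := by simp [hU]
  have v1 : v.1 = w.1 + W.1 := by simp [hW]
  have v2 : v.2 = w.2 + W.2 := by simp [hW]
  -- A common point means `s U = (1 - t) ε d + t W`. Taking determinants with `W` and with `U`
  -- contradicts the first or the second sign condition.
  have f1 : s * U.1 = (1 - t) * ε * d.1 + t * W.1 := by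
    rw [u1] at e1; rw [v1] at e3; linarith
  have f2 : s * U.2 = (1 - t) * ε * d.2 + t * W.2 := by
    rw [u2] at e2; rw [v2] at e4; linarith
  have g1 : s * det2 U W = (1 - t) * ε * det2 d W := by
    unfold det2; linear_combination W.2 * f1 - W.1 * f2
  have g2 : (1 - t) * ε * det2 U d + t * det2 U W = 0 := by
    unfold det2; linear_combination U.2 * f1 - U.1 * f2
  have ht : 0 ≤ (1 - t) * ε := by nlinarith
  rcases h with h | h
  · have hne : det2 U W ≠ 0 := fun h0 => by rw [h0] at h; simp at h
    have hsq : 0 < det2 U W ^ 2 := by positivity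
    have k1 : s * det2 U W ^ 2 = (1 - t) * ε * (det2 d W * det2 U W) := by
      linear_combination det2 U W * g1
    have k2 : (1 - t) * ε = 0 := by
      by_contra hk
      have := mul_neg_of_pos_of_neg (lt_of_le_of_ne ht (Ne.symm hk)) h
      nlinarith [mul_nonneg s0 hsq.le]
    have k3 : t = 1 := by
      have := (mul_eq_zero.1 k2).resolve_right hε.ne'
      linarith
    rw [k2, k3] at g2
    simp at g2
    exact hne g2
  · have hne : det2 U W ≠ 0 := fun h0 => by rw [h0] at h; simp at h
    have hsq : 0 < det2 U W ^ 2 := by positivity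
    have k1 : (1 - t) * ε * (det2 U d * det2 U W) + t * det2 U W ^ 2 = 0 := by
      linear_combination det2 U W * g2
    rcases eq_or_lt_of_le t0 with h0 | h0
    · rw [← h0] at k1
      have := mul_pos hε h
      linarith
    · nlinarith [mul_nonneg ht h.le, mul_pos h0 hsq]

end Directions

end RectilinearCrossing


namespace RectilinearCrossing

/-! ### Crossing parity and the exclusion of alternating connections. -/

section Parity

/-- The sign of a nonzero real number. -/
noncomputable def sg (x : ℝ) : Bool := decide (0 < x)

lemma sg_true {x : ℝ} : sg x = true ↔ 0 < x := by simp [sg]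

lemma sg_false {x : ℝ} (hx : x ≠ 0) : sg x = false ↔ x < 0 := by
  simp only [sg, decide_eq_false_iff_not, not_lt]
  exact ⟨fun h => lt_of_le_of_ne h hx, le_of_lt⟩

lemma sg_mul {x y : ℝ} (hx : x ≠ 0) (hy : y ≠ 0) : sg (x * y) = (sg x == sg y) := by
  rcases lt_or_gt_of_ne hx with h1 | h1 <;> rcases lt_or_gt_of_ne hy with h2 | h2
  · rw [(sg_false hx).2 h1, (sg_false hy).2 h2, sg_true.2 (mul_pos_of_neg_of_neg h1 h2)]; rfl
  · rw [(sg_false hx).2 h1, sg_true.2 h2, (sg_false (mul_ne_zero hx hy)).2 (mul_neg_of_neg_of_pos h1 h2)]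
    rfl
  · rw [(sg_false hy).2 h2, sg_true.2 h1, (sg_false (mul_ne_zero hx hy)).2 (mul_neg_of_pos_of_neg h1 h2)]
    rfl
  · rw [sg_true.2 h1, sg_true.2 h2, sg_true.2 (mul_pos h1 h2)]; rfl

lemma sg_neg {x : ℝ} (hx : x ≠ 0) : sg (-x) = !sg x := by
  rcases lt_or_gt_of_ne hx with h | h
  · rw [(sg_false hx).2 h, sg_true.2 (neg_pos.2 h)]; rfl
  · rw [sg_true.2 h, (sg_false (neg_ne_zero.2 hx)).2 (neg_lt_zero.2 h)]; rfl

lemma mul_pos_iff_sg {x y : ℝ} (hx : x ≠ 0) (hy : y ≠ 0) : 0 < x * y ↔ sg x = sg y := by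
  rw [← sg_true, sg_mul hx hy, beq_iff_eq]

lemma mul_neg_iff_sg {x y : ℝ} (hx : x ≠ 0) (hy : y ≠ 0) : x * y < 0 ↔ sg x ≠ sg y := by
  rw [← sg_false (mul_ne_zero hx hy), sg_mul hx hy, beq_eq_false_iff_ne]

/-- The sign of a difference of two products with opposite signs. -/
lemma sg_sub {z x₁ x₂ y₁ y₂ : ℝ} (hx₁ : x₁ ≠ 0) (hx₂ : x₂ ≠ 0) (hy₁ : y₁ ≠ 0) (hy₂ : y₂ ≠ 0)
    (h : z = x₁ * x₂ - y₁ * y₂) (hs : (sg x₁ == sg x₂) ≠ (sg y₁ == sg y₂)) :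
    sg z = (sg x₁ == sg x₂) := by
  rw [← sg_mul hx₁ hx₂, ← sg_mul hy₁ hy₂] at hs
  rw [← sg_mul hx₁ hx₂]
  have hx := mul_ne_zero hx₁ hx₂
  have hy := mul_ne_zero hy₁ hy₂
  rcases lt_or_gt_of_ne hx with h1 | h1 <;> rcases lt_or_gt_of_ne hy with h2 | h2
  · rw [(sg_false hx).2 h1, (sg_false hy).2 h2] at hs; exact absurd rfl hs
  · rw [(sg_false hx).2 h1, sg_false (by linarith)]; linarith
  · rw [sg_true.2 h1, sg_true]; linarith
  · rw [sg_true.2 h1, sg_true.2 h2] at hs; exact absurd rfl hs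

/-- Three nonzero numbers with sum zero do not have the same sign. -/
lemma sg_sum {x₁ x₂ x₃ y₁ y₂ y₃ : ℝ} (hx₁ : x₁ ≠ 0) (hx₂ : x₂ ≠ 0) (hx₃ : x₃ ≠ 0) (hy₁ : y₁ ≠ 0)
    (hy₂ : y₂ ≠ 0) (hy₃ : y₃ ≠ 0) (h : x₁ * y₁ + x₂ * y₂ + x₃ * y₃ = 0) :
    ¬ ((sg x₁ == sg y₁) = (sg x₂ == sg y₂) ∧ (sg x₂ == sg y₂) = (sg x₃ == sg y₃)) := by
  rw [← sg_mul hx₁ hy₁, ← sg_mul hx₂ hy₂, ← sg_mul hx₃ hy₃]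
  have h1 := mul_ne_zero hx₁ hy₁
  have h2 := mul_ne_zero hx₂ hy₂
  have h3 := mul_ne_zero hx₃ hy₃
  rintro ⟨e1, e2⟩
  rcases lt_or_gt_of_ne h1 with h | h
  · rw [(sg_false h1).2 h] at e1
    have := (sg_false h2).1 e1.symm
    have := (sg_false h3).1 (e2 ▸ e1.symm)
    linarith
  · rw [sg_true.2 h] at e1
    have := sg_true.1 e1.symm
    have := sg_true.1 (e2 ▸ e1.symm)
    linarith

/-- Each segment has its ends strictly on different sides of the other line. -/
lemma not_disjoint_segment_iff {a b c d : ℝ × ℝ} (h1 : det3 a b c ≠ 0) (h2 : det3 a b d ≠ 0)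
    (h3 : det3 c d a ≠ 0) (h4 : det3 c d b ≠ 0) :
    ¬ Disjoint (segment ℝ a b) (segment ℝ c d) ↔
      det3 a b c * det3 a b d < 0 ∧ det3 c d a * det3 c d b < 0 := by
  have key : ∀ {a b c d m : ℝ × ℝ}, m ∈ segment ℝ a b → m ∈ segment ℝ c d → det3 a b c ≠ 0 →
      det3 a b d ≠ 0 → det3 a b c * det3 a b d < 0 := by
    intro a b c d m hm hm' h1 h2
    have h0 := det3_eq_zero_of_mem_segment hm
    obtain ⟨t, t0, t1, e1, e2⟩ := mem_seg.1 hm'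
    rw [det3_comb₃ a b m e1 e2] at h0
    by_contra! hge
    have hpos : 0 < det3 a b c * det3 a b d := lt_of_le_of_ne hge (mul_ne_zero h1 h2).symm
    have e : (1 - t) * (det3 a b c * det3 a b d) + t * det3 a b d ^ 2 = 0 := by
      linear_combination det3 a b d * h0
    have hsq : 0 < det3 a b d ^ 2 := by positivity
    rcases eq_or_lt_of_le t0 with h | h
    · rw [← h] at e; linarith
    · nlinarith [mul_pos h hsq, mul_nonneg (sub_nonneg.2 t1) hge]
  constructor
  · intro h
    obtain ⟨m, hm, hm'⟩ := Set.not_disjoint_iff.1 h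
    exact ⟨key hm hm' h1 h2, key hm' hm h3 h4⟩
  · rintro ⟨hA, hB⟩
    rw [Set.not_disjoint_iff]
    -- The parameters on the two segments have denominators equal up to sign, which makes the two
    -- descriptions of the crossing point agree.
    have hNe : det3 a b d - det3 a b c = det3 c d a - det3 c d b := by unfold det3; ring
    have frac : ∀ {x y : ℝ}, x * y < 0 → x - y ≠ 0 ∧ 0 ≤ x / (x - y) ∧ x / (x - y) ≤ 1 := by
      intro x y hxy
      rcases lt_or_gt_of_ne (show x ≠ 0 by rintro rfl; simp at hxy) with h | h
      · have hy : 0 < y := by by_contra! h'; nlinarith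
        have hn : x - y < 0 := by linarith
        exact ⟨hn.ne, div_nonneg_of_nonpos h.le hn.le, by rw [div_le_one_of_neg hn]; linarith⟩
      · have hy : y < 0 := by by_contra! h'; nlinarith
        have hn : 0 < x - y := by linarith
        exact ⟨hn.ne', by positivity, by rw [div_le_one hn]; linarith⟩
    obtain ⟨n1, l1, l2⟩ := frac hB
    obtain ⟨n2, l3, l4⟩ := frac hA
    set t := det3 c d a / (det3 c d a - det3 c d b) with ht
    refine ⟨((1 - t) * a.1 + t * b.1, (1 - t) * a.2 + t * b.2), mem_seg.2 ⟨t, l1, l2, rfl, rfl⟩,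
      mem_seg.2 ⟨det3 a b c / (det3 a b c - det3 a b d), l3, l4, ?_, ?_⟩⟩
    · have n3 : det3 a b c - det3 a b d = -(det3 c d a - det3 c d b) := by rw [← hNe]; ring
      simp only [ht]
      rw [n3]
      field_simp
      unfold det3; ring
    · have n3 : det3 a b c - det3 a b d = -(det3 c d a - det3 c d b) := by rw [← hNe]; ring
      simp only [ht]
      rw [n3]
      field_simp
      unfold det3; ring

open Classical in
/-- The indicator of a proposition modulo two. -/
noncomputable def ind (P : Prop) : ZMod 2 := if P then 1 else 0

lemma ind_bool (x : Bool) : ind (x = true) = if x then 1 else 0 := by unfold ind; cases x <;> simp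

lemma ind_congr {P : Prop} {x : Bool} (h : P ↔ x = true) : ind P = if x then 1 else 0 := by
  rw [← ind_bool, propext h]

/-- The variables are the signs of `uv`, `bb'`, `ub`, `ub'`, `vb`, `vb'` as seen from `w`. The
hypothesis is what the relation `[uv][bb'] = [ub][vb'] - [ub'][vb]` says about signs. -/
lemma cone_parity_bool : ∀ A B C E F K : Bool,
    ((C == K) ≠ (E == F) → (A == B) = (C == K)) →
    (if (C == A) && (F != A) then (1 : ZMod 2) else 0) + (if (E == A) && (K != A) then 1 else 0) =
    (if (C != B) && (E == B) then 1 else 0) + (if (F != B) && (K == B) then 1 else 0) := by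
  decide

/-- The two rays `wb`, `wb'` separate `u` from `v` if and only if the cone spanned by `u` and `v`
contains exactly one of them. -/
lemma cone_parity {w u v b b' : ℝ × ℝ} (h1 : det3 w u v ≠ 0) (h2 : det3 w b b' ≠ 0)
    (h3 : det3 w u b ≠ 0) (h4 : det3 w u b' ≠ 0) (h5 : det3 w v b ≠ 0) (h6 : det3 w v b' ≠ 0) :
    ind (InCone w u v b) + ind (InCone w u v b') = ind (InCone w b b' u) + ind (InCone w b b' v) := by
  have sw : ∀ s t, det3 w s t = - det3 w t s := fun s t => det3_swap' w s t
  have key := cone_parity_bool (sg (det3 w u v)) (sg (det3 w b b')) (sg (det3 w u b))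
    (sg (det3 w u b')) (sg (det3 w v b)) (sg (det3 w v b')) (by
      intro hne
      rw [← sg_mul h1 h2]
      refine sg_sub h3 h6 h4 h5 ?_ hne
      unfold det3; ring)
  have hneg : ∀ {x}, x ≠ 0 → ∀ y : Bool, (sg (-x) = y ↔ sg x ≠ y) := fun {x} hx y => by
    rw [sg_neg hx]; cases sg x <;> cases y <;> simp
  rw [ind_congr (x := (sg (det3 w u b) == sg (det3 w u v)) && (sg (det3 w v b) != sg (det3 w u v))),
    ind_congr (x := (sg (det3 w u b') == sg (det3 w u v)) && (sg (det3 w v b') != sg (det3 w u v))),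
    ind_congr (x := (sg (det3 w u b) != sg (det3 w b b')) && (sg (det3 w u b') == sg (det3 w b b'))),
    ind_congr (x := (sg (det3 w v b) != sg (det3 w b b')) && (sg (det3 w v b') == sg (det3 w b b')))]
  · exact key
  · unfold InCone
    rw [sw b v, mul_pos_iff_sg (neg_ne_zero.2 h5) h2, mul_pos_iff_sg h6 h2, hneg h5]; simp
  · unfold InCone
    rw [sw b u, mul_pos_iff_sg (neg_ne_zero.2 h3) h2, mul_pos_iff_sg h4 h2, hneg h3]; simp
  · unfold InCone
    rw [sw b' v, mul_pos_iff_sg h4 h1, mul_pos_iff_sg (neg_ne_zero.2 h6) h1, hneg h6]; simp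
  · unfold InCone
    rw [sw b v, mul_pos_iff_sg h3 h1, mul_pos_iff_sg (neg_ne_zero.2 h5) h1, hneg h5]; simp

-- Here `l`, `m` are the signs of the barycentric coordinates of `q`, `q'`, and the `q` variables
-- tell the sides of the line `qq'` on which `w`, `u`, `v` lie. The hypotheses are: some coordinate
-- is positive; the sides are determined by two-by-two minors of the coordinates; the functional of
-- `qq'` vanishes at `q` and `q'`; `uv` is not crossed.
set_option maxRecDepth 4000 in
lemma tri_parity_bool : ∀ l₀ l₁ l₂ m₀ m₁ m₂ q₀ q₁ q₂ : Bool,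
    (l₀ || l₁ || l₂) = true → (m₀ || m₁ || m₂) = true →
    ((l₁ == m₂) ≠ (l₂ == m₁) → q₀ = (l₁ == m₂)) →
    ((l₂ == m₀) ≠ (l₀ == m₂) → q₁ = (l₂ == m₀)) →
    ((l₀ == m₁) ≠ (l₁ == m₀) → q₂ = (l₀ == m₁)) →
    ¬ ((l₀ == q₀) = (l₁ == q₁) ∧ (l₁ == q₁) = (l₂ == q₂)) →
    ¬ ((m₀ == q₀) = (m₁ == q₁) ∧ (m₁ == q₁) = (m₂ == q₂)) →
    ((l₀ != m₀) && (q₁ != q₂)) = false →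
    (if l₀ && l₁ && l₂ then (1 : ZMod 2) else 0) + (if m₀ && m₁ && m₂ then 1 else 0) =
    (if (l₂ != m₂) && (q₀ != q₁) then 1 else 0) + (if (l₁ != m₁) && (q₀ != q₂) then 1 else 0) := by
  decide

/-- A segment that avoids the side `uv` of the triangle `wuv` enters or leaves it through one of the
other two sides. -/
lemma tri_parity {w u v q q' : ℝ × ℝ} (hD : det3 w u v ≠ 0) (h0 : det3 q u v ≠ 0)
    (h1 : det3 w q v ≠ 0) (h2 : det3 w u q ≠ 0) (h0' : det3 q' u v ≠ 0) (h1' : det3 w q' v ≠ 0)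
    (h2' : det3 w u q' ≠ 0) (k0 : det3 q q' w ≠ 0) (k1 : det3 q q' u ≠ 0) (k2 : det3 q q' v ≠ 0)
    (hd : Disjoint (segment ℝ u v) (segment ℝ q q')) :
    ind (InTri w u v q) + ind (InTri w u v q') =
      ind (¬ Disjoint (segment ℝ w u) (segment ℝ q q')) +
      ind (¬ Disjoint (segment ℝ w v) (segment ℝ q q')) := by
  set D := det3 w u v with hDdef
  have i0 : det3 q q' w * D = det3 w q v * det3 w u q' - det3 w u q * det3 w q' v := by
    rw [hDdef]; unfold det3; ring
  have i1 : det3 q q' u * D = det3 w u q * det3 q' u v - det3 q u v * det3 w u q' := by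
    rw [hDdef]; unfold det3; ring
  have i2 : det3 q q' v * D = det3 q u v * det3 w q' v - det3 w q v * det3 q' u v := by
    rw [hDdef]; unfold det3; ring
  have s := det3_sum w u v q
  have s' := det3_sum w u v q'
  rw [← hDdef] at s s'
  have hDsq : 0 < D ^ 2 := by positivity
  have n3 : ∀ {x : ℝ}, x ≠ 0 → x * D ^ 3 ≠ 0 := fun hx => mul_ne_zero hx (pow_ne_zero 3 hD)
  have n1 : ∀ {x : ℝ}, x ≠ 0 → x * D ≠ 0 := fun hx => mul_ne_zero hx hD
  -- Multiplying by `D` makes signs independent of the orientation of `wuv`. Two coordinates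
  -- multiplied by `D` turn `i0`, `i1`, `i2` into identities with `D ^ 3`.
  have key := tri_parity_bool (sg (det3 q u v * D)) (sg (det3 w q v * D)) (sg (det3 w u q * D))
    (sg (det3 q' u v * D)) (sg (det3 w q' v * D)) (sg (det3 w u q' * D))
    (sg (det3 q q' w * D ^ 3)) (sg (det3 q q' u * D ^ 3)) (sg (det3 q q' v * D ^ 3))
    (by
      by_contra hcon
      simp only [Bool.or_eq_true, sg_true, not_or, not_lt] at hcon
      obtain ⟨⟨h₀, h₁⟩, h₂⟩ := hcon
      have : det3 q u v * D + det3 w q v * D + det3 w u q * D = D ^ 2 := by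
        linear_combination D * s
      linarith)
    (by
      by_contra hcon
      simp only [Bool.or_eq_true, sg_true, not_or, not_lt] at hcon
      obtain ⟨⟨h₀, h₁⟩, h₂⟩ := hcon
      have : det3 q' u v * D + det3 w q' v * D + det3 w u q' * D = D ^ 2 := by
        linear_combination D * s'
      linarith)
    (sg_sub (n1 h1) (n1 h2') (n1 h2) (n1 h1') (by linear_combination D ^ 2 * i0))
    (sg_sub (n1 h2) (n1 h0') (n1 h0) (n1 h2') (by linear_combination D ^ 2 * i1))
    (sg_sub (n1 h0) (n1 h1') (n1 h1) (n1 h0') (by linear_combination D ^ 2 * i2))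
    (sg_sum (n1 h0) (n1 h1) (n1 h2) (n3 k0) (n3 k1) (n3 k2) (by
      linear_combination D ^ 3 * (det3 q u v * i0 + det3 w q v * i1 + det3 w u q * i2)))
    (sg_sum (n1 h0') (n1 h1') (n1 h2') (n3 k0) (n3 k1) (n3 k2) (by
      linear_combination D ^ 3 * (det3 q' u v * i0 + det3 w q' v * i1 + det3 w u q' * i2)))
  have c1 : ∀ {x y : ℝ}, x ≠ 0 → y ≠ 0 → (x * y < 0 ↔ sg (x * D) ≠ sg (y * D)) := by
    intro x y hx hy
    rw [← mul_neg_iff_sg (n1 hx) (n1 hy), show x * D * (y * D) = x * y * D ^ 2 by ring]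
    exact ⟨fun h => mul_neg_of_neg_of_pos h hDsq, fun h => by
      by_contra! h'; nlinarith [mul_nonneg h' hDsq.le]⟩
  have c3 : ∀ {x y : ℝ}, x ≠ 0 → y ≠ 0 → (x * y < 0 ↔ sg (x * D ^ 3) ≠ sg (y * D ^ 3)) := by
    intro x y hx hy
    have hD6 : 0 < D ^ 6 := by positivity
    rw [← mul_neg_iff_sg (n3 hx) (n3 hy), show x * D ^ 3 * (y * D ^ 3) = x * y * D ^ 6 by ring]
    exact ⟨fun h => mul_neg_of_neg_of_pos h hD6, fun h => by
      by_contra! h'; nlinarith [mul_nonneg h' hD6.le]⟩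
  have hc0 := not_disjoint_segment_iff (a := u) (b := v) (c := q) (d := q')
    (by rwa [← det3_cycle q u v]) (by rwa [← det3_cycle q' u v]) k1 k2
  have hcu := not_disjoint_segment_iff (a := w) (b := u) (c := q) (d := q') h2 h2' k0 k1
  have e1 : det3 w v q = - det3 w q v := det3_swap' w v q
  have e2 : det3 w v q' = - det3 w q' v := det3_swap' w v q'
  have hcv := not_disjoint_segment_iff (a := w) (b := v) (c := q) (d := q')
    (by rw [e1]; exact neg_ne_zero.2 h1) (by rw [e2]; exact neg_ne_zero.2 h1') k0 k2
  rw [e1, e2, neg_mul_neg] at hcv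
  rw [ind_congr (x := sg (det3 q u v * D) && sg (det3 w q v * D) && sg (det3 w u q * D)),
    ind_congr (x := sg (det3 q' u v * D) && sg (det3 w q' v * D) && sg (det3 w u q' * D)),
    ind_congr (x := (sg (det3 w u q * D) != sg (det3 w u q' * D)) &&
      (sg (det3 q q' w * D ^ 3) != sg (det3 q q' u * D ^ 3))),
    ind_congr (x := (sg (det3 w q v * D) != sg (det3 w q' v * D)) &&
      (sg (det3 q q' w * D ^ 3) != sg (det3 q q' v * D ^ 3)))]
  · refine key ?_
    by_contra hcon
    rw [Bool.not_eq_false, Bool.and_eq_true, bne_iff_ne, bne_iff_ne] at hcon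
    refine hc0.2 ⟨?_, (c3 k1 k2).2 hcon.2⟩ hd
    rw [← det3_cycle q u v, ← det3_cycle q' u v]
    exact (c1 h0 h0').2 hcon.1
  · rw [hcv, Bool.and_eq_true, bne_iff_ne, bne_iff_ne]
    exact and_congr (c1 h1 h1') (c3 k0 k2)
  · rw [hcu, Bool.and_eq_true, bne_iff_ne, bne_iff_ne]
    exact and_congr (c1 h2 h2') (c3 k0 k1)
  · rw [Bool.and_eq_true, Bool.and_eq_true, sg_true, sg_true, sg_true, and_assoc]; rfl
  · rw [Bool.and_eq_true, Bool.and_eq_true, sg_true, sg_true, sg_true, and_assoc]; rfl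

/-- A point of the cone outside the triangle is beyond `uv`, and the segment from `w` would cross
`uv`. -/
lemma inTri_iff_inCone {w u v b : ℝ × ℝ} (hD : det3 w u v ≠ 0) (h0 : det3 b u v ≠ 0)
    (h1 : det3 w b v ≠ 0) (h2 : det3 w u b ≠ 0)
    (hd : Disjoint (segment ℝ w b) (segment ℝ u v)) : InTri w u v b ↔ InCone w u v b := by
  unfold InTri InCone
  refine ⟨fun h => ⟨h.2.2, h.2.1⟩, fun h => ⟨?_, h.2, h.1⟩⟩
  by_contra! hcon
  have e1 : det3 u v b = det3 b u v := (det3_cycle b u v).symm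
  have e2 : det3 u v w = det3 w u v := (det3_cycle w u v).symm
  have e3 : det3 w b u = - det3 w u b := det3_swap' w b u
  refine (not_disjoint_segment_iff (a := w) (b := b) (c := u) (d := v) (by
    rw [e3]; exact neg_ne_zero.2 h2) h1 (by rwa [e2]) (by rwa [e1])).2 ⟨?_, ?_⟩ hd
  · rw [e3]
    have hD2 : 0 < det3 w u v ^ 2 := by positivity
    have := mul_pos h.1 h.2
    nlinarith
  · rw [e1, e2, mul_comm]
    exact lt_of_le_of_ne hcon (mul_ne_zero h0 hD)

variable {V : Type*} {G : SimpleGraph V}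

/-- In a plane drawing, two disjoint connected sets that avoid the vertex `w` do not have
alternating neighbours around `w`. -/
theorem not_alternating {S X Y : Set V} {p : V → ℝ × ℝ} {w : V} (hw : w ∈ S)
    (hgen : ∀ i ∈ S, ∀ j ∈ S, ∀ k ∈ S, i ≠ j → i ≠ k → j ≠ k → det3 (p i) (p j) (p k) ≠ 0)
    (hXS : X ⊆ S) (hYS : Y ⊆ S) (hwX : w ∉ X) (hwY : w ∉ Y) (hXY : Disjoint X Y)
    (hX : Conn G X) (hY : Conn G Y) {a₁ a₂ b₁ b₂ : V} (ha₁ : a₁ ∈ X) (ha₂ : a₂ ∈ X) (hb₁ : b₁ ∈ Y)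
    (hb₂ : b₂ ∈ Y) (hb : b₁ ≠ b₂)
    (hd : ∀ u ∈ X, ∀ v ∈ X, G.Adj u v → ∀ q ∈ Y, ∀ q' ∈ Y, G.Adj q q' →
      Disjoint (segment ℝ (p u) (p v)) (segment ℝ (p q) (p q')))
    (hda₁ : ∀ q ∈ Y, ∀ q' ∈ Y, G.Adj q q' →
      Disjoint (segment ℝ (p w) (p a₁)) (segment ℝ (p q) (p q')))
    (hda₂ : ∀ q ∈ Y, ∀ q' ∈ Y, G.Adj q q' →
      Disjoint (segment ℝ (p w) (p a₂)) (segment ℝ (p q) (p q')))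
    (hdb₁ : ∀ q ∈ X, ∀ q' ∈ X, G.Adj q q' →
      Disjoint (segment ℝ (p w) (p b₁)) (segment ℝ (p q) (p q')))
    (hdb₂ : ∀ q ∈ X, ∀ q' ∈ X, G.Adj q q' →
      Disjoint (segment ℝ (p w) (p b₂)) (segment ℝ (p q) (p q'))) :
    InCone (p w) (p b₁) (p b₂) (p a₁) → InCone (p w) (p b₁) (p b₂) (p a₂) := by
  have nXY : ∀ {x y}, x ∈ X → y ∈ Y → x ≠ y := fun hx hy h =>
    Set.disjoint_left.1 hXY hx (h ▸ hy)
  have nX : ∀ {x}, x ∈ X → w ≠ x := fun hx h => hwX (h ▸ hx)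
  have nY : ∀ {x}, x ∈ Y → w ≠ x := fun hx h => hwY (h ▸ hx)
  have two : (2 : ZMod 2) = 0 := by decide
  -- `I q` counts modulo two the triangles `wuv` containing `q`, over the edges `uv` of a walk from
  -- `a₁` to `a` in `X`. Along an edge of `Y` it changes only by crossings with the first and the
  -- last spoke, since inner spokes cancel (`tri_parity`). At `b₁`, `b₂` triangles may be replaced
  -- by cones, and the count telescopes by `cone_parity`.
  have main : ∀ a ∈ X, ∃ I : V → ZMod 2,
      (∀ q ∈ Y, ∀ q' ∈ Y, G.Adj q q' → I q + I q' =
        ind (¬ Disjoint (segment ℝ (p w) (p a₁)) (segment ℝ (p q) (p q'))) +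
        ind (¬ Disjoint (segment ℝ (p w) (p a)) (segment ℝ (p q) (p q')))) ∧
      I b₁ + I b₂ = ind (InCone (p w) (p b₁) (p b₂) (p a₁)) +
        ind (InCone (p w) (p b₁) (p b₂) (p a)) := by
    refine hX.induction ha₁ ⟨0, fun q _ q' _ _ => ?_, ?_⟩ ?_
    · have : ∀ x : ZMod 2, (0 : V → ZMod 2) q + (0 : V → ZMod 2) q' = x + x := fun x => by
        simp only [Pi.zero_apply]; linear_combination -x * two
      exact this _
    · have : ∀ x : ZMod 2, (0 : V → ZMod 2) b₁ + (0 : V → ZMod 2) b₂ = x + x := fun x => by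
        simp only [Pi.zero_apply]; linear_combination -x * two
      exact this _
    · rintro u hu v hv huv ⟨I, hI1, hI2⟩
      refine ⟨fun q => I q + ind (InTri (p w) (p u) (p v) (p q)), fun q hq q' hq' hqq' => ?_, ?_⟩
      · have h := tri_parity (w := p w) (u := p u) (v := p v) (q := p q) (q' := p q')
          (hgen _ hw _ (hXS hu) _ (hXS hv) (nX hu) (nX hv) huv.ne)
          (hgen _ (hYS hq) _ (hXS hu) _ (hXS hv) (nXY hu hq).symm (nXY hv hq).symm huv.ne)
          (hgen _ hw _ (hYS hq) _ (hXS hv) (nY hq) (nX hv) (nXY hv hq).symm)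
          (hgen _ hw _ (hXS hu) _ (hYS hq) (nX hu) (nY hq) (nXY hu hq))
          (hgen _ (hYS hq') _ (hXS hu) _ (hXS hv) (nXY hu hq').symm (nXY hv hq').symm huv.ne)
          (hgen _ hw _ (hYS hq') _ (hXS hv) (nY hq') (nX hv) (nXY hv hq').symm)
          (hgen _ hw _ (hXS hu) _ (hYS hq') (nX hu) (nY hq') (nXY hu hq'))
          (hgen _ (hYS hq) _ (hYS hq') _ hw hqq'.ne (nY hq).symm (nY hq').symm)
          (hgen _ (hYS hq) _ (hYS hq') _ (hXS hu) hqq'.ne (nXY hu hq).symm (nXY hu hq').symm)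
          (hgen _ (hYS hq) _ (hYS hq') _ (hXS hv) hqq'.ne (nXY hv hq).symm (nXY hv hq').symm)
          (hd u hu v hv huv q hq q' hq' hqq')
        linear_combination hI1 q hq q' hq' hqq' + h +
          ind (¬ Disjoint (segment ℝ (p w) (p u)) (segment ℝ (p q) (p q'))) * two
      · have hc := cone_parity (w := p w) (u := p u) (v := p v) (b := p b₁) (b' := p b₂)
          (hgen _ hw _ (hXS hu) _ (hXS hv) (nX hu) (nX hv) huv.ne)
          (hgen _ hw _ (hYS hb₁) _ (hYS hb₂) (nY hb₁) (nY hb₂) hb)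
          (hgen _ hw _ (hXS hu) _ (hYS hb₁) (nX hu) (nY hb₁) (nXY hu hb₁))
          (hgen _ hw _ (hXS hu) _ (hYS hb₂) (nX hu) (nY hb₂) (nXY hu hb₂))
          (hgen _ hw _ (hXS hv) _ (hYS hb₁) (nX hv) (nY hb₁) (nXY hv hb₁))
          (hgen _ hw _ (hXS hv) _ (hYS hb₂) (nX hv) (nY hb₂) (nXY hv hb₂))
        have ht : ∀ b ∈ Y, Disjoint (segment ℝ (p w) (p b)) (segment ℝ (p u) (p v)) →
            (InTri (p w) (p u) (p v) (p b) ↔ InCone (p w) (p u) (p v) (p b)) := fun b hb hd =>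
          inTri_iff_inCone (hgen _ hw _ (hXS hu) _ (hXS hv) (nX hu) (nX hv) huv.ne)
            (hgen _ (hYS hb) _ (hXS hu) _ (hXS hv) (nXY hu hb).symm (nXY hv hb).symm huv.ne)
            (hgen _ hw _ (hYS hb) _ (hXS hv) (nY hb) (nX hv) (nXY hv hb).symm)
            (hgen _ hw _ (hXS hu) _ (hYS hb) (nX hu) (nY hb) (nXY hu hb)) hd
        show I b₁ + ind _ + (I b₂ + ind _) = _
        rw [propext (ht b₁ hb₁ (hdb₁ u hu v hv huv)), propext (ht b₂ hb₂ (hdb₂ u hu v hv huv))]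
        linear_combination hI2 + hc + ind (InCone (p w) (p b₁) (p b₂) (p u)) * two
  obtain ⟨I, hI1, hI2⟩ := main a₂ ha₂
  -- Edges of `Y` cross neither of the spokes to `a₁` and `a₂`, so `I` is constant on the connected
  -- set `Y`.
  have hconst : ∀ q ∈ Y, I q = I b₁ := by
    refine hY.induction hb₁ rfl fun q hq q' hq' hqq' h => ?_
    have h1 := hI1 q hq q' hq' hqq'
    have z : ∀ P : Prop, P → ind (¬ P) = 0 := fun P hP => by simp [ind, hP]
    rw [z _ (hda₁ q hq q' hq' hqq'), z _ (hda₂ q hq q' hq' hqq')] at h1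
    linear_combination h1 + h - I q * two
  rw [hconst b₂ hb₂] at hI2
  intro h
  by_contra hn
  simp only [ind, h, hn, if_true, if_false] at hI2
  have : (1 : ZMod 2) = 0 := by linear_combination -hI2 + I b₁ * two
  exact absurd this (by decide)

end Parity

end RectilinearCrossing


namespace RectilinearCrossing

/-! ### Completing one side of a separation by a clique. -/

section Torso

variable {V : Type*} {G : SimpleGraph V} {U A B S : Set V}

/-- The subgraph of `G` induced by `U`, with all edges between vertices of `S` added. -/
def torso (G : SimpleGraph V) (U S : Set V) : SimpleGraph V where
  Adj u v := u ≠ v ∧ u ∈ U ∧ v ∈ U ∧ (G.Adj u v ∨ (u ∈ S ∧ v ∈ S))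
  symm := ⟨fun _ _ h => ⟨h.1.symm, h.2.2.1, h.2.1, h.2.2.2.imp SimpleGraph.Adj.symm And.symm⟩⟩
  loopless := ⟨fun _ h => h.1 rfl⟩

lemma torso_livesIn : LivesIn (torso G U S) U := fun _ _ h => h.2.1

lemma torso_adj_of {u v : V} (hu : u ∈ U) (hv : v ∈ U) (h : G.Adj u v) : (torso G U S).Adj u v :=
  ⟨h.ne, hu, hv, Or.inl h⟩

lemma torso_adj_iff {u v : V} (hu : u ∉ S) : (torso G U S).Adj u v ↔ G.Adj u v ∧ u ∈ U ∧ v ∈ U :=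
  ⟨fun h => ⟨h.2.2.2.resolve_right fun h' => hu h'.1, h.2.1, h.2.2.1⟩,
    fun h => torso_adj_of h.2.1 h.2.2 h.1⟩

/-- If both sides of a cut meet `S`, an added edge crosses. Otherwise a side lies within `A`, and
the edge of `G` leaving it ends in `A ∪ S`. -/
lemma Conn.torso {Z : Set V} (hAU : A ∪ S ⊆ U) (hA : ∀ u ∈ A, ∀ v ∈ U, G.Adj u v → v ∈ A ∪ S)
    (h : Conn G (U \ Z)) : Conn (torso G (A ∪ S) S) ((A ∪ S) \ Z) := by
  have key : ∀ M ⊆ (A ∪ S) \ Z, M.Nonempty → (((A ∪ S) \ Z) \ M).Nonempty → Disjoint M S →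
      ∃ u ∈ M, ∃ v ∈ ((A ∪ S) \ Z) \ M, (RectilinearCrossing.torso G (A ∪ S) S).Adj u v := by
    rintro M hM h1 ⟨b, hb⟩ hMS
    obtain ⟨u, hu, v, hv, huv⟩ := h M (fun x hx => ⟨hAU (hM hx).1, (hM hx).2⟩) h1
      ⟨b, ⟨hAU hb.1.1, hb.1.2⟩, hb.2⟩
    have huA : u ∈ A := (hM hu).1.resolve_right fun h => Set.disjoint_left.1 hMS hu h
    have hvA := hA u huA v hv.1.1 huv
    exact ⟨u, hu, v, ⟨⟨hvA, hv.1.2⟩, hv.2⟩, torso_adj_of (hM hu).1 hvA huv⟩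
  intro M hM h1 h2
  by_cases hMS : Disjoint M S
  · exact key M hM h1 h2 hMS
  by_cases hNS : Disjoint (((A ∪ S) \ Z) \ M) S
  · have hMM : ((A ∪ S) \ Z) \ (((A ∪ S) \ Z) \ M) = M := by
      rw [Set.sdiff_sdiff_right_self]; exact Set.inter_eq_self_of_subset_right hM
    obtain ⟨u, hu, v, hv, huv⟩ := key _ Set.sdiff_subset h2 (by rwa [hMM]) hNS
    rw [hMM] at hv
    exact ⟨v, hv, u, hu, huv.symm⟩
  · obtain ⟨s, hsM, hsS⟩ := Set.not_disjoint_iff.1 hMS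
    obtain ⟨t, htM, htS⟩ := Set.not_disjoint_iff.1 hNS
    exact ⟨s, hsM, t, htM, fun h => htM.2 (h ▸ hsM), (hM hsM).1, htM.1.1, Or.inr ⟨hsS, htS⟩⟩

/-- A torso is a minor when the vertices of `S` other than `z` are adjacent, and the rest of
the graph can be contracted to `z`. -/
lemma HasK33.of_torso {z : V} (hB : Conn G B) (hBU : Disjoint B U)
    (hzB : ∃ b ∈ B, G.Adj z b)
    (hS : ∀ s ∈ S, s ≠ z → ∃ b ∈ B, G.Adj s b)
    (hSS : ∀ s ∈ S, ∀ t ∈ S, s ≠ t → s ≠ z → t ≠ z → G.Adj s t)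
    (h : HasK33 (torso G U S)) : HasK33 G := by
  classical
  -- The branch set of `z` absorbs `B`, which supplies the missing edges between `z` and the rest of
  -- `S`.
  refine h.of_model (U := U) torso_livesIn (fun v => if v = z then {z} ∪ B else {v}) ?_ ?_ ?_
  · intro v hv
    split_ifs with h
    · obtain ⟨b, hb, hzb⟩ := hzB
      exact ⟨⟨z, by simp⟩, (conn_singleton z).union hB rfl hb (Or.inr hzb)⟩
    · exact ⟨⟨v, rfl⟩, conn_singleton v⟩
  · intro u hu v hv huv
    have hnB : ∀ x ∈ U, x ∉ B := fun x hx hxB => Set.disjoint_left.1 hBU hxB hx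
    split_ifs with h h' h'
    · exact absurd (h.trans h'.symm) huv
    · rw [Set.disjoint_singleton_right]; rintro (h1 | h1)
      exacts [h' h1, hnB v hv h1]
    · rw [Set.disjoint_singleton_left]; rintro (h1 | h1)
      exacts [h h1, hnB u hu h1]
    · simpa using huv
  · rintro u v ⟨huv, hu, hv, h1 | ⟨h1, h2⟩⟩
    · refine ⟨u, ?_, v, ?_, h1⟩
      · split_ifs with h
        exacts [Or.inl h, rfl]
      · split_ifs with h
        exacts [Or.inl h, rfl]
    · split_ifs with h h' h'
      · exact absurd (h.trans h'.symm) huv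
      · obtain ⟨b, hb, hvb⟩ := hS v h2 h'
        exact ⟨b, Or.inr hb, v, rfl, hvb.symm⟩
      · obtain ⟨b, hb, hub⟩ := hS u h1 h
        exact ⟨u, rfl, b, Or.inr hb, hub⟩
      · exact ⟨u, rfl, v, rfl, hSS u h1 v h2 huv h h'⟩

end Torso

/-! ### Plane placements, their perturbation and the smallest case. -/

section Drawings

variable {V : Type*} {G : SimpleGraph V} {U C : Set V} {a b : V} {p : V → ℝ × ℝ} {T : ℝ × ℝ}

/-- A straight-line placement of the vertices, not necessarily injective, in which edges without a
common end position are disjoint. -/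
def PlaneMap (G : SimpleGraph V) (p : V → ℝ × ℝ) : Prop :=
  ∀ u v u' v', G.Adj u v → G.Adj u' v' → p u ≠ p u' → p u ≠ p v' → p v ≠ p u' → p v ≠ p v' →
    Disjoint (segment ℝ (p u) (p v)) (segment ℝ (p u') (p v'))

/-- No three distinct positions are collinear. -/
def NoThree (p : V → ℝ × ℝ) : Prop :=
  ∀ u v w, p u ≠ p v → p u ≠ p w → p v ≠ p w → det3 (p u) (p v) (p w) ≠ 0

/-- The vertices of `U` lie inside the triangle `p a`, `p b`, `T`, except that `a`, `b` are two of its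
corners and the vertices of `C` are at the third one. -/
structure Rooted (U : Set V) (a b : V) (C : Set V) (p : V → ℝ × ℝ) (T : ℝ × ℝ) : Prop where
  det_ne : det3 (p a) (p b) T ≠ 0
  corner : ∀ c ∈ C, p c = T
  inTri : ∀ v ∈ U, v ≠ a → v ≠ b → v ∉ C → InTri (p a) (p b) T (p v)

lemma Rooted.inCTri (h : Rooted U a b C p T) {v : V} (hv : v ∈ U) : InCTri (p a) (p b) T (p v) := by
  by_cases h1 : v = a
  · rw [h1]; exact inCTri_left
  by_cases h2 : v = b
  · rw [h2]; exact inCTri_mid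
  by_cases h3 : v ∈ C
  · rw [h.corner v h3]; exact inCTri_right
  · exact (h.inTri v hv h1 h2 h3).inCTri

/-- The pairs of edges to be kept disjoint are selected by the fixed `p`, not by `q`. So this is a
finite intersection of open conditions, and `q` may separate vertices that coincide in `p`. -/
lemma isOpen_planeMap [Finite V] (G : SimpleGraph V) (p : V → ℝ × ℝ) :
    IsOpen {q : V → ℝ × ℝ | ∀ u v u' v', G.Adj u v → G.Adj u' v' → p u ≠ p u' → p u ≠ p v' →
      p v ≠ p u' → p v ≠ p v' →
      Disjoint (segment ℝ (q u) (q v)) (segment ℝ (q u') (q v'))} := by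
  simp only [Set.ofPred_forall]
  refine isOpen_iInter_of_finite fun u => isOpen_iInter_of_finite fun v =>
    isOpen_iInter_of_finite fun u' => isOpen_iInter_of_finite fun v' =>
    isOpen_iInter_of_finite fun _ => isOpen_iInter_of_finite fun _ =>
    isOpen_iInter_of_finite fun _ => isOpen_iInter_of_finite fun _ =>
    isOpen_iInter_of_finite fun _ => isOpen_iInter_of_finite fun _ => ?_
  exact isOpen_disjoint_segment' (continuous_apply u) (continuous_apply v) (continuous_apply u')
    (continuous_apply v')

/-- A rooted plane placement can be put in general position. -/
lemma exists_noThree [Finite V] (hC : C.Subsingleton) (h : PlaneMap G p) (hr : Rooted U a b C p T) :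
    ∃ p' T', PlaneMap G p' ∧ Rooted U a b C p' T' ∧ NoThree p' ∧ ∀ u v, p' u = p' v ↔ p u = p v := by
  have := Fintype.ofFinite V
  -- The third corner has to move with the vertex of `C` if there is one, and stays fixed if there
  -- is none.
  obtain ⟨τ, hτ, hτp, hτC⟩ : ∃ τ : (V → ℝ × ℝ) → ℝ × ℝ, Continuous τ ∧ τ p = T ∧
      ∀ c ∈ C, ∀ q, q c = τ q := by
    rcases C.eq_empty_or_nonempty with hC' | ⟨c, hc⟩
    · exact ⟨fun _ => T, continuous_const, rfl, by simp [hC']⟩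
    · exact ⟨fun q => q c, continuous_apply c, hr.corner c hc, fun c' hc' q => by rw [hC hc hc']⟩
  have ho1 := isOpen_planeMap G p
  have ho2 : IsOpen {q : V → ℝ × ℝ | det3 (q a) (q b) (τ q) ≠ 0} :=
    isOpen_ne_fun (continuous_det3 (continuous_apply a) (continuous_apply b) hτ) continuous_const
  have ho3 : IsOpen {q : V → ℝ × ℝ | ∀ v ∈ U, v ≠ a → v ≠ b → v ∉ C →
      InTri (q a) (q b) (τ q) (q v)} := by
    simp only [Set.ofPred_forall]
    refine isOpen_iInter_of_finite fun v => isOpen_iInter_of_finite fun _ =>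
      isOpen_iInter_of_finite fun _ => isOpen_iInter_of_finite fun _ =>
      isOpen_iInter_of_finite fun _ => ?_
    exact isOpen_inTri (continuous_apply a) (continuous_apply b) hτ (continuous_apply v)
  obtain ⟨p', ⟨⟨h1, h2⟩, h3⟩, he, hg⟩ := exists_perturbation ((ho1.inter ho2).inter ho3) (p := p)
    ⟨⟨h, by rw [Set.mem_ofPred_eq, hτp]; exact hr.det_ne⟩, by
      rw [Set.mem_ofPred_eq, hτp]; exact hr.inTri⟩
  refine ⟨p', τ p', fun u v u' v' e e' n1 n2 n3 n4 => h1 u v u' v' e e' (mt (he _ _).2 n1)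
    (mt (he _ _).2 n2) (mt (he _ _).2 n3) (mt (he _ _).2 n4), ⟨h2, fun c hc => hτC c hc p', h3⟩,
    hg, he⟩

/-- Three corners of a triangle and a point inside. -/
def tetra : Fin 4 → ℤ × ℤ := ![(0, 0), (4, 0), (0, 4), (1, 1)]

/-- Integer coordinates make the orientation signs decidable. -/
lemma tetra_disjoint {i j k l : Fin 4} (h : [i, j, k, l].Nodup) :
    Disjoint (segment ℝ (((tetra i).1 : ℝ), ((tetra i).2 : ℝ)) ((tetra j).1, (tetra j).2))
      (segment ℝ (((tetra k).1 : ℝ), ((tetra k).2 : ℝ)) ((tetra l).1, (tetra l).2)) := by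
  let d : Fin 4 → Fin 4 → Fin 4 → ℤ := fun i j k =>
    ((tetra j).1 - (tetra i).1) * ((tetra k).2 - (tetra i).2) -
      ((tetra j).2 - (tetra i).2) * ((tetra k).1 - (tetra i).1)
  have hd : ∀ i j k : Fin 4, det3 (((tetra i).1 : ℝ), ((tetra i).2 : ℝ)) ((tetra j).1, (tetra j).2)
      ((tetra k).1, (tetra k).2) = (d i j k : ℝ) := by
    intro i j k; simp only [det3, d]; push_cast; ring
  have key : ∀ i j k l : Fin 4, [i, j, k, l].Nodup → d i j k ≠ 0 ∧ d i j l ≠ 0 ∧ d k l i ≠ 0 ∧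
      d k l j ≠ 0 ∧ ¬ (d i j k * d i j l < 0 ∧ d k l i * d k l j < 0) := by decide
  obtain ⟨h1, h2, h3, h4, h5⟩ := key i j k l h
  by_contra hc
  rw [not_disjoint_segment_iff (by rw [hd]; exact_mod_cast h1) (by rw [hd]; exact_mod_cast h2)
    (by rw [hd]; exact_mod_cast h3) (by rw [hd]; exact_mod_cast h4), hd, hd, hd, hd] at hc
  exact h5 (by exact_mod_cast hc)

/-- A graph with at most one vertex besides its roots. -/
lemma exists_rooted_of_subsingleton (hG : LivesIn G U) (hab : a ≠ b) (hC : C.Subsingleton)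
    (haC : a ∉ C) (hbC : b ∉ C) (hR : (U \ ({a, b} ∪ C)).Subsingleton) :
    ∃ p T, PlaneMap G p ∧ Rooted U a b C p T ∧ Set.InjOn p U := by
  classical
  let κ : V → Fin 4 := fun v => if v = a then 0 else if v = b then 1 else if v ∈ C then 2 else 3
  have hκ : Set.InjOn κ U := by
    intro u hu v hv huv
    have hR' : u ≠ a → u ≠ b → u ∉ C → v ≠ a → v ≠ b → v ∉ C → u = v := fun h1 h2 h3 h4 h5 h6 =>
      hR ⟨hu, by simp [h1, h2, h3]⟩ ⟨hv, by simp [h4, h5, h6]⟩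
    simp only [κ] at huv
    split_ifs at huv
    all_goals first
      | exact hC ‹_› ‹_›
      | (exfalso; revert huv; decide)
      | simp_all
  let p : V → ℝ × ℝ := fun v => ((tetra (κ v)).1, (tetra (κ v)).2)
  have hp : ∀ u v, κ u = κ v → p u = p v := fun u v h => by simp only [p, h]
  have ka : κ a = 0 := by simp [κ]
  have kb : κ b = 1 := by simp [κ, hab.symm]
  refine ⟨p, (0, 4), ?_, ⟨?_, ?_, ?_⟩, ?_⟩
  · intro u v u' v' e e' n1 n2 n3 n4
    refine tetra_disjoint ?_
    have h1 : κ u ≠ κ v := fun h => e.ne (hκ (hG e) (hG.right e) h)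
    have h2 : κ u' ≠ κ v' := fun h => e'.ne (hκ (hG e') (hG.right e') h)
    have := mt (hp _ _) n1
    have := mt (hp _ _) n2
    have := mt (hp _ _) n3
    have := mt (hp _ _) n4
    simp [*]
  · simp [p, ka, kb, tetra, det3]
  · intro c hc
    have : κ c = 2 := by
      have h1 : c ≠ a := fun h => haC (h ▸ hc)
      have h2 : c ≠ b := fun h => hbC (h ▸ hc)
      simp [κ, h1, h2, hc]
    simp [p, this, tetra]
  · intro v hv h1 h2 h3
    have : κ v = 3 := by simp [κ, h1, h2, h3]
    have t0 : tetra 0 = (0, 0) := rfl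
    have t1 : tetra 1 = (4, 0) := rfl
    have t3 : tetra 3 = (1, 1) := rfl
    simp only [p, ka, kb, this, t0, t1, t3, InTri, det3]
    norm_num
  · intro u hu v hv huv
    refine hκ hu hv ?_
    have inj : ∀ i j : Fin 4, tetra i = tetra j → i = j := by decide
    simp only [p, Prod.mk.injEq, Int.cast_inj] at huv
    exact inj _ _ (Prod.ext huv.1 huv.2)

end Drawings

end RectilinearCrossing


namespace RectilinearCrossing

/-! ### Inserting one drawing into an empty triangle of another. -/

section TriangleSum

variable {V : Type*} {G : SimpleGraph V} {A B : Set V} {x y z : V} {pA pB : V → ℝ × ℝ}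

/-- A drawing rooted at a triangle is put into an empty triangle of another drawing. -/
lemma exists_planeMap_triangle_sum (hG : LivesIn G (A ∪ B ∪ {x, y, z}))
    (hAB : Disjoint A B) (hAS : Disjoint A {x, y, z}) (hBS : Disjoint B {x, y, z})
    (hxy : x ≠ y) (hxz : x ≠ z) (hyz : y ≠ z)
    (hE : ∀ u ∈ A, ∀ v ∈ B, ¬ G.Adj u v)
    (hpA : PlaneMap (torso G (A ∪ {x, y, z}) {x, y, z}) pA) (hiA : Set.InjOn pA (A ∪ {x, y, z}))
    (hD : det3 (pA x) (pA y) (pA z) ≠ 0)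
    (hout : ∀ v ∈ A, ¬ InCTri (pA x) (pA y) (pA z) (pA v))
    (hpB : PlaneMap (torso G (B ∪ {x, y, z}) {x, y, z}) pB) (hiB : Set.InjOn pB (B ∪ {x, y, z}))
    (hDB : det3 (pB x) (pB y) (pB z) ≠ 0)
    (hB : ∀ v ∈ B, InTri (pB x) (pB y) (pB z) (pB v)) :
    ∃ p, PlaneMap G p ∧ (∀ v, v ∉ B → p v = pA v) ∧ Set.InjOn p (A ∪ B ∪ {x, y, z}) ∧
      ∀ v ∈ B, InTri (pA x) (pA y) (pA z) (p v) := by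
  classical
  set S : Set V := {x, y, z} with hS
  have hxS : x ∈ S := by simp [hS]
  have hyS : y ∈ S := by simp [hS]
  have hzS : z ∈ S := by simp [hS]
  obtain ⟨L, Lx, Ly, Lz, Linj, Lseg, Ltri⟩ := exists_affine hDB hD
  let p : V → ℝ × ℝ := fun v => if v ∈ B then L (pB v) else pA v
  have pA' : ∀ v, v ∉ B → p v = pA v := fun v hv => if_neg hv
  have nAB : ∀ v ∈ A, v ∉ B := fun v hv hv' => Set.disjoint_left.1 hAB hv hv'
  have nSB : ∀ v ∈ S, v ∉ B := fun v hv hv' => Set.disjoint_left.1 hBS hv' hv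
  have pAS : ∀ v ∈ A ∪ S, p v = pA v := fun v hv => pA' v (hv.elim (nAB v) (nSB v))
  have pBS : ∀ v ∈ B ∪ S, p v = L (pB v) := by
    rintro v (hv | hv)
    · exact if_pos hv
    · rw [pA' v (nSB v hv)]
      rcases hv with rfl | rfl | rfl
      exacts [Lx.symm, Ly.symm, Lz.symm]
  have triB : ∀ v ∈ B, InTri (pA x) (pA y) (pA z) (p v) := fun v hv => by
    rw [pBS v (Or.inl hv)]; exact Ltri _ (hB v hv)
  have ctriBS : ∀ v ∈ B ∪ S, InCTri (pA x) (pA y) (pA z) (p v) := by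
    rintro v (hv | hv)
    · exact (triB v hv).inCTri
    · rw [pA' v (nSB v hv)]
      rcases hv with rfl | rfl | rfl
      exacts [inCTri_left, inCTri_mid, inCTri_right]
  have hinj : Set.InjOn p (A ∪ B ∪ S) := by
    have iA : ∀ u ∈ A ∪ S, ∀ v ∈ A ∪ S, p u = p v → u = v := fun u hu v hv h =>
      hiA hu hv (by rwa [pAS u hu, pAS v hv] at h)
    have iB : ∀ u ∈ B ∪ S, ∀ v ∈ B ∪ S, p u = p v → u = v := fun u hu v hv h =>
      hiB hu hv (Linj (by rwa [pBS u hu, pBS v hv] at h))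
    have iAB : ∀ u ∈ A, ∀ v ∈ B, p u ≠ p v := fun u hu v hv h =>
      hout u hu (by rw [← pA' u (nAB u hu), h]; exact (triB v hv).inCTri)
    rintro u ((hu | hu) | hu) v ((hv | hv) | hv) h
    · exact iA u (Or.inl hu) v (Or.inl hv) h
    · exact absurd h (iAB u hu v hv)
    · exact iA u (Or.inl hu) v (Or.inr hv) h
    · exact absurd h.symm (iAB v hv u hu)
    · exact iB u (Or.inl hu) v (Or.inl hv) h
    · exact iB u (Or.inl hu) v (Or.inr hv) h
    · exact iA u (Or.inr hu) v (Or.inl hv) h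
    · exact iB u (Or.inr hu) v (Or.inl hv) h
    · exact iA u (Or.inr hu) v (Or.inr hv) h
  refine ⟨p, ?_, pA', hinj, triB⟩
  have nAS : ∀ u ∈ A, ∀ s ∈ S, u ≠ s := fun u hu s hs h => Set.disjoint_left.1 hAS hu (h ▸ hs)
  have side : ∀ u ∈ A, ∀ v ∈ A ∪ S, G.Adj u v → ∀ s ∈ S, ∀ t ∈ S, s ≠ t → v ≠ s → v ≠ t →
      Disjoint (segment ℝ (pA u) (pA v)) (segment ℝ (pA s) (pA t)) := by
    intro u hu v hv huv s hs t ht hst hvs hvt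
    refine hpA u v s t (torso_adj_of (Or.inl hu) hv huv) ⟨hst, Or.inr hs, Or.inr ht, Or.inr ⟨hs, ht⟩⟩
      ?_ ?_ ?_ ?_
    · exact fun h => nAS u hu s hs (hiA (Or.inl hu) (Or.inr hs) h)
    · exact fun h => nAS u hu t ht (hiA (Or.inl hu) (Or.inr ht) h)
    · exact fun h => hvs (hiA hv (Or.inr hs) h)
    · exact fun h => hvt (hiA hv (Or.inr ht) h)
  -- An edge arriving from outside at a corner meets the triangle only there, and a corner is an
  -- extreme point, so no inner segment with other ends passes through it.
  have corner : ∀ s ∈ S, ∀ t ∈ S, ∀ r ∈ S, s ≠ t → s ≠ r → t ≠ r →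
      det3 (pA s) (pA t) (pA r) ≠ 0 →
      (∀ q, InCTri (pA s) (pA t) (pA r) q ↔ InCTri (pA x) (pA y) (pA z) q) →
      ∀ u ∈ A, G.Adj u s → ∀ u' ∈ B ∪ S, ∀ v' ∈ B ∪ S, p s ≠ p u' → p s ≠ p v' →
      Disjoint (segment ℝ (p u) (p s)) (segment ℝ (p u') (p v')) := by
    intro s hs t ht r hr hst hsr htr hD' hiff u hu hus u' hu' v' hv' n1 n2
    rw [pA' u (nAB u hu), Set.disjoint_left]
    rw [pA' s (nSB s hs)] at n1 n2 ⊢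
    intro m hm hm'
    have hmT := (ctriBS u' hu').segment (ctriBS v' hv') hm'
    have := eq_corner_of_mem_tri hD' (mt (hiff _).1 (hout u hu))
      (side u hu s (Or.inr hs) hus t ht r hr htr hst hsr) hm ((hiff m).2 hmT)
    rw [this] at hm'
    exact corner_notMem_segment hD' ((hiff _).2 (ctriBS u' hu')) ((hiff _).2 (ctriBS v' hv'))
      n1.symm n2.symm hm'
  have mixed : ∀ u ∈ A, ∀ v ∈ A ∪ S, G.Adj u v → ∀ u' ∈ B ∪ S, ∀ v' ∈ B ∪ S, p v ≠ p u' →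
      p v ≠ p v' → Disjoint (segment ℝ (p u) (p v)) (segment ℝ (p u') (p v')) := by
    rintro u hu v (hv | hv) huv u' hu' v' hv' n1 n2
    · rw [pA' u (nAB u hu), pA' v (nAB v hv), Set.disjoint_left]
      intro m hm hm'
      exact not_mem_tri_of_disjoint hD (hout u hu)
        (side u hu v (Or.inl hv) huv x hxS y hyS hxy (nAS v hv x hxS) (nAS v hv y hyS))
        (side u hu v (Or.inl hv) huv y hyS z hzS hyz (nAS v hv y hyS) (nAS v hv z hzS))
        (side u hu v (Or.inl hv) huv z hzS x hxS hxz.symm (nAS v hv z hzS) (nAS v hv x hxS)) m hm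
        ((ctriBS u' hu').segment (ctriBS v' hv') hm')
    · rcases hv with rfl | rfl | rfl
      · exact corner _ hxS _ hyS _ hzS hxy hxz hyz hD (fun q => Iff.rfl) u hu huv u' hu' v' hv' n1 n2
      · exact corner _ hyS _ hzS _ hxS hyz hxy.symm hxz.symm (by rwa [← det3_cycle])
          (fun q => ⟨fun h => h.rotate.rotate, fun h => h.rotate⟩) u hu huv u' hu' v' hv' n1 n2
      · exact corner _ hzS _ hxS _ hyS hxz.symm hyz.symm hxy (by rwa [det3_cycle])
          (fun q => ⟨fun h => h.rotate, fun h => h.rotate.rotate⟩) u hu huv u' hu' v' hv' n1 n2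
  have cls : ∀ u v, G.Adj u v → (u ∈ A ∪ S ∧ v ∈ A ∪ S) ∨ (u ∈ B ∪ S ∧ v ∈ B ∪ S) := by
    intro u v huv
    have h1 := hG huv
    have h2 := hG.right huv
    have h3 := hE u
    have h4 := hE v
    simp only [Set.mem_union] at *
    by_cases hu : u ∈ A
    · exact Or.inl ⟨Or.inl hu, (h2.imp_left fun h => h.resolve_right fun h' => h3 hu v h' huv)⟩
    · by_cases hv : v ∈ A
      · exact Or.inl ⟨(h1.imp_left fun h => h.resolve_right fun h' => h4 hv u h' huv.symm), Or.inl hv⟩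
      · tauto
  have mixed' : ∀ u ∈ A ∪ S, ∀ v ∈ A ∪ S, G.Adj u v → ∀ u' ∈ B ∪ S, ∀ v' ∈ B ∪ S, G.Adj u' v' →
      p u ≠ p u' → p u ≠ p v' → p v ≠ p u' → p v ≠ p v' →
      Disjoint (segment ℝ (p u) (p v)) (segment ℝ (p u') (p v')) := by
    intro u hu v hv huv u' hu' v' hv' huv' n1 n2 n3 n4
    by_cases huA : u ∈ A
    · exact mixed u huA v hv huv u' hu' v' hv' n3 n4
    by_cases hvA : v ∈ A
    · rw [segment_symm ℝ (p u)]
      exact mixed v hvA u hu huv.symm u' hu' v' hv' n1 n2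
    -- Both ends lie in `S`, so the pair of edges is already part of the drawing of `B ∪ S`.
    have hu2 : u ∈ B ∪ S := Or.inr (hu.resolve_left huA)
    have hv2 : v ∈ B ∪ S := Or.inr (hv.resolve_left hvA)
    rw [pBS u hu2, pBS v hv2, pBS u' hu', pBS v' hv'] at *
    rw [Lseg, Lseg, Set.disjoint_image_iff Linj]
    exact hpB u v u' v' (torso_adj_of hu2 hv2 huv) (torso_adj_of hu' hv' huv')
      (fun h => n1 (by rw [h])) (fun h => n2 (by rw [h])) (fun h => n3 (by rw [h]))
      (fun h => n4 (by rw [h]))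
  intro u v u' v' e e' n1 n2 n3 n4
  rcases cls u v e with ⟨hu, hv⟩ | ⟨hu, hv⟩ <;> rcases cls u' v' e' with ⟨hu', hv'⟩ | ⟨hu', hv'⟩
  · rw [pAS u hu, pAS v hv, pAS u' hu', pAS v' hv'] at *
    exact hpA u v u' v' (torso_adj_of hu hv e) (torso_adj_of hu' hv' e') n1 n2 n3 n4
  · exact mixed' u hu v hv e u' hu' v' hv' e' n1 n2 n3 n4
  · exact (mixed' u' hu' v' hv' e' u hu v hv e n1.symm n3.symm n2.symm n4.symm).symm
  · rw [pBS u hu, pBS v hv, pBS u' hu', pBS v' hv'] at *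
    rw [Lseg, Lseg, Set.disjoint_image_iff Linj]
    exact hpB u v u' v' (torso_adj_of hu hv e) (torso_adj_of hu' hv' e')
      (fun h => n1 (by rw [h])) (fun h => n2 (by rw [h])) (fun h => n3 (by rw [h]))
      (fun h => n4 (by rw [h]))

end TriangleSum

end RectilinearCrossing


namespace RectilinearCrossing

/-! ### Rooted 3-connected graphs and separating triples. -/

section ThreeConnected

variable {V : Type*} {G : SimpleGraph V} {U C : Set V} {a b : V}

/-- A 3-connected `K_{3,3}`-minor-free graph on `U` other than `K₅`, with pairwise adjacent roots `a`, `b`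
and the at most one vertex of `C`, such that the other vertices form a connected set. -/
structure RootedGraph (G : SimpleGraph V) (U : Set V) (a b : V) (C : Set V) : Prop where
  livesIn : LivesIn G U
  free : ¬ HasK33 G
  conn : ∀ s t, Conn G (U \ {s, t})
  ne_five : ¬ (U.ncard = 5 ∧ ∀ u ∈ U, ∀ v ∈ U, u ≠ v → G.Adj u v)
  subset : C ⊆ U
  subsingleton : C.Subsingleton
  left_notMem : a ∉ C
  right_notMem : b ∉ C
  adj : G.Adj a b
  adj_left : ∀ c ∈ C, G.Adj a c
  adj_right : ∀ c ∈ C, G.Adj b c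
  conn_rest : Conn G (U \ ({a, b} ∪ C))

/-- There is a plane drawing in general position inside a triangle with the roots as corners. -/
def Drawable (G : SimpleGraph V) (U : Set V) (a b : V) (C : Set V) : Prop :=
  ∃ p T, PlaneMap G p ∧ Rooted U a b C p T ∧ NoThree p ∧ Set.InjOn p U

lemma Drawable.of_rooted [Finite V] (hC : C.Subsingleton) {p : V → ℝ × ℝ} {T : ℝ × ℝ}
    (h : PlaneMap G p) (hr : Rooted U a b C p T) (hi : Set.InjOn p U) : Drawable G U a b C := by
  obtain ⟨p', T', h1, h2, h3, h4⟩ := exists_noThree hC h hr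
  exact ⟨p', T', h1, h2, h3, fun u hu v hv huv => hi hu hv ((h4 u v).1 huv)⟩

/-- Every separated part is adjacent to all three vertices of a separating triple. -/
lemma exists_adj_of_closed {x y z : V} {K : Set V} (h : Conn G (U \ {x, y})) (hz : z ∈ U)
    (hzx : z ≠ x) (hzy : z ≠ y) (hK : K ⊆ U \ {x, y, z}) (hne : K.Nonempty)
    (hcl : ∀ u ∈ K, ∀ v ∈ U \ {x, y, z}, G.Adj u v → v ∈ K) : ∃ u ∈ K, G.Adj u z := by
  have hzK : z ∉ K := fun h => by simpa using (hK h).2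
  obtain ⟨u, hu, v, hv, huv⟩ := h K (fun u hu => ⟨(hK hu).1, fun h' => (hK hu).2 (by
    simp only [Set.mem_insert_iff, Set.mem_singleton_iff] at h' ⊢; tauto)⟩) hne
    ⟨z, ⟨hz, by simp [hzx, hzy]⟩, hzK⟩
  have hvz : v = z := by
    by_contra hvz
    refine hv.2 (hcl u hu v ⟨hv.1.1, ?_⟩ huv)
    have := hv.1.2
    simp only [Set.mem_insert_iff, Set.mem_singleton_iff] at this ⊢
    tauto
  exact ⟨u, hu, hvz ▸ huv⟩

/-- By 3-connectivity every component of the rest sees all of `x`, `y`, `z`, so three components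
would give a `K_{3,3}` minor. -/
lemma RootedGraph.exists_separation [Finite V] (h : RootedGraph G U a b C) {x y z : V}
    (hx : x ∈ U) (hy : y ∈ U) (hz : z ∈ U) (hxy : x ≠ y) (hxz : x ≠ z) (hyz : y ≠ z)
    (hcut : ¬ Conn G (U \ {x, y, z})) {r : V} (hr : r ∈ U \ {x, y, z}) :
    ∃ A B : Set V, r ∈ A ∧ B.Nonempty ∧ A ∪ B = U \ {x, y, z} ∧ Disjoint A B ∧ Conn G A ∧ Conn G B ∧
      (∀ u ∈ A, ∀ v ∈ B, ¬ G.Adj u v) ∧ (∀ t ∈ ({x, y, z} : Set V), ∃ u ∈ A, G.Adj u t) ∧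
      ∀ t ∈ ({x, y, z} : Set V), ∃ u ∈ B, G.Adj u t := by
  have hadj : ∀ K ⊆ U \ {x, y, z}, K.Nonempty →
      (∀ u ∈ K, ∀ v ∈ U \ {x, y, z}, G.Adj u v → v ∈ K) →
      ∀ t ∈ ({x, y, z} : Set V), ∃ u ∈ K, G.Adj u t := by
    intro K hK hne hcl t ht
    have e1 : ({y, z, x} : Set V) = {x, y, z} := by ext; simp; tauto
    have e2 : ({x, z, y} : Set V) = {x, y, z} := by ext; simp; tauto
    rcases ht with rfl | rfl | rfl
    · exact exists_adj_of_closed (h.conn y z) hx hxy hxz (by rwa [e1]) hne (by rwa [e1])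
    · exact exists_adj_of_closed (h.conn x z) hy hxy.symm hyz (by rwa [e2]) hne (by rwa [e2])
    · exact exists_adj_of_closed (h.conn x y) hz hxz.symm hyz.symm hK hne hcl
  obtain ⟨A, hAW, hrA, hA, hAcl⟩ := exists_component G hr
  have hBne : ((U \ {x, y, z}) \ A).Nonempty := by
    rw [Set.nonempty_iff_ne_empty]
    intro h0
    exact hcut (Set.Subset.antisymm hAW (Set.sdiff_eq_empty.1 h0) ▸ hA)
  obtain ⟨s, hs⟩ := hBne
  obtain ⟨B, hBW, hsB, hB, hBcl⟩ := exists_component G hs.1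
  have hdAB : Disjoint A B := by
    rw [Set.disjoint_left]
    intro v hvA hvB
    have : ∀ w ∈ B, w ∈ A := hB.induction hvB hvA fun u hu w hw huw huA => hAcl u huA w (hBW hw) huw
    exact hs.2 (this s hsB)
  have hAB : A ∪ B = U \ {x, y, z} := by
    refine Set.Subset.antisymm (Set.union_subset hAW hBW) fun t ht => ?_
    by_contra htn
    obtain ⟨K, hKW, htK, hK, hKcl⟩ := exists_component G ht
    have hd : ∀ D ⊆ U \ {x, y, z}, (∀ u ∈ D, ∀ v ∈ U \ {x, y, z}, G.Adj u v → v ∈ D) → t ∉ D →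
        Disjoint D K := by
      intro D hD hDcl htD
      rw [Set.disjoint_left]
      intro v hvD hvK
      have : ∀ w ∈ K, w ∈ D := hK.induction hvK hvD fun u hu w hw huw huD => hDcl u huD w (hKW hw) huw
      exact htD (this t htK)
    refine h.free (HasK33.of_three hA hB hK hdAB (hd A hAW hAcl fun h => htn (Or.inl h))
      (hd B hBW hBcl fun h => htn (Or.inr h)) hxy hxz hyz ?_)
    have mm : ∀ t, t ∈ [x, y, z] → t ∈ ({x, y, z} : Set V) := by simp
    have fin : ∀ D ⊆ U \ {x, y, z}, D.Nonempty →
        (∀ u ∈ D, ∀ v ∈ U \ {x, y, z}, G.Adj u v → v ∈ D) →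
        ∀ t ∈ [x, y, z], t ∉ D ∧ ∃ s ∈ D, G.Adj s t := fun D hD hne hcl t ht =>
      ⟨fun h => (hD h).2 (mm t ht), hadj D hD hne hcl t (mm t ht)⟩
    intro S hS
    simp only [List.mem_cons, List.not_mem_nil, or_false] at hS
    rcases hS with rfl | rfl | rfl
    exacts [fin _ hAW ⟨r, hrA⟩ hAcl, fin _ hBW ⟨s, hsB⟩ hBcl, fin _ hKW ⟨t, htK⟩ hKcl]
  exact ⟨A, B, hrA, ⟨s, hsB⟩, hAB, hdAB, hA, hB,
    fun u hu v hv huv => Set.disjoint_left.1 hdAB (hAcl u hu v (hBW hv) huv) hv,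
    hadj A hAW ⟨r, hrA⟩ hAcl, hadj B hBW ⟨s, hsB⟩ hBcl⟩

/-- One side of a separation of order three, completed by a triangle. -/
lemma torso_rootedGraph [Finite V] {x y z : V} {A B : Set V} (hfree : ¬ HasK33 G)
    (hx : x ∈ U) (hy : y ∈ U) (hz : z ∈ U) (hxy : G.Adj x y)
    (hxz : x ≠ z) (hyz : y ≠ z) (hAB : A ∪ B = U \ {x, y, z}) (hd : Disjoint A B)
    (hB : Conn G B) (hE : ∀ u ∈ A, ∀ v ∈ B, ¬ G.Adj u v)
    (hSB : ∀ t ∈ ({x, y, z} : Set V), ∃ u ∈ B, G.Adj u t) :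
    LivesIn (torso G (A ∪ {x, y, z}) {x, y, z}) (A ∪ {x, y, z}) ∧
    ¬ HasK33 (torso G (A ∪ {x, y, z}) {x, y, z}) ∧
    (∀ Z, Conn G (U \ Z) → Conn (torso G (A ∪ {x, y, z}) {x, y, z}) ((A ∪ {x, y, z}) \ Z)) ∧
    ¬ ((A ∪ {x, y, z}).ncard = 5 ∧ ∀ u ∈ A ∪ {x, y, z}, ∀ v ∈ A ∪ {x, y, z}, u ≠ v →
      (torso G (A ∪ {x, y, z}) {x, y, z}).Adj u v) := by
  have hAU : A ⊆ U \ {x, y, z} := hAB ▸ Set.subset_union_left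
  have hBU : B ⊆ U \ {x, y, z} := hAB ▸ Set.subset_union_right
  have hSU : ({x, y, z} : Set V) ⊆ U := by
    rintro t (rfl | rfl | rfl) <;> assumption
  -- Absorbing `B` into `z` supplies the edges `zx` and `zy`, while `xy` is present in `G`.
  refine ⟨torso_livesIn, fun h => hfree (h.of_torso (z := z) hB ?_ ?_ ?_ ?_), fun Z hZ => ?_, ?_⟩
  · rw [Set.disjoint_left]
    rintro v hv (hvA | hvS)
    · exact Set.disjoint_left.1 hd hvA hv
    · exact (hBU hv).2 hvS
  · obtain ⟨u, hu, h⟩ := hSB z (by simp)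
    exact ⟨u, hu, h.symm⟩
  · intro s hs _
    obtain ⟨u, hu, h⟩ := hSB s hs
    exact ⟨u, hu, h.symm⟩
  · rintro s (rfl | rfl | rfl) t (rfl | rfl | rfl) h1 h2 h3
    all_goals first | exact absurd rfl h1 | exact absurd rfl h2 | exact absurd rfl h3 | exact hxy |
      exact hxy.symm
  · refine Conn.torso (Set.union_subset (hAU.trans Set.sdiff_subset) hSU) ?_ hZ
    intro u hu v hv huv
    by_cases hvS : v ∈ ({x, y, z} : Set V)
    · exact Or.inr hvS
    · have : v ∈ A ∪ B := hAB ▸ ⟨hv, hvS⟩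
      exact Or.inl (this.resolve_right fun h => hE u hu v h huv)
  -- If the torso is `K₅`, the two vertices of `A` and the set `B` are all adjacent to `x`, `y`,
  -- `z`.
  · rintro ⟨h5, hK⟩
    have hS3 : ({x, y, z} : Set V).ncard = 3 := by
      rw [Set.ncard_eq_three]; exact ⟨x, y, z, hxy.ne, hxz, hyz, rfl⟩
    have hdAS : Disjoint A {x, y, z} := Set.disjoint_left.2 fun v hv => (hAU hv).2
    rw [Set.ncard_union_eq hdAS (Set.toFinite _) (Set.toFinite _), hS3] at h5
    obtain ⟨s, t, hst, hA⟩ := Set.ncard_eq_two.1 (show A.ncard = 2 by omega)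
    have hadj : ∀ v ∈ A, ∀ r ∈ ({x, y, z} : Set V), G.Adj v r := fun v hv r hr =>
      ((torso_adj_iff (hAU hv).2).1 (hK v (Or.inl hv) r (Or.inr hr)
        fun h => (hAU hv).2 (h ▸ hr))).1
    have hsA : s ∈ A := by simp [hA]
    have htA : t ∈ A := by simp [hA]
    refine hfree (HasK33.of_three (conn_singleton s) (conn_singleton t) hB (by simpa using hst)
      (Set.disjoint_singleton_left.2 fun h => Set.disjoint_left.1 hd hsA h)
      (Set.disjoint_singleton_left.2 fun h => Set.disjoint_left.1 hd htA h) hxy.ne hxz hyz ?_)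
    have mm : ∀ t, t ∈ [x, y, z] → t ∈ ({x, y, z} : Set V) := by simp
    intro D hD r hr
    simp only [List.mem_cons, List.not_mem_nil, or_false] at hD
    rcases hD with rfl | rfl | rfl
    · exact ⟨fun h => (hAU hsA).2 (h ▸ mm r hr), s, rfl, hadj s hsA r (mm r hr)⟩
    · exact ⟨fun h => (hAU htA).2 (h ▸ mm r hr), t, rfl, hadj t htA r (mm r hr)⟩
    · exact ⟨fun h => (hBU h).2 (mm r hr), hSB r (mm r hr)⟩

/-- The side `A` containing a root contains all roots up to `z`; it is drawn with these roots, and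
the other side with roots `x`, `y`, `z`. The triangle `xyz` is empty in the first drawing, because a
corner of the outer triangle is not in it and the connected set `A` never crosses its sides. -/
theorem RootedGraph.drawable_of_cut [Finite V] (h : RootedGraph G U a b C)
    (ih : ∀ (G' : SimpleGraph V) (U' : Set V) (a' b' : V) (C' : Set V), U'.ncard < U.ncard →
      RootedGraph G' U' a' b' C' → Drawable G' U' a' b' C')
    {x y z : V} (hx : x ∈ U \ ({a, b} ∪ C)) (hy : y ∈ U \ ({a, b} ∪ C)) (hxy : G.Adj x y)
    (hz : z ∈ U \ {x, y}) (hcut : ¬ Conn G (U \ {x, y, z})) : Drawable G U a b C := by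
  have haU := h.livesIn h.adj
  have hbU := h.livesIn.right h.adj
  have nx : x ≠ a ∧ x ≠ b ∧ x ∉ C := by
    have := hx.2; simp only [Set.mem_union, Set.mem_insert_iff, Set.mem_singleton_iff] at this; tauto
  have ny : y ≠ a ∧ y ≠ b ∧ y ∉ C := by
    have := hy.2; simp only [Set.mem_union, Set.mem_insert_iff, Set.mem_singleton_iff] at this; tauto
  have hxz : x ≠ z := fun h' => hz.2 (by simp [h'])
  have hyz : y ≠ z := fun h' => hz.2 (by simp [h'])
  obtain ⟨r, hrab, hrz⟩ : ∃ r, (r = a ∨ r = b) ∧ r ≠ z := by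
    by_cases haz : a = z
    · exact ⟨b, Or.inr rfl, fun h' => h.adj.ne (haz.trans h'.symm)⟩
    · exact ⟨a, Or.inl rfl, haz⟩
  have hrS : r ∈ U \ {x, y, z} := by
    simp only [Set.mem_sdiff, Set.mem_insert_iff, Set.mem_singleton_iff]
    rcases hrab with rfl | rfl
    · exact ⟨haU, by simp [nx.1.symm, ny.1.symm, hrz]⟩
    · exact ⟨hbU, by simp [nx.2.1.symm, ny.2.1.symm, hrz]⟩
  obtain ⟨A, B, hrA, hBne, hAB, hd, hA, hB, hE, hSA, hSB⟩ :=
    h.exists_separation hx.1 hy.1 hz.1 hxy.ne hxz hyz hcut hrS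
  have hAU : A ⊆ U \ {x, y, z} := hAB ▸ Set.subset_union_left
  have hBU : B ⊆ U \ {x, y, z} := hAB ▸ Set.subset_union_right
  have hSU : ({x, y, z} : Set V) ⊆ U := by
    rintro t (rfl | rfl | rfl)
    exacts [hx.1, hy.1, hz.1]
  have hdAS : Disjoint A {x, y, z} := Set.disjoint_left.2 fun v hv => (hAU hv).2
  have hdBS : Disjoint B {x, y, z} := Set.disjoint_left.2 fun v hv => (hBU hv).2
  have hUeq : A ∪ B ∪ {x, y, z} = U := by rw [hAB]; exact Set.sdiff_union_of_subset hSU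
  obtain ⟨l1, f1, c1, k1⟩ := torso_rootedGraph h.free hx.1 hy.1 hz.1 hxy hxz hyz
    hAB hd hB hE hSB
  obtain ⟨l2, f2, c2, k2⟩ := torso_rootedGraph h.free hx.1 hy.1 hz.1 hxy hxz hyz
    (by rwa [Set.union_comm]) hd.symm hA (fun u hu v hv huv => hE v hv u hu huv.symm) hSA
  -- Roots are pairwise adjacent, so no root is separated from `r`.
  have hroot : ∀ t ∈ U, t ≠ x → t ≠ y → (t = r ∨ G.Adj r t) → t ∈ A ∪ {x, y, z} := by
    intro t ht h1 h2 h3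
    by_cases htz : t = z
    · exact Or.inr (by simp [htz])
    · have : t ∈ A ∪ B := by
        rw [hAB]; exact ⟨ht, by simp [h1, h2, htz]⟩
      refine Or.inl (this.resolve_right fun htB => ?_)
      rcases h3 with rfl | h3
      · exact Set.disjoint_left.1 hd hrA htB
      · exact hE r hrA t htB h3
  have haA : a ∈ A ∪ {x, y, z} := hroot a haU nx.1.symm ny.1.symm (by
    rcases hrab with rfl | rfl
    exacts [Or.inl rfl, Or.inr h.adj.symm])
  have hbA : b ∈ A ∪ {x, y, z} := hroot b hbU nx.2.1.symm ny.2.1.symm (by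
    rcases hrab with rfl | rfl
    exacts [Or.inr h.adj, Or.inl rfl])
  have hCA : C ⊆ A ∪ {x, y, z} := fun c hc => hroot c (h.subset hc) (fun h' => nx.2.2 (h' ▸ hc))
    (fun h' => ny.2.2 (h' ▸ hc)) (by
      rcases hrab with rfl | rfl
      exacts [Or.inr (h.adj_left c hc), Or.inr (h.adj_right c hc)])
  have hltA : (A ∪ {x, y, z}).ncard < U.ncard := by
    refine Set.ncard_lt_ncard ?_ (Set.toFinite U)
    obtain ⟨s, hs⟩ := hBne
    refine ⟨Set.union_subset (hAU.trans Set.sdiff_subset) hSU, fun hle => ?_⟩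
    rcases hle (hBU hs).1 with h' | h'
    exacts [Set.disjoint_left.1 hd h' hs, (hBU hs).2 h']
  have hltB : (B ∪ {x, y, z}).ncard < U.ncard := by
    refine Set.ncard_lt_ncard ?_ (Set.toFinite U)
    refine ⟨Set.union_subset (hBU.trans Set.sdiff_subset) hSU, fun hle => ?_⟩
    rcases hle (hAU hrA).1 with h' | h'
    exacts [Set.disjoint_left.1 hd hrA h', (hAU hrA).2 h']
  obtain ⟨pA, T, hpA, rA, gA, iA⟩ := ih _ _ a b C hltA
    ⟨l1, f1, fun s t => c1 _ (h.conn s t), k1, hCA, h.subsingleton, h.left_notMem, h.right_notMem,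
      torso_adj_of haA hbA h.adj, fun c hc => torso_adj_of haA (hCA hc) (h.adj_left c hc),
      fun c hc => torso_adj_of hbA (hCA hc) (h.adj_right c hc), c1 _ h.conn_rest⟩
  have hxS : x ∈ ({x, y, z} : Set V) := by simp
  have hyS : y ∈ ({x, y, z} : Set V) := by simp
  have hzS : z ∈ ({x, y, z} : Set V) := by simp
  have hBS : (B ∪ {x, y, z}) \ ({x, y} ∪ {z}) = B := by
    rw [Set.insert_union, Set.singleton_union, Set.union_sdiff_right]
    exact hdBS.sdiff_eq_left
  obtain ⟨pB, TB, hpB, rB, gB, iB⟩ := ih _ _ x y {z} hltB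
    ⟨l2, f2, fun s t => c2 _ (h.conn s t), k2, by simp, Set.subsingleton_singleton, by simpa using hxz,
      by simpa using hyz, torso_adj_of (Or.inr hxS) (Or.inr hyS) hxy,
      by rintro _ rfl; exact ⟨hxz, Or.inr hxS, Or.inr hzS, Or.inr ⟨hxS, hzS⟩⟩,
      by rintro _ rfl; exact ⟨hyz, Or.inr hyS, Or.inr hzS, Or.inr ⟨hyS, hzS⟩⟩,
      by rw [hBS]; exact hB.mono fun u hu v hv huv => torso_adj_of (Or.inl hu) (Or.inl hv) huv⟩
  have hTB : pB z = TB := rB.corner z rfl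
  have ne : ∀ {u v}, u ∈ A ∪ {x, y, z} → v ∈ A ∪ {x, y, z} → u ≠ v → pA u ≠ pA v :=
    fun hu hv huv h' => huv (iA hu hv h')
  have hD : det3 (pA x) (pA y) (pA z) ≠ 0 := gA _ _ _ (ne (Or.inr hxS) (Or.inr hyS) hxy.ne)
    (ne (Or.inr hxS) (Or.inr hzS) hxz) (ne (Or.inr hyS) (Or.inr hzS) hyz)
  have tx := rA.inTri x (Or.inr hxS) nx.1 nx.2.1 nx.2.2
  have ty := rA.inTri y (Or.inr hyS) ny.1 ny.2.1 ny.2.2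
  have tz := rA.inCTri (v := z) (Or.inr hzS)
  have hrout : ¬ InCTri (pA x) (pA y) (pA z) (pA r) := by
    intro hc
    have : pA r = pA z := by
      rcases hrab with rfl | rfl
      · exact eq_of_corner_mem hD tx ty tz hc
      · exact eq_of_corner_mem hD tx.rotate ty.rotate tz.rotate hc
    exact hrz (iA (Or.inl hrA) (Or.inr hzS) this)
  have hout : ∀ v ∈ A, ¬ InCTri (pA x) (pA y) (pA z) (pA v) := by
    refine hA.induction hrA hrout ?_
    intro u hu v hv huv hu'
    have nS : ∀ w ∈ A, ∀ s ∈ ({x, y, z} : Set V), w ≠ s := fun w hw s hs h' =>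
      Set.disjoint_left.1 hdAS hw (h' ▸ hs)
    have key : ∀ s ∈ ({x, y, z} : Set V), ∀ t ∈ ({x, y, z} : Set V), s ≠ t →
        Disjoint (segment ℝ (pA u) (pA v)) (segment ℝ (pA s) (pA t)) := fun s hs t ht hst =>
      hpA u v s t (torso_adj_of (Or.inl hu) (Or.inl hv) huv)
        ⟨hst, Or.inr hs, Or.inr ht, Or.inr ⟨hs, ht⟩⟩
        (ne (Or.inl hu) (Or.inr hs) (nS u hu s hs)) (ne (Or.inl hu) (Or.inr ht) (nS u hu t ht))
        (ne (Or.inl hv) (Or.inr hs) (nS v hv s hs)) (ne (Or.inl hv) (Or.inr ht) (nS v hv t ht))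
    exact not_mem_tri_of_disjoint hD hu' (key x hxS y hyS hxy.ne) (key y hyS z hzS hyz)
      (key z hzS x hxS hxz.symm) _ (right_mem_segment ℝ _ _)
  obtain ⟨p, hp, hpA', hpi, hpB'⟩ := exists_planeMap_triangle_sum (hUeq ▸ h.livesIn) hd hdAS hdBS
    hxy.ne hxz hyz hE hpA iA hD hout hpB iB (by rw [hTB]; exact rB.det_ne) (fun v hv => by
      rw [hTB]
      have := (hBU hv).2
      simp only [Set.mem_insert_iff, Set.mem_singleton_iff, not_or] at this
      exact rB.inTri v (Or.inl hv) this.1 this.2.1 this.2.2)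
  have hpAS : ∀ v ∈ A ∪ {x, y, z}, p v = pA v := fun v hv => hpA' v fun hvB => by
    rcases hv with hv | hv
    exacts [Set.disjoint_left.1 hd hv hvB, (hBU hvB).2 hv]
  refine Drawable.of_rooted (T := T) h.subsingleton hp ⟨?_, ?_, ?_⟩ (by rwa [hUeq] at hpi)
  · rw [hpAS a haA, hpAS b hbA]; exact rA.det_ne
  · intro c hc; rw [hpAS c (hCA hc)]; exact rA.corner c hc
  · intro v hv h1 h2 h3
    rw [hpAS a haA, hpAS b hbA]
    by_cases hvB : v ∈ B
    -- The triangle is rotated because `z` may be a root and thus a corner; the last place needs a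
    -- strictly interior point.
    · exact InTri.trans ty.inCTri tz tx (hpB' v hvB).rotate
    · rw [hpA' v hvB]
      refine rA.inTri v ?_ h1 h2 h3
      rw [← hUeq] at hv
      rcases hv with (hv | hv) | hv
      exacts [Or.inl hv, absurd hv hvB, Or.inr hv]

end ThreeConnected

end RectilinearCrossing


namespace RectilinearCrossing

/-! ### Contraction of an edge that lies in no separating triple. -/

section Contraction

variable {V : Type*} {G : SimpleGraph V} {U C : Set V} {a b : V}

lemma contract_adj_of {x y u v : V} (h : G.Adj u v) (hu : u ≠ y) (hv : v ≠ y) :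
    (contract G x y).Adj u v := ⟨h.ne, hu, hv, Or.inl h⟩

/-- A vertex of a 3-connected graph has two neighbours besides a given one. -/
lemma nontrivial_neighbors {x y : V} (hconn : ∀ s t, Conn G (U \ {s, t})) (hx : x ∈ U) (hxy : x ≠ y)
    (hU : ∀ s, ∃ t ∈ U, t ≠ x ∧ t ≠ y ∧ t ≠ s) : {v ∈ U | G.Adj x v ∧ v ≠ y}.Nontrivial := by
  by_contra hn
  rw [Set.not_nontrivial_iff] at hn
  -- If `x` has at most one neighbour `q` besides `y`, deleting `y` and `q` isolates `x`.
  obtain ⟨q, hq, hqx⟩ : ∃ q, {v ∈ U | G.Adj x v ∧ v ≠ y} ⊆ {q} ∧ q ≠ x := by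
    rcases hn.eq_empty_or_singleton with h | ⟨q, h⟩
    · exact ⟨y, h.trans_subset (Set.empty_subset _), hxy.symm⟩
    · have : q ∈ {v ∈ U | G.Adj x v ∧ v ≠ y} := h ▸ rfl
      exact ⟨q, h.subset, this.2.1.ne.symm⟩
  obtain ⟨t, ht, htx, hty, htq⟩ := hU q
  obtain ⟨u, hu, v, hv, huv⟩ := hconn y q {x}
    (by rintro _ rfl; exact ⟨hx, by simp [hxy, hqx.symm]⟩) ⟨x, rfl⟩ ⟨t, ⟨ht, by simp [hty, htq]⟩, htx⟩
  rw [Set.mem_singleton_iff] at hu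
  rw [hu] at huv
  have hvn := hv.1.2
  simp only [Set.mem_insert_iff, Set.mem_singleton_iff, not_or] at hvn
  exact hvn.2 (hq ⟨hv.1.1, huv, hvn.1⟩)

/-- Contracting an edge that is in no separating triple to `K₅` requires a `K_{3,3}` minor. -/
lemma HasK33.of_contract_five [Finite V] {x y : V} (hxy : G.Adj x y) (hx : x ∈ U) (hy : y ∈ U)
    (hconn : ∀ s t, Conn G (U \ {s, t})) (h5 : (U \ {y}).ncard = 5)
    (hK : ∀ u ∈ U \ {y}, ∀ v ∈ U \ {y}, u ≠ v → (contract G x y).Adj u v) : HasK33 G := by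
  have hQ4 : (U \ {x, y}).ncard = 4 := by
    have : (U \ {y}) \ {x} = U \ {x, y} := by
      rw [Set.sdiff_sdiff, Set.union_comm]; rfl
    rw [← this, Set.ncard_sdiff_singleton_of_mem (show x ∈ U \ {y} from ⟨hx, hxy.ne⟩), h5]
  have hmemQ : ∀ {v}, v ∈ U \ {x, y} ↔ v ∈ U ∧ v ≠ x ∧ v ≠ y := by
    intro v; simp [Set.mem_sdiff, not_or]
  have hU : ∀ s, ∃ t ∈ U, t ≠ x ∧ t ≠ y ∧ t ≠ s := by
    intro s
    obtain ⟨t, ht, hts⟩ := Set.exists_mem_notMem_of_ncard_lt_ncard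
      (s := {s}) (t := U \ {x, y}) (by rw [Set.ncard_singleton, hQ4]; norm_num)
    exact ⟨t, (hmemQ.1 ht).1, (hmemQ.1 ht).2.1, (hmemQ.1 ht).2.2, hts⟩
  have hNx := nontrivial_neighbors hconn hx hxy.ne hU
  have hNy := nontrivial_neighbors hconn hy hxy.ne.symm fun s => by
    obtain ⟨t, h1, h2, h3, h4⟩ := hU s
    exact ⟨t, h1, h3, h2, h4⟩
  have hQQ : ∀ u ∈ U \ {x, y}, ∀ v ∈ U \ {x, y}, u ≠ v → G.Adj u v := by
    intro u hu v hv huv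
    have hu' := hmemQ.1 hu
    have hv' := hmemQ.1 hv
    rcases (hK u ⟨hu.1, hu'.2.2⟩ v ⟨hv.1, hv'.2.2⟩ huv).2.2.2 with h | h | h
    · exact h
    · exact absurd h.1 hu'.2.1
    · exact absurd h.1 hv'.2.1
  have hcov : ∀ v ∈ U \ {x, y}, G.Adj x v ∨ G.Adj y v := by
    intro v hv
    have hv' := hmemQ.1 hv
    rcases (hK x ⟨hx, hxy.ne⟩ v ⟨hv.1, hv'.2.2⟩ hv'.2.1.symm).2.2.2 with h | h | h
    · exact Or.inl h
    · exact Or.inr h.2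
    · exact absurd h.1 hv'.2.1
  set X := {v ∈ U | G.Adj x v ∧ v ≠ y} with hX
  set Y := {v ∈ U | G.Adj y v ∧ v ≠ x} with hY
  have hXQ : X ⊆ U \ {x, y} := fun v hv => hmemQ.2 ⟨hv.1, hv.2.1.ne.symm, hv.2.2⟩
  have hYQ : Y ⊆ U \ {x, y} := fun v hv => hmemQ.2 ⟨hv.1, hv.2.2, hv.2.1.ne.symm⟩
  have h2 : ∀ {Z : Set V}, Z.Nontrivial → 2 ≤ Z.ncard := fun hZ =>
    (Set.one_lt_ncard_iff_nontrivial).2 hZ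
  have hsub : (U \ {x, y}) \ Y ⊆ X := by
    rintro v ⟨hv, hvY⟩
    have hv' := hmemQ.1 hv
    refine ⟨hv.1, (hcov v hv).resolve_right fun h => hvY ⟨hv.1, h, hv'.2.1⟩, hv'.2.2⟩
  -- The four remaining vertices form a `K₄`, and each is adjacent to `x` or `y`. They are divided
  -- into two neighbours of `x` and two of `y`: the first pair has to contain the non-neighbours of
  -- `y`, of which there are at most two.
  obtain ⟨X', hX1, hX2, hX3⟩ := Set.exists_subsuperset_card_eq hsub (n := 2) (by
    have := Set.ncard_sdiff_add_ncard_of_subset hYQ (Set.toFinite _)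
    have := h2 hNy
    omega) (h2 hNx)
  obtain ⟨a₁, a₂, ha, hXa⟩ := Set.ncard_eq_two.1 hX3
  obtain ⟨b₁, b₂, hb, hYb⟩ := Set.ncard_eq_two.1 (show ((U \ {x, y}) \ X').ncard = 2 by
    have := Set.ncard_sdiff_add_ncard_of_subset (hX2.trans hXQ) (Set.toFinite _)
    omega)
  have ma₁ : a₁ ∈ X' := by simp [hXa]
  have ma₂ : a₂ ∈ X' := by simp [hXa]
  have mb₁ : b₁ ∈ (U \ {x, y}) \ X' := by simp [hYb]
  have mb₂ : b₂ ∈ (U \ {x, y}) \ X' := by simp [hYb]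
  have hY' : ∀ v ∈ (U \ {x, y}) \ X', v ∈ Y := fun v hv => by
    by_contra h; exact hv.2 (hX1 ⟨hv.1, h⟩)
  have nab : ∀ {u v}, u ∈ X' → v ∈ (U \ {x, y}) \ X' → u ≠ v := fun hu hv h => hv.2 (h ▸ hu)
  refine HasK33.of_rootedC4 (Q := U \ {x, y}) (by simp) (by simp) hxy (hX2 ma₁).2.1 (hX2 ma₂).2.1
    (hY' b₁ mb₁).2.1 (hY' b₂ mb₂).2.1 ⟨{a₁}, {a₂}, {b₁}, {b₂}, ?_, rfl, rfl, rfl, rfl, ?_, ?_⟩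
  · intro S hS
    simp only [List.mem_cons, List.not_mem_nil, or_false] at hS
    rcases hS with rfl | rfl | rfl | rfl
    · exact ⟨Set.singleton_subset_iff.2 (hXQ (hX2 ma₁)), conn_singleton _⟩
    · exact ⟨Set.singleton_subset_iff.2 (hXQ (hX2 ma₂)), conn_singleton _⟩
    · exact ⟨Set.singleton_subset_iff.2 mb₁.1, conn_singleton _⟩
    · exact ⟨Set.singleton_subset_iff.2 mb₂.1, conn_singleton _⟩
  · simp [ha, hb, nab ma₁ mb₁, nab ma₁ mb₂, nab ma₂ mb₁, nab ma₂ mb₂]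
  · intro S hS T hT
    simp only [List.mem_cons, List.not_mem_nil, or_false] at hS hT
    rcases hS with rfl | rfl <;> rcases hT with rfl | rfl
    · exact ⟨a₁, rfl, b₁, rfl, hQQ _ (hXQ (hX2 ma₁)) _ mb₁.1 (nab ma₁ mb₁)⟩
    · exact ⟨a₁, rfl, b₂, rfl, hQQ _ (hXQ (hX2 ma₁)) _ mb₂.1 (nab ma₁ mb₂)⟩
    · exact ⟨a₂, rfl, b₁, rfl, hQQ _ (hXQ (hX2 ma₂)) _ mb₁.1 (nab ma₂ mb₁)⟩
    · exact ⟨a₂, rfl, b₂, rfl, hQQ _ (hXQ (hX2 ma₂)) _ mb₂.1 (nab ma₂ mb₂)⟩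

/-- A separating pair of the contraction containing `x` would be a separating triple of `G`
containing `x` and `y`, and any other separating pair would already separate `G`. The exclusion of
`K₅` is `HasK33.of_contract_five`. -/
lemma RootedGraph.contract [Finite V] (h : RootedGraph G U a b C) {x y : V}
    (hx : x ∈ U \ ({a, b} ∪ C)) (hy : y ∈ U \ ({a, b} ∪ C)) (hxy : G.Adj x y)
    (hcon : ∀ z, Conn G ((U \ {x, y}) \ {z})) :
    RootedGraph (contract G x y) (U \ {y}) a b C := by
  have ny : y ≠ a ∧ y ≠ b ∧ y ∉ C := by
    have := hy.2; simp only [Set.mem_union, Set.mem_insert_iff, Set.mem_singleton_iff] at this; tauto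
  refine ⟨contract_livesIn h.livesIn hx.1, fun h' => h.free (h'.of_contract hxy), ?_, ?_, ?_,
    h.subsingleton, h.left_notMem, h.right_notMem, contract_adj_of h.adj ny.1.symm ny.2.1.symm,
    fun c hc => contract_adj_of (h.adj_left c hc) ny.1.symm fun h' => ny.2.2 (h' ▸ hc),
    fun c hc => contract_adj_of (h.adj_right c hc) ny.2.1.symm fun h' => ny.2.2 (h' ▸ hc), ?_⟩
  · have one : ∀ t, Conn (RectilinearCrossing.contract G x y) ((U \ {y}) \ {x, t}) := by
      intro t
      have : (U \ {y}) \ {x, t} = (U \ {x, y}) \ {t} := by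
        ext v; simp only [Set.mem_sdiff, Set.mem_insert_iff, Set.mem_singleton_iff]; tauto
      rw [this]
      refine (hcon t).mono fun u hu v hv huv => contract_adj_of huv ?_ ?_
      · rintro rfl; exact hu.1.2 (by simp)
      · rintro rfl; exact hv.1.2 (by simp)
    intro s t
    by_cases hs : s = x
    · rw [hs]; exact one t
    by_cases ht : t = x
    · rw [ht, Set.pair_comm]; exact one s
    by_cases hyst : y ∈ ({s, t} : Set V)
    · have : (U \ {y}) \ {s, t} = U \ {s, t} := by
        rw [Set.sdiff_sdiff, Set.union_eq_self_of_subset_left (Set.singleton_subset_iff.2 hyst)]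
      rw [this]
      refine (h.conn s t).mono fun u hu v hv huv => contract_adj_of huv ?_ ?_
      · rintro rfl; exact hu.2 hyst
      · rintro rfl; exact hv.2 hyst
    · rw [Set.sdiff_sdiff_comm]
      refine (h.conn s t).contracted (fun _ => ⟨hx.1, ?_⟩) hxy.ne
      simp [Ne.symm hs, Ne.symm ht]
  · rintro ⟨h5, hK⟩
    exact h.free (HasK33.of_contract_five hxy hx.1 hy.1 h.conn h5 hK)
  · exact fun c hc => ⟨h.subset hc, fun h' => ny.2.2 (h' ▸ hc)⟩
  · rw [Set.sdiff_sdiff_comm]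
    exact h.conn_rest.contracted (fun _ => hx) hxy.ne

end Contraction

end RectilinearCrossing


namespace RectilinearCrossing

/-! ### Undoing the contraction, and the drawing of 3-connected graphs. -/

section Splitting

open Filter Topology

variable {V : Type*} {G : SimpleGraph V} {U C : Set V} {a b : V}

lemma NoThree.det_ne {p : V → ℝ × ℝ} {S : Set V} (h : NoThree p) (hi : Set.InjOn p S) {u v w : V}
    (hu : u ∈ S) (hv : v ∈ S) (hw : w ∈ S) (huv : u ≠ v) (huw : u ≠ w) (hvw : v ≠ w) :
    det3 (p u) (p v) (p w) ≠ 0 :=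
  h u v w (fun h' => huv (hi hu hv h')) (fun h' => huw (hi hu hw h')) fun h' => hvw (hi hv hw h')

/-- The direction in which a contracted edge `xy` can be expanded again. -/
lemma RootedGraph.exists_direction [Finite V] (h : RootedGraph G U a b C) {x y : V} (hx : x ∈ U)
    (hy : y ∈ U) (hxy : G.Adj x y) (hcon : ∀ z, Conn G ((U \ {x, y}) \ {z}))
    {p : V → ℝ × ℝ} (hp : PlaneMap (RectilinearCrossing.contract G x y) p) (hg : NoThree p) (hi : Set.InjOn p (U \ {y}))
    (hNx : {v ∈ U | G.Adj x v ∧ v ≠ y}.Nontrivial) (hNy : {v ∈ U | G.Adj y v ∧ v ≠ x}.Nontrivial) :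
    ∃ d : ℝ × ℝ, ∀ u v, G.Adj x u → G.Adj y v → u ≠ y → v ≠ x → u ≠ v →
      det2 d (p v - p x) * det2 (p u - p x) (p v - p x) < 0 ∨
      0 < det2 (p u - p x) d * det2 (p u - p x) (p v - p x) := by
  have hxU : x ∈ U \ {y} := ⟨hx, hxy.ne⟩
  have hQ : U \ {x, y} ⊆ U \ {y} := fun v hv => ⟨hv.1, fun h' => hv.2 (Or.inr h')⟩
  have memQ : ∀ {v}, v ∈ U \ {x, y} → v ≠ x ∧ v ≠ y := fun hv => by
    have := hv.2; simpa [not_or] using this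
  have hX : ∀ v ∈ {v ∈ U | G.Adj x v ∧ v ≠ y}, v ∈ U \ {x, y} := fun v hv =>
    ⟨hv.1, by simp [hv.2.1.ne.symm, hv.2.2]⟩
  have hY : ∀ v ∈ {v ∈ U | G.Adj y v ∧ v ≠ x}, v ∈ U \ {x, y} := fun v hv =>
    ⟨hv.1, by simp [hv.2.1.ne.symm, hv.2.2]⟩
  have hXadj : ∀ v ∈ {v ∈ U | G.Adj x v ∧ v ≠ y}, (RectilinearCrossing.contract G x y).Adj x v :=
    fun v hv => contract_adj_of hv.2.1 hxy.ne hv.2.2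
  have hYadj : ∀ v ∈ {v ∈ U | G.Adj y v ∧ v ≠ x}, (RectilinearCrossing.contract G x y).Adj x v :=
    fun v hv => ⟨hv.2.2.symm, hxy.ne, hv.2.1.ne.symm, Or.inr (Or.inl ⟨rfl, hv.2.1⟩)⟩
  refine (exists_split_direction p (p x) {v ∈ U | G.Adj x v ∧ v ≠ y}
    {v ∈ U | G.Adj y v ∧ v ≠ x} hNx hNy ?_ ?_ ?_).imp fun d hd u v hu hv h1 h2 h3 =>
      hd u ⟨h.livesIn.right hu, hu, h1⟩ v ⟨h.livesIn.right hv, hv, h2⟩ h3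
  · have : ∀ u ∈ {v ∈ U | G.Adj x v ∧ v ≠ y} ∪ {v ∈ U | G.Adj y v ∧ v ≠ x}, u ∈ U \ {x, y} :=
      fun u hu => hu.elim (hX u) (hY u)
    exact fun u hu v hv huv => hg.det_ne hi hxU (hQ (this u hu)) (hQ (this v hv))
      (memQ (this u hu)).1.symm (memQ (this v hv)).1.symm huv
  · intro a₁ ha₁ a₂ ha₂ b₁ hb₁ b₂ hb₂ haa hbb h11 h12 h21 h22
    by_contra hcone
    -- Without disjoint connections `a₁a₂` and `b₁b₂` there is a rooted four-cycle, hence a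
    -- `K_{3,3}` minor. With them, `not_alternating` applies in the drawing of the contraction.
    refine h.free (HasK33.of_rootedC4 (Q := U \ {x, y}) (by simp) (by simp) hxy ha₁.2.1 ha₂.2.1
      hb₁.2.1 hb₂.2.1 (exists_rootedC4 _ G (U \ {x, y}) rfl hcon a₁ (hX _ ha₁) a₂ (hX _ ha₂)
        b₁ (hY _ hb₁) b₂ (hY _ hb₂) (by simp [*]) ?_))
    intro X hXQ Y hYQ hXc hYc hXY m1 m2 m3 m4
    refine hcone ?_
    have key : ∀ s ∈ U \ {y}, ∀ u ∈ U \ {y}, (RectilinearCrossing.contract G x y).Adj s u →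
        ∀ q ∈ U \ {x, y}, ∀ q' ∈ U \ {x, y}, G.Adj q q' → s ≠ q → s ≠ q' → u ≠ q → u ≠ q' →
        Disjoint (segment ℝ (p s) (p u)) (segment ℝ (p q) (p q')) := by
      intro s hs u hu hsu q hq q' hq' hqq' n1 n2 n3 n4
      exact hp s u q q' hsu (contract_adj_of hqq' (memQ hq).2 (memQ hq').2)
        (fun e => n1 (hi hs (hQ hq) e)) (fun e => n2 (hi hs (hQ hq') e))
        (fun e => n3 (hi hu (hQ hq) e)) (fun e => n4 (hi hu (hQ hq') e))
    have nXY : ∀ {s t}, s ∈ X → t ∈ Y → s ≠ t := fun hs ht e =>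
      Set.disjoint_left.1 hXY hs (e ▸ ht)
    refine not_alternating (S := U \ {y}) (X := X) (Y := Y) (G := G) hxU
      (fun i hi' j hj k hk => hg.det_ne hi hi' hj hk) (hXQ.trans hQ) (hYQ.trans hQ)
      (fun h' => (memQ (hXQ h')).1 rfl) (fun h' => (memQ (hYQ h')).1 rfl) hXY hXc hYc m1 m2 m3 m4 hbb
      ?_ ?_ ?_ ?_ ?_
    · exact fun u hu v hv huv q hq q' hq' hqq' => key u (hQ (hXQ hu)) v (hQ (hXQ hv))
        (contract_adj_of huv (memQ (hXQ hu)).2 (memQ (hXQ hv)).2) q (hYQ hq) q' (hYQ hq') hqq'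
        (nXY hu hq) (nXY hu hq') (nXY hv hq) (nXY hv hq')
    · exact fun q hq q' hq' hqq' => key x hxU a₁ (hQ (hXQ m1)) (hXadj _ ha₁) q (hYQ hq) q' (hYQ hq')
        hqq' (memQ (hYQ hq)).1.symm (memQ (hYQ hq')).1.symm (nXY m1 hq) (nXY m1 hq')
    · exact fun q hq q' hq' hqq' => key x hxU a₂ (hQ (hXQ m2)) (hXadj _ ha₂) q (hYQ hq) q' (hYQ hq')
        hqq' (memQ (hYQ hq)).1.symm (memQ (hYQ hq')).1.symm (nXY m2 hq) (nXY m2 hq')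
    · exact fun q hq q' hq' hqq' => key x hxU b₁ (hQ (hYQ m3)) (hYadj _ hb₁) q (hXQ hq) q' (hXQ hq')
        hqq' (memQ (hXQ hq)).1.symm (memQ (hXQ hq')).1.symm (nXY hq m3).symm (nXY hq' m3).symm
    · exact fun q hq q' hq' hqq' => key x hxU b₂ (hQ (hYQ m4)) (hYadj _ hb₂) q (hXQ hq) q' (hXQ hq')
        hqq' (memQ (hXQ hq)).1.symm (memQ (hXQ hq')).1.symm (nXY hq m4).symm (nXY hq' m4).symm
  · intro c₁ hc₁ c₂ hc₂ c₃ hc₃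
    by_contra! hne
    obtain ⟨h12, h13, h23⟩ := hne
    have hc : Function.Injective ![c₁, c₂, c₃] := by
      intro i j hij
      fin_cases i <;> fin_cases j <;> simp_all
    refine h.free (HasK33.of_three_common h.conn hx hy hxy hcon hc ?_ ?_ ?_ ?_)
    · intro i; fin_cases i
      exacts [hc₁.1.1, hc₂.1.1, hc₃.1.1]
    · intro i; fin_cases i
      exacts [hc₁.1.2.1, hc₂.1.2.1, hc₃.1.2.1]
    · intro i; fin_cases i
      exacts [hc₁.2.2.1, hc₂.2.2.1, hc₃.2.2.1]
    · intro hU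
      have hU : U = {x, y, c₁, c₂, c₃} := hU
      have q1 := memQ (hX _ hc₁.1)
      have q2 := memQ (hX _ hc₂.1)
      have q3 := memQ (hX _ hc₃.1)
      -- The graph has only five vertices. Deleting `x`, `y`, `r` leaves the connected set `{s, t}`,
      -- so all pairs are adjacent and the graph is `K₅`.
      have adj : ∀ s t r, s ≠ t → s ≠ r → t ≠ r → s ∈ U \ {x, y} → t ∈ U \ {x, y} →
          U \ {x, y} ⊆ {s, t, r} → G.Adj s t := by
        intro s t r hst hsr htr hs ht hsub
        obtain ⟨u, hu, v, hv, huv⟩ := hcon r {s} (by rintro _ rfl; exact ⟨hs, hsr⟩) ⟨s, rfl⟩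
          ⟨t, ⟨ht, htr⟩, hst.symm⟩
        rw [Set.mem_singleton_iff] at hu
        rcases hsub hv.1.1 with h' | h' | h'
        · exact absurd h' hv.2
        · rwa [hu, h'] at huv
        · exact absurd h' hv.1.2
      have hsub : U \ {x, y} ⊆ {c₁, c₂, c₃} := by
        rintro v ⟨hv, hv'⟩
        rw [hU] at hv
        simp only [Set.mem_insert_iff, Set.mem_singleton_iff, not_or] at hv hv' ⊢
        tauto
      have a12 := adj c₁ c₂ c₃ h12 h13 h23 (hX _ hc₁.1) (hX _ hc₂.1) hsub
      have a13 := adj c₁ c₃ c₂ h13 h12 h23.symm (hX _ hc₁.1) (hX _ hc₃.1)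
        (hsub.trans (by rw [Set.pair_comm]))
      have a23 := adj c₂ c₃ c₁ h23 h12.symm h13.symm (hX _ hc₂.1) (hX _ hc₃.1)
        (hsub.trans (by intro t; simp only [Set.mem_insert_iff, Set.mem_singleton_iff]; tauto))
      have x1 := hc₁.1.2.1
      have x2 := hc₂.1.2.1
      have x3 := hc₃.1.2.1
      have y1 := hc₁.2.2.1
      have y2 := hc₂.2.2.1
      have y3 := hc₃.2.2.1
      refine h.ne_five ⟨?_, ?_⟩
      · rw [hU]
        have hxy' := hxy.ne
        have e3 : ({c₁, c₂, c₃} : Set V).ncard = 3 :=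
          Set.ncard_eq_three.2 ⟨_, _, _, h12, h13, h23, rfl⟩
        rw [Set.ncard_insert_of_notMem, Set.ncard_insert_of_notMem, e3]
        · simp [y1.ne, y2.ne, y3.ne]
        · simp [hxy', x1.ne, x2.ne, x3.ne]
      · rw [hU]
        rintro u (rfl | rfl | rfl | rfl | rfl) v (rfl | rfl | rfl | rfl | rfl) huv <;>
        first | exact absurd rfl huv | assumption | (apply SimpleGraph.Adj.symm; assumption)

/-- `y` is placed at `p x + ε • d`. For small `ε` openness settles everything except edges at `x`
against edges at `y`; these are disjoint for every `ε > 0` by the choice of `d`. -/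
theorem RootedGraph.drawable_of_contract [Finite V] (h : RootedGraph G U a b C) {x y : V}
    (hx : x ∈ U \ ({a, b} ∪ C)) (hy : y ∈ U \ ({a, b} ∪ C)) (hxy : G.Adj x y)
    (hcon : ∀ z, Conn G ((U \ {x, y}) \ {z}))
    (hD : Drawable (RectilinearCrossing.contract G x y) (U \ {y}) a b C) : Drawable G U a b C := by
  classical
  have nx : x ≠ a ∧ x ≠ b ∧ x ∉ C := by
    have := hx.2; simp only [Set.mem_union, Set.mem_insert_iff, Set.mem_singleton_iff] at this; tauto
  have ny : y ≠ a ∧ y ≠ b ∧ y ∉ C := by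
    have := hy.2; simp only [Set.mem_union, Set.mem_insert_iff, Set.mem_singleton_iff] at this; tauto
  have haU := h.livesIn h.adj
  have hbU := h.livesIn.right h.adj
  have hU : ∀ s, ∃ t ∈ U, t ≠ x ∧ t ≠ y ∧ t ≠ s := by
    intro s
    by_cases hs : a = s
    · exact ⟨b, hbU, nx.2.1.symm, ny.2.1.symm, fun h' => h.adj.ne (hs.trans h'.symm)⟩
    · exact ⟨a, haU, nx.1.symm, ny.1.symm, hs⟩
  have hNx := nontrivial_neighbors h.conn hx.1 hxy.ne hU
  have hNy := nontrivial_neighbors h.conn hy.1 hxy.ne.symm fun s => by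
    obtain ⟨t, h1, h2, h3, h4⟩ := hU s
    exact ⟨t, h1, h3, h2, h4⟩
  obtain ⟨p, T, hp, hr, hg, hi⟩ := hD
  obtain ⟨d, hd⟩ := h.exists_direction hx.1 hy.1 hxy hcon hp hg hi hNx hNy
  have hxU : x ∈ U \ {y} := ⟨hx.1, hxy.ne⟩
  -- Needed for `y` and `x` to have different positions.
  have hd0 : d ≠ 0 := by
    rintro rfl
    obtain ⟨u, hu⟩ := hNx.nonempty
    obtain ⟨v, hv, hvu⟩ := hNy.exists_ne u
    have := hd u v hu.2.1 hv.2.1 hu.2.2 hv.2.2 hvu.symm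
    simp [det2] at this
  have cont : Continuous fun ε : ℝ => p x + ε • d := by fun_prop
  have ev : ∀ {P : ℝ → Prop}, IsOpen {ε | P ε} → P 0 → ∀ᶠ ε in 𝓝[>] (0 : ℝ), P ε := fun hs h0 =>
    nhdsWithin_le_nhds (hs.mem_nhds h0)
  have inj : ∀ {u v}, u ∈ U \ {y} → v ∈ U \ {y} → u ≠ v → p u ≠ p v := fun hu hv huv e =>
    huv (hi hu hv e)
  have mem : ∀ {u v}, G.Adj u v → u ≠ y → u ∈ U \ {y} := fun huv hu => ⟨h.livesIn huv, hu⟩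
  have e1 : ∀ᶠ ε in 𝓝[>] (0 : ℝ), ∀ v u' v', G.Adj y v → G.Adj u' v' → v ≠ x → u' ≠ x → v' ≠ x →
      u' ≠ y → v' ≠ y → v ≠ u' → v ≠ v' →
      Disjoint (segment ℝ (p x + ε • d) (p v)) (segment ℝ (p u') (p v')) := by
    simp only [eventually_all]
    intro v u' v' hv hu' n1 n2 n3 n4 n5 n6 n7
    refine ev (isOpen_disjoint_segment' cont continuous_const continuous_const continuous_const) ?_
    have hvU : v ∈ U \ {y} := mem hv.symm hv.ne.symm
    simp only [zero_smul, add_zero]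
    exact hp x v u' v' ⟨n1.symm, hxy.ne, hv.ne.symm, Or.inr (Or.inl ⟨rfl, hv⟩)⟩
      (contract_adj_of hu' n4 n5) (inj hxU (mem hu' n4) n2.symm) (inj hxU (mem hu'.symm n5) n3.symm)
      (inj hvU (mem hu' n4) n6) (inj hvU (mem hu'.symm n5) n7)
  -- For `ε = 0` the edge `xy` is a point, which is on no other edge because no three positions are
  -- collinear.
  have e2 : ∀ᶠ ε in 𝓝[>] (0 : ℝ), ∀ u' v', G.Adj u' v' → u' ≠ x → v' ≠ x → u' ≠ y → v' ≠ y →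
      Disjoint (segment ℝ (p x + ε • d) (p x)) (segment ℝ (p u') (p v')) := by
    simp only [eventually_all]
    intro u' v' hu' n2 n3 n4 n5
    refine ev (isOpen_disjoint_segment' cont continuous_const continuous_const continuous_const) ?_
    simp only [zero_smul, add_zero, segment_same, Set.disjoint_singleton_left]
    intro hm
    refine hg.det_ne hi (mem hu' n4) (mem hu'.symm n5) hxU hu'.ne n2 n3 ?_
    exact det3_eq_zero_of_mem_segment hm
  have e3 : ∀ᶠ ε in 𝓝[>] (0 : ℝ), ∀ v ∈ U, v ≠ x → v ≠ y → p x + ε • d ≠ p v := by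
    simp only [eventually_all]
    intro v hv n1 n2
    refine ev (isOpen_ne_fun cont continuous_const) ?_
    simp only [zero_smul, add_zero]
    exact inj hxU ⟨hv, n2⟩ n1.symm
  have e4 : ∀ᶠ ε in 𝓝[>] (0 : ℝ), InTri (p a) (p b) T (p x + ε • d) := by
    refine ev (isOpen_inTri continuous_const continuous_const continuous_const cont) ?_
    simp only [zero_smul, add_zero]
    exact hr.inTri x hxU nx.1 nx.2.1 nx.2.2
  obtain ⟨ε, ⟨⟨⟨h1, h2⟩, h3⟩, h4⟩, hε⟩ :=
    ((((e1.and e2).and e3).and e4).and self_mem_nhdsWithin).exists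
  have hε : 0 < ε := hε
  let q : V → ℝ × ℝ := fun v => if v = y then p x + ε • d else p v
  have qy : q y = p x + ε • d := if_pos rfl
  have qn : ∀ {v}, v ≠ y → q v = p v := fun hv => if_neg hv
  have ycase : ∀ v u' v', G.Adj y v → G.Adj u' v' → y ≠ u' → y ≠ v' → v ≠ u' → v ≠ v' →
      Disjoint (segment ℝ (q y) (q v)) (segment ℝ (q u') (q v')) := by
    intro v u' v' hv huv' n1 n2 n3 n4
    rw [qy, qn hv.ne.symm, qn n1.symm, qn n2.symm]
    by_cases hvx : v = x
    · rw [hvx] at n3 n4 ⊢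
      exact h2 u' v' huv' n3.symm n4.symm n1.symm n2.symm
    by_cases hux : u' = x
    · rw [hux] at huv' ⊢
      exact (disjoint_of_split hε (hd v' v huv' hv n2.symm hvx n4.symm)).symm
    by_cases hvx' : v' = x
    · rw [hvx'] at huv' ⊢
      rw [segment_symm ℝ (p u')]
      exact (disjoint_of_split hε (hd u' v huv'.symm hv n1.symm hvx n3.symm)).symm
    exact h1 v u' v' hv huv' hvx hux hvx' n1.symm n2.symm n3 n4
  refine Drawable.of_rooted (p := q) (T := T) h.subsingleton ?_ ⟨?_, ?_, ?_⟩ ?_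
  · intro u v u' v' huv huv' m1 m2 m3 m4
    have n1 : u ≠ u' := fun e => m1 (by rw [e])
    have n2 : u ≠ v' := fun e => m2 (by rw [e])
    have n3 : v ≠ u' := fun e => m3 (by rw [e])
    have n4 : v ≠ v' := fun e => m4 (by rw [e])
    by_cases hu : u = y
    · subst hu; exact ycase v u' v' huv huv' n1 n2 n3 n4
    by_cases hv : v = y
    · subst hv; rw [segment_symm ℝ (q u)]; exact ycase u u' v' huv.symm huv' n3 n4 n1 n2
    by_cases hu' : u' = y
    · subst hu'; exact (ycase v' u v huv' huv n1.symm n3.symm n2.symm n4.symm).symm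
    by_cases hv' : v' = y
    · subst hv'; rw [segment_symm ℝ (q u')]
      exact (ycase u' u v huv'.symm huv n2.symm n4.symm n1.symm n3.symm).symm
    rw [qn hu, qn hv, qn hu', qn hv']
    exact hp u v u' v' (contract_adj_of huv hu hv) (contract_adj_of huv' hu' hv')
      (inj (mem huv hu) (mem huv' hu') n1) (inj (mem huv hu) (mem huv'.symm hv') n2)
      (inj (mem huv.symm hv) (mem huv' hu') n3) (inj (mem huv.symm hv) (mem huv'.symm hv') n4)
  · rw [qn ny.1.symm, qn ny.2.1.symm]; exact hr.det_ne
  · intro c hc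
    rw [qn fun e => ny.2.2 (e ▸ hc)]; exact hr.corner c hc
  · intro v hv m1 m2 m3
    rw [qn ny.1.symm, qn ny.2.1.symm]
    by_cases hvy : v = y
    · rw [hvy, qy]; exact h4
    · rw [qn hvy]; exact hr.inTri v ⟨hv, hvy⟩ m1 m2 m3
  · have hyn : ∀ v ∈ U, v ≠ y → q y ≠ q v := by
      intro v hv hvy
      rw [qy, qn hvy]
      by_cases hvx : v = x
      · rw [hvx]; simp [hε.ne', hd0]
      · exact h3 v hv hvx hvy
    intro u hu v hv huv
    by_contra hne
    by_cases huy : u = y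
    · subst huy; exact hyn v hv (Ne.symm hne) huv
    by_cases hvy : v = y
    · subst hvy; exact hyn u hu hne huv.symm
    rw [qn huy, qn hvy] at huv
    exact hne (hi ⟨hu, huy⟩ ⟨hv, hvy⟩ huv)

/-- Every 3-connected `K_{3,3}`-minor-free graph other than `K₅` has a rooted plane drawing. -/
theorem RootedGraph.drawable [Finite V] (h : RootedGraph G U a b C) : Drawable G U a b C := by
  induction hn : U.ncard using Nat.strong_induction_on generalizing G U a b C with
  | _ n ih =>
    subst hn
    by_cases hR : (U \ ({a, b} ∪ C)).Subsingleton
    · obtain ⟨p, T, h1, h2, h3⟩ := exists_rooted_of_subsingleton h.livesIn h.adj.ne h.subsingleton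
        h.left_notMem h.right_notMem hR
      exact Drawable.of_rooted h.subsingleton h1 h2 h3
    rw [Set.not_subsingleton_iff] at hR
    obtain ⟨u, hu, v, hv, huv⟩ := hR
    -- At least two vertices are not roots, and they form a connected set, so there is an edge
    -- between two of them.
    obtain ⟨x, hx, y, hy, hxy⟩ := h.conn_rest {u} (Set.singleton_subset_iff.2 hu) ⟨u, rfl⟩
      ⟨v, hv, huv.symm⟩
    rw [Set.mem_singleton_iff] at hx
    rw [← hx] at hu
    by_cases hcut : ∃ z ∈ U \ {x, y}, ¬ Conn G (U \ {x, y, z})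
    · obtain ⟨z, hz, hcut⟩ := hcut
      exact h.drawable_of_cut (fun G' U' a' b' C' hlt h' => ih _ hlt h' rfl) hu hy.1 hxy hz hcut
    · push Not at hcut
      have hcon : ∀ z, Conn G ((U \ {x, y}) \ {z}) := by
        intro z
        by_cases hz : z ∈ U \ {x, y}
        · have : (U \ {x, y}) \ {z} = U \ {x, y, z} := by
            rw [Set.sdiff_sdiff, Set.insert_union, Set.singleton_union]
          rw [this]; exact hcut z hz
        · rw [Set.sdiff_singleton_eq_self hz]; exact h.conn x y
      refine h.drawable_of_contract hu hy.1 hxy hcon (ih _ ?_ (h.contract hu hy.1 hxy hcon) rfl)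
      exact Set.ncard_sdiff_singleton_lt_of_mem hy.1.1 (Set.toFinite U)

end Splitting

end RectilinearCrossing


namespace RectilinearCrossing

/-! ### Thin empty triangles in a drawing. -/

section Slots

open Filter Topology

/-- There are points inside a triangle that avoid finitely many given lines. -/
lemma exists_inTri_generic {ι : Type*} [Finite ι] {a b c : ℝ × ℝ} (hD : det3 a b c ≠ 0)
    (f g : ι → ℝ × ℝ) (hfg : ∀ i, f i ≠ g i) :
    ∃ q, InTri a b c q ∧ ∀ i, det3 (f i) q (g i) ≠ 0 := by
  have hF : ∀ i, IsOpen {q : ℝ × ℝ | det3 (f i) q (g i) ≠ 0} ∧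
      Dense {q : ℝ × ℝ | det3 (f i) q (g i) ≠ 0} := by
    intro i
    -- The witness is `f i` displaced perpendicularly to the line, where the determinant is the
    -- squared distance of `f i` and `g i`.
    refine isOpen_dense_ne_zero (F := fun q => det3 (f i) q (g i))
      (q₀ := ((f i).1 + ((g i).2 - (f i).2), (f i).2 - ((g i).1 - (f i).1))) (fun q => ?_) ?_
    · unfold det3
      exact ((analyticAt_fst.sub analyticAt_const).mul analyticAt_const).sub
        ((analyticAt_snd.sub analyticAt_const).mul analyticAt_const)
    · intro h
      refine hfg i ?_
      unfold det3 at h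
      have h1 : ((g i).2 - (f i).2) ^ 2 + ((g i).1 - (f i).1) ^ 2 = 0 := by
        linear_combination h
      have h2 : (g i).2 - (f i).2 = 0 := by nlinarith [sq_nonneg ((g i).2 - (f i).2)]
      have h3 : (g i).1 - (f i).1 = 0 := by nlinarith [sq_nonneg ((g i).1 - (f i).1)]
      exact Prod.ext (by linarith) (by linarith)
  have hd : Dense (⋂ i, {q : ℝ × ℝ | det3 (f i) q (g i) ≠ 0}) :=
    dense_iInter_of_isOpen (fun i => (hF i).1) (fun i => (hF i).2)
  have hcen : InTri a b c ((a.1 + b.1 + c.1) / 3, (a.2 + b.2 + c.2) / 3) := by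
    have h2 : 0 < det3 a b c ^ 2 := by positivity
    unfold InTri
    have e1 : det3 ((a.1 + b.1 + c.1) / 3, (a.2 + b.2 + c.2) / 3) b c = det3 a b c / 3 := by
      unfold det3; ring
    have e2 : det3 a ((a.1 + b.1 + c.1) / 3, (a.2 + b.2 + c.2) / 3) c = det3 a b c / 3 := by
      unfold det3; ring
    have e3 : det3 a b ((a.1 + b.1 + c.1) / 3, (a.2 + b.2 + c.2) / 3) = det3 a b c / 3 := by
      unfold det3; ring
    rw [e1, e2, e3]
    refine ⟨?_, ?_, ?_⟩ <;> linarith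
  obtain ⟨q, hq1, hq2⟩ := hd.exists_mem_open
    (isOpen_inTri continuous_const continuous_const continuous_const continuous_id) ⟨_, hcen⟩
  exact ⟨q, hq2, fun i => Set.mem_iInter.1 hq1 i⟩

lemma InCTri.comb {a b c q r m : ℝ × ℝ} {t : ℝ} (hq : InCTri a b c q) (hr : InTri a b c r)
    (h0 : 0 < t) (h1 : t ≤ 1) (e1 : m.1 = (1 - t) * q.1 + t * r.1)
    (e2 : m.2 = (1 - t) * q.2 + t * r.2) : InTri a b c m := by
  have h0' : 0 ≤ 1 - t := by linarith
  obtain ⟨q1, q2, q3⟩ := hq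
  obtain ⟨r1, r2, r3⟩ := hr
  refine ⟨?_, ?_, ?_⟩
  · rw [det3_comb₁ b c m e1 e2]; nlinarith [mul_nonneg h0' q1, mul_pos h0 r1]
  · rw [det3_comb₂ a c m e1 e2]; nlinarith [mul_nonneg h0' q2, mul_pos h0 r2]
  · rw [det3_comb₃ a b m e1 e2]; nlinarith [mul_nonneg h0' q3, mul_pos h0 r3]

/-- A triangle whose side at `P` is steeper than the line `Pw` meets that line only in `P`. -/
lemma eq_of_mem_thin {P Q T w m : ℝ × ℝ} (hD : det3 P Q T ≠ 0)
    (hw : det3 P w T * det3 P Q w < 0) (hm : m ∈ segment ℝ P w) (hT : InCTri P Q T m) : m = P := by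
  obtain ⟨t, h0, h1, e1, e2⟩ := mem_seg.1 hm
  obtain ⟨-, k1, k2⟩ := hT
  rw [det3_comb₂ P T m e1 e2] at k1
  rw [det3_comb₃ P Q m e1 e2] at k2
  have z1 : det3 P P T = 0 := by unfold det3; ring
  have z2 : det3 P Q P = 0 := by unfold det3; ring
  rw [z1] at k1
  rw [z2] at k2
  have key : 0 ≤ (det3 P w T * det3 P Q w) * (t * det3 P Q T) ^ 2 := by
    have := mul_nonneg k1 k2
    nlinarith
  have ht : t = 0 := by
    by_contra ht
    have : 0 < (t * det3 P Q T) ^ 2 := by positivity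
    nlinarith
  subst ht
  exact Prod.ext (by linarith) (by linarith)

/-- A flat triangle over `PQ` is swept by translates of its base. -/
lemma mem_translate_of_mem_thin {P Q T n m : ℝ × ℝ} {ε : ℝ} (hε : 0 < ε) (hD : det3 P Q T ≠ 0)
    (hT1 : T.1 = (P.1 + Q.1) / 2 + ε * n.1) (hT2 : T.2 = (P.2 + Q.2) / 2 + ε * n.2)
    (hm : InCTri P Q T m) :
    ∃ δ, 0 ≤ δ ∧ δ ≤ ε ∧ m ∈ segment ℝ (P + δ • n) (Q + δ • n) := by
  obtain ⟨h1, h2, h3⟩ := hm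
  have hs := det3_sum P Q T m
  obtain ⟨b1, b2⟩ := bary P Q T m
  have hD2 : 0 < det3 P Q T ^ 2 := by positivity
  obtain ⟨α, hα⟩ : ∃ α, α = det3 m Q T / det3 P Q T := ⟨_, rfl⟩
  obtain ⟨β, hβ⟩ : ∃ β, β = det3 P m T / det3 P Q T := ⟨_, rfl⟩
  obtain ⟨γ, hγ⟩ : ∃ γ, γ = det3 P Q m / det3 P Q T := ⟨_, rfl⟩
  have pos : ∀ {x : ℝ}, 0 ≤ x * det3 P Q T → 0 ≤ x / det3 P Q T := fun {x} hx => by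
    have : x / det3 P Q T = x * det3 P Q T / det3 P Q T ^ 2 := by field_simp
    rw [this]; positivity
  have hα0 : 0 ≤ α := hα ▸ pos h1
  have hβ0 : 0 ≤ β := hβ ▸ pos h2
  have hγ0 : 0 ≤ γ := hγ ▸ pos h3
  have hsum : α + β + γ = 1 := by
    rw [hα, hβ, hγ, ← add_div, ← add_div, hs, div_self hD]
  have m1 : m.1 = α * P.1 + β * Q.1 + γ * T.1 := by
    rw [hα, hβ, hγ]; field_simp; linarith
  have m2 : m.2 = α * P.2 + β * Q.2 + γ * T.2 := by
    rw [hα, hβ, hγ]; field_simp; linarith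
  have hα' : α = 1 - β - γ := by linarith
  refine ⟨γ * ε, by positivity, by nlinarith, mem_seg.2 ⟨β + γ / 2, by positivity, by linarith, ?_, ?_⟩⟩
  · rw [m1, hT1, hα']; simp; ring
  · rw [m2, hT2, hα']; simp; ring

variable {V : Type*} {G : SimpleGraph V} {U : Set V} {a b : V} {p : V → ℝ × ℝ} {T P Q : ℝ × ℝ}

/-- A triangle inside the root triangle that meets the drawing only in its corners `P` and `Q`, or its
base `PQ`. -/
structure Slot (G : SimpleGraph V) (U : Set V) (a b : V) (p : V → ℝ × ℝ) (T P Q R : ℝ × ℝ) :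
    Prop where
  det_ne : det3 P Q R ≠ 0
  left : InCTri (p a) (p b) T P
  mid : InCTri (p a) (p b) T Q
  right : InTri (p a) (p b) T R
  edge : ∀ u v, G.Adj u v → ∀ m ∈ segment ℝ (p u) (p v), InCTri P Q R m →
    (m = P ∧ (p u = P ∨ p v = P)) ∨ (m = Q ∧ (p u = Q ∨ p v = Q)) ∨
      (p u = P ∧ p v = Q) ∨ (p u = Q ∧ p v = P)
  vertex : ∀ v ∈ U, ¬ InTri P Q R (p v)

/-- The apex is the midpoint of `PQ` moved slightly towards an interior point `q`. Translates of
`PQ` sweep out this triangle and stay clear of edges disjoint from `PQ`; edges leaving `P` or `Q`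
for another position do so more steeply than its sides. -/
lemma exists_slot [Finite V] (hG : LivesIn G U) (hT : det3 (p a) (p b) T ≠ 0)
    (hP : InCTri (p a) (p b) T P) (hQ : InCTri (p a) (p b) T Q) (hPQ : P ≠ Q)
    (hedge : ∀ u v, G.Adj u v → p u ≠ P → p u ≠ Q → p v ≠ P → p v ≠ Q →
      Disjoint (segment ℝ P Q) (segment ℝ (p u) (p v)))
    (hvert : ∀ v ∈ U, p v ≠ P → p v ≠ Q → det3 P Q (p v) ≠ 0) :
    ∃ R, Slot G U a b p T P Q R := by
  obtain ⟨q, hq, hqPQ⟩ := exists_inTri_generic hT (fun _ : Unit => P) (fun _ => Q) fun _ => hPQ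
  have hqPQ : det3 P q Q ≠ 0 := hqPQ ()
  let M : ℝ × ℝ := ((P.1 + Q.1) / 2, (P.2 + Q.2) / 2)
  have hM : InCTri (p a) (p b) T M := hP.segment hQ (mem_seg.2 ⟨1 / 2, by norm_num, by norm_num,
    by simp only [M]; ring, by simp only [M]; ring⟩)
  let n : ℝ × ℝ := q - M
  let R : ℝ → ℝ × ℝ := fun ε => M + ε • n
  have contR : Continuous R := by fun_prop
  have ev : ∀ {X : ℝ → Prop}, IsOpen {ε | X ε} → X 0 → ∀ᶠ ε in 𝓝[>] (0 : ℝ), X ε := fun hs h0 =>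
    nhdsWithin_le_nhds (hs.mem_nhds h0)
  have R0 : R 0 = M := by simp [R]
  -- Stated for all small `δ`, since the whole sweep has to avoid the edges.
  have e1 : ∃ ε₀ > (0 : ℝ), ∀ δ, 0 ≤ δ → δ < ε₀ → ∀ u v, G.Adj u v → p u ≠ P → p u ≠ Q →
      p v ≠ P → p v ≠ Q → Disjoint (segment ℝ (P + δ • n) (Q + δ • n)) (segment ℝ (p u) (p v)) := by
    have : ∀ᶠ δ in 𝓝 (0 : ℝ), ∀ u v, G.Adj u v → p u ≠ P → p u ≠ Q → p v ≠ P → p v ≠ Q →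
        Disjoint (segment ℝ (P + δ • n) (Q + δ • n)) (segment ℝ (p u) (p v)) := by
      simp only [eventually_all]
      intro u v huv n1 n2 n3 n4
      refine (isOpen_disjoint_segment' (X := ℝ) (a := fun δ => P + δ • n) (b := fun δ => Q + δ • n)
        (by fun_prop) (by fun_prop) continuous_const continuous_const).mem_nhds ?_
      simp only [Set.mem_ofPred_eq, zero_smul, add_zero]
      exact hedge u v huv n1 n2 n3 n4
    obtain ⟨ε₀, h0, h1⟩ := Metric.eventually_nhds_iff.1 this
    exact ⟨ε₀, h0, fun δ h2 h3 => h1 (by rwa [Real.dist_eq, sub_zero, abs_of_nonneg h2])⟩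
  obtain ⟨ε₀, hε₀, e1⟩ := e1
  have e2 : ∀ᶠ ε in 𝓝[>] (0 : ℝ), ∀ v ∈ U, p v ≠ P → p v ≠ Q →
      det3 P (p v) (R ε) * det3 P Q (p v) < 0 := by
    simp only [eventually_all]
    intro v hv n1 n2
    refine ev (isOpen_lt ((continuous_det3 continuous_const continuous_const contR).mul
      continuous_const) continuous_const) ?_
    have h2 : 0 < det3 P Q (p v) ^ 2 := by have := hvert v hv n1 n2; positivity
    have : det3 P (p v) M = - det3 P Q (p v) / 2 := by simp only [M, det3]; ring
    rw [R0, this]; nlinarith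
  have e3 : ∀ᶠ ε in 𝓝[>] (0 : ℝ), ∀ v ∈ U, p v ≠ P → p v ≠ Q →
      det3 Q (p v) (R ε) * det3 Q P (p v) < 0 := by
    simp only [eventually_all]
    intro v hv n1 n2
    refine ev (isOpen_lt ((continuous_det3 continuous_const continuous_const contR).mul
      continuous_const) continuous_const) ?_
    have h2 : 0 < det3 P Q (p v) ^ 2 := by have := hvert v hv n1 n2; positivity
    have : det3 Q (p v) M = det3 P Q (p v) / 2 := by simp only [M, det3]; ring
    rw [R0, this, det3_swap Q P]; nlinarith
  have e4 : ∀ᶠ ε in 𝓝[>] (0 : ℝ), ε < min ε₀ 1 := ev (isOpen_lt continuous_id continuous_const)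
    (by simp [hε₀])
  obtain ⟨ε, ⟨⟨h2, h3⟩, h4⟩, hε⟩ := (((e2.and e3).and e4).and self_mem_nhdsWithin).exists
  have hε : 0 < ε := hε
  obtain ⟨h4, h5⟩ := lt_min_iff.1 h4
  have hD : det3 P Q (R ε) ≠ 0 := by
    have : det3 P Q (R ε) = - ε * det3 P q Q := by
      simp only [R, n, M, det3, Prod.fst_add, Prod.snd_add, Prod.smul_fst, Prod.smul_snd, Prod.fst_sub,
        Prod.snd_sub, smul_eq_mul]
      ring
    rw [this]
    exact mul_ne_zero (neg_ne_zero.2 hε.ne') hqPQ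
  have hD' : det3 Q P (R ε) ≠ 0 := by rw [det3_swap]; exact neg_ne_zero.2 hD
  have tP : ∀ v ∈ U, p v ≠ P → p v ≠ Q → ∀ m ∈ segment ℝ P (p v), InCTri P Q (R ε) m → m = P :=
    fun v hv n1 n2 m hm hmT => eq_of_mem_thin hD (h2 v hv n1 n2) hm hmT
  have tQ : ∀ v ∈ U, p v ≠ P → p v ≠ Q → ∀ m ∈ segment ℝ Q (p v), InCTri P Q (R ε) m → m = Q :=
    fun v hv n1 n2 m hm hmT => eq_of_mem_thin hD' (h3 v hv n1 n2) hm hmT.swap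
  have half : ∀ u v, G.Adj u v → ∀ m ∈ segment ℝ (p u) (p v), InCTri P Q (R ε) m →
      (p u = P ∨ p u = Q) →
      (m = P ∧ (p u = P ∨ p v = P)) ∨ (m = Q ∧ (p u = Q ∨ p v = Q)) ∨
      (p u = P ∧ p v = Q) ∨ (p u = Q ∧ p v = P) := by
    intro u v huv m hm hmT hu
    have hvU := hG.right huv
    rcases hu with hu | hu
    · by_cases v1 : p v = P
      · rw [hu, v1, segment_same] at hm
        exact Or.inl ⟨hm, Or.inl hu⟩
      by_cases v2 : p v = Q
      · exact Or.inr (Or.inr (Or.inl ⟨hu, v2⟩))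
      · rw [hu] at hm
        exact Or.inl ⟨tP v hvU v1 v2 m hm hmT, Or.inl hu⟩
    · by_cases v2 : p v = Q
      · rw [hu, v2, segment_same] at hm
        exact Or.inr (Or.inl ⟨hm, Or.inl hu⟩)
      by_cases v1 : p v = P
      · exact Or.inr (Or.inr (Or.inr ⟨hu, v1⟩))
      · rw [hu] at hm
        exact Or.inr (Or.inl ⟨tQ v hvU v1 v2 m hm hmT, Or.inl hu⟩)
  refine ⟨R ε, hD, hP, hQ, hM.comb hq hε h5.le ?_ ?_, ?_, ?_⟩
  · simp [R, n]; ring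
  · simp [R, n]; ring
  · intro u v huv m hm hmT
    by_cases hu : p u = P ∨ p u = Q
    · exact half u v huv m hm hmT hu
    by_cases hv : p v = P ∨ p v = Q
    · rw [segment_symm] at hm
      have := half v u huv.symm m hm hmT hv
      tauto
    rw [not_or] at hu hv
    obtain ⟨δ, d0, d1, hδ⟩ := mem_translate_of_mem_thin (n := n) hε hD (by simp [R, M])
      (by simp [R, M]) hmT
    exact absurd hm (Set.disjoint_left.1 (e1 δ d0 (lt_of_le_of_lt d1 h4) u v huv hu.1 hu.2 hv.1 hv.2) hδ)
  · intro v hv hvT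
    have nP : p v ≠ P := fun e => by
      have := hvT.2.2; rw [e] at this; simp [det3] at this
    have nQ : p v ≠ Q := fun e => by
      have := hvT.2.2; rw [e] at this; simp [det3, mul_comm] at this
    exact nP (tP v hv nP nQ _ (right_mem_segment ℝ _ _) hvT.inCTri)

lemma exists_slot_of_edge [Finite V] (hG : LivesIn G U) (hp : PlaneMap G p) (hr : Rooted U a b ∅ p T)
    (hg : NoThree p) {s t : V} (hst : G.Adj s t) (hne : p s ≠ p t) :
    ∃ R, Slot G U a b p T (p s) (p t) R :=
  exists_slot hG hr.det_ne (hr.inCTri (hG hst)) (hr.inCTri (hG.right hst)) hne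
    (fun u v huv n1 n2 n3 n4 => hp s t u v hst huv n1.symm n3.symm n2.symm n4.symm)
    (fun v _ n1 n2 => hg s t v hne n1.symm n2.symm)

/-- The base is a short segment starting at `p s` in a direction off all lines to other positions.
-/
lemma exists_slot_of_vertex [Finite V] (hG : LivesIn G U) (hr : Rooted U a b ∅ p T)
    (hg : NoThree p) {s : V} (hs : s ∈ U) : ∃ Q R, Slot G U a b p T (p s) Q R := by
  obtain ⟨q, hq, hqv⟩ := exists_inTri_generic (ι := {v : V // p s ≠ p v}) hr.det_ne
    (fun _ => p s) (fun v => p v.1) (fun v => v.2)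
  have hqv : ∀ v, p s ≠ p v → det3 (p s) q (p v) ≠ 0 := fun v hv => hqv ⟨v, hv⟩
  have hP := hr.inCTri hs
  have hpq : p s ≠ q := by
    intro e
    have hD := hr.det_ne
    by_cases h1 : p s = p a
    · have := hqv b (fun h => hD (by rw [← h1, h]; simp [det3]))
      rw [← e] at this; simp [det3] at this
    · have := hqv a h1
      rw [← e] at this; simp [det3] at this
  have e1 : ∀ᶠ ε in 𝓝[>] (0 : ℝ), ∀ u v, G.Adj u v → p u ≠ p s → p v ≠ p s →
      Disjoint (segment ℝ (p s) (p s + ε • (q - p s))) (segment ℝ (p u) (p v)) := by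
    simp only [eventually_all]
    intro u v huv n1 n3
    refine nhdsWithin_le_nhds ((isOpen_disjoint_segment' (X := ℝ) (a := fun _ => p s)
      (b := fun ε => p s + ε • (q - p s)) (by fun_prop) (by fun_prop) continuous_const
      continuous_const).mem_nhds ?_)
    simp only [Set.mem_ofPred_eq, zero_smul, add_zero, segment_same, Set.disjoint_singleton_left]
    intro hm
    by_cases huv' : p u = p v
    · rw [huv', segment_same] at hm; exact n3 hm.symm
    · exact hg u v s huv' n1 n3 (det3_eq_zero_of_mem_segment hm)
  have e2 : ∀ᶠ ε in 𝓝[>] (0 : ℝ), ε < 1 := nhdsWithin_le_nhds (Iio_mem_nhds one_pos)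
  obtain ⟨ε, ⟨h1, h2⟩, hε⟩ := ((e1.and e2).and self_mem_nhdsWithin).exists
  have hε : 0 < ε := hε
  set Q := p s + ε • (q - p s) with hQ
  have hdet : ∀ v, p s ≠ p v → det3 (p s) Q (p v) ≠ 0 := by
    intro v hv
    have : det3 (p s) Q (p v) = ε * det3 (p s) q (p v) := by
      simp only [hQ, det3, Prod.fst_add, Prod.snd_add, Prod.smul_fst, Prod.smul_snd, Prod.fst_sub,
        Prod.snd_sub, smul_eq_mul]
      ring
    rw [this]; exact mul_ne_zero hε.ne' (hqv v hv)
  have hsQ : p s ≠ Q := by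
    intro e
    have : ε • (q - p s) = 0 := by rw [hQ] at e; simpa using e
    rcases smul_eq_zero.1 this with h | h
    exacts [hε.ne' h, hpq (sub_eq_zero.1 h).symm]
  obtain ⟨R, hR⟩ := exists_slot hG hr.det_ne hP
    (hP.segment hq.inCTri (mem_seg.2 ⟨ε, hε.le, h2.le, by simp [hQ]; ring, by simp [hQ]; ring⟩)) hsQ
    (fun u v huv n1 _ n3 _ => h1 u v huv n1 n3) (fun v _ n1 _ => hdet v n1.symm)
  exact ⟨Q, R, hR⟩

end Slots

end RectilinearCrossing


namespace RectilinearCrossing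

/-! ### Placing a part of the graph into a slot. -/

section Gluing

/-- An affine map that puts a triangle into another one, with the first corner at a given place. -/
lemma exists_affine_inTri {P Q R P₀ Q₀ R₀ x y z : ℝ × ℝ} (hP : InCTri P Q R P₀) (hQ : InTri P Q R Q₀)
    (hR : InTri P Q R R₀) (hD : det3 P₀ Q₀ R₀ ≠ 0) (hD' : det3 x y z ≠ 0) :
    ∃ L : ℝ × ℝ → ℝ × ℝ, L x = P₀ ∧ L y = Q₀ ∧ Function.Injective L ∧
      (∀ p q, segment ℝ (L p) (L q) = L '' segment ℝ p q) ∧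
      ∀ q, InTri x y z q → InTri P Q R (L q) := by
  obtain ⟨L, h1, h2, h3, h4, h5, h6⟩ := exists_affine hD' hD
  exact ⟨L, h1, h2, h4, h5, fun q hq => InTri.trans hP hQ.inCTri hR (h6 q hq)⟩

/-- `P₀Q₀R₀` receives an unattached part, and `PQ₀R₀` a part attached at the corner `P`. -/
lemma exists_inner_triangle {P Q R : ℝ × ℝ} (hD : det3 P Q R ≠ 0) :
    ∃ P₀ Q₀ R₀, InTri P Q R P₀ ∧ InTri P Q R Q₀ ∧ InTri P Q R R₀ ∧ det3 P₀ Q₀ R₀ ≠ 0 ∧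
      det3 P Q₀ R₀ ≠ 0 := by
  have h2 : 0 < det3 P Q R ^ 2 := by positivity
  have key : ∀ α β γ : ℝ, α + β + γ = 1 → 0 < α → 0 < β → 0 < γ →
      InTri P Q R (α * P.1 + β * Q.1 + γ * R.1, α * P.2 + β * Q.2 + γ * R.2) := by
    intro α β γ hs h1 h3 h4
    have hα : α = 1 - β - γ := by linarith
    have e1 : det3 (α * P.1 + β * Q.1 + γ * R.1, α * P.2 + β * Q.2 + γ * R.2) Q R =
        α * det3 P Q R := by rw [hα]; unfold det3; ring
    have e2 : det3 P (α * P.1 + β * Q.1 + γ * R.1, α * P.2 + β * Q.2 + γ * R.2) R =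
        β * det3 P Q R := by rw [hα]; unfold det3; ring
    have e3 : det3 P Q (α * P.1 + β * Q.1 + γ * R.1, α * P.2 + β * Q.2 + γ * R.2) =
        γ * det3 P Q R := by rw [hα]; unfold det3; ring
    unfold InTri
    rw [e1, e2, e3]
    refine ⟨?_, ?_, ?_⟩ <;> rw [mul_assoc, ← sq] <;> positivity
  refine ⟨_, _, _, key (1 / 2) (1 / 4) (1 / 4) (by norm_num) (by norm_num) (by norm_num) (by norm_num),
    key (1 / 4) (1 / 2) (1 / 4) (by norm_num) (by norm_num) (by norm_num) (by norm_num),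
    key (1 / 4) (1 / 4) (1 / 2) (by norm_num) (by norm_num) (by norm_num) (by norm_num), ?_, ?_⟩
  · have : ∀ x y : ℝ, x = 1 / 16 * y → y ≠ 0 → x ≠ 0 := fun x y h hy => by
      rw [h]; exact mul_ne_zero (by norm_num) hy
    exact this _ (det3 P Q R) (by unfold det3; ring) hD
  · have : ∀ x y : ℝ, x = 3 / 16 * y → y ≠ 0 → x ≠ 0 := fun x y h hy => by
      rw [h]; exact mul_ne_zero (by norm_num) hy
    exact this _ (det3 P Q R) (by unfold det3; ring) hD

variable {V : Type*} {G : SimpleGraph V} {U B : Set V} {a b : V}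

/-- At most two vertices of `U` share a position. -/
def FibresLeTwo (p : V → ℝ × ℝ) (U : Set V) : Prop :=
  ∀ u ∈ U, ∀ v ∈ U, ∀ w ∈ U, p u = p v → p u = p w → u = v ∨ u = w ∨ v = w

/-- There is a plane placement in general position, with at most two vertices in one position, inside
a triangle with side `ab`. -/
def BagDrawable (G : SimpleGraph V) (U : Set V) (a b : V) : Prop :=
  ∃ p T, PlaneMap G p ∧ Rooted U a b ∅ p T ∧ NoThree p ∧ FibresLeTwo p U

lemma BagDrawable.of_rooted [Finite V] {p : V → ℝ × ℝ} {T : ℝ × ℝ} (h : PlaneMap G p)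
    (hr : Rooted U a b ∅ p T) (hf : FibresLeTwo p U) : BagDrawable G U a b := by
  obtain ⟨p', T', h1, h2, h3, h4⟩ := exists_noThree Set.subsingleton_empty h hr
  exact ⟨p', T', h1, h2, h3, fun u hu v hv w hw huv huw => hf u hu v hv w hw ((h4 u v).1 huv)
    ((h4 u w).1 huw)⟩

lemma PlaneMap.comp {p : V → ℝ × ℝ} (h : PlaneMap G p) {L : ℝ × ℝ → ℝ × ℝ}
    (hL : Function.Injective L) (hs : ∀ p q, segment ℝ (L p) (L q) = L '' segment ℝ p q) :
    PlaneMap G (fun v => L (p v)) := by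
  intro u v u' v' e e' n1 n2 n3 n4
  dsimp only at *
  rw [hs, hs, Set.disjoint_image_iff hL]
  exact h u v u' v' e e' (fun h => n1 (by rw [h])) (fun h => n2 (by rw [h]))
    (fun h => n3 (by rw [h])) (fun h => n4 (by rw [h]))

lemma FibresLeTwo.comp {p : V → ℝ × ℝ} (h : FibresLeTwo p U) (hBU : B ⊆ U) {L : ℝ × ℝ → ℝ × ℝ}
    (hL : Function.Injective L) : FibresLeTwo (fun v => L (p v)) B :=
  fun u hu v hv w hw huv huw => h u (hBU hu) v (hBU hv) w (hBU hw) (hL huv) (hL huw)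

/-- A drawing of the part `B` is put into a slot of the drawing of the other part. -/
lemma BagDrawable.glue [Finite V] (hG : LivesIn G U) (ha : a ∉ B) (hb : b ∉ B)
    {GA GB : SimpleGraph V} {pA q : V → ℝ × ℝ} {T P Q R : ℝ × ℝ}
    (hpA : PlaneMap GA pA) (hGA : ∀ u ∈ U \ B, ∀ v ∈ U \ B, G.Adj u v → GA.Adj u v)
    (hr : Rooted (U \ B) a b ∅ pA T) (hfA : FibresLeTwo pA (U \ B))
    (hs : Slot GA (U \ B) a b pA T P Q R) (hq : PlaneMap GB q) (hfB : FibresLeTwo q B)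
    (hqB : ∀ u ∈ B, InTri P Q R (q u)) (hBB : ∀ u ∈ B, ∀ v ∈ B, G.Adj u v → GB.Adj u v)
    (hBA : ∀ u ∈ B, ∀ v ∈ U \ B, G.Adj u v → (pA v = P ∨ pA v = Q) ∧ ∃ v', GB.Adj u v' ∧ q v' = pA v) :
    BagDrawable G U a b := by
  classical
  let p : V → ℝ × ℝ := fun v => if v ∈ B then q v else pA v
  have pB : ∀ {v}, v ∈ B → p v = q v := fun hv => if_pos hv
  have pA' : ∀ {v}, v ∉ B → p v = pA v := fun hv => if_neg hv
  have tri : ∀ {v}, v ∈ B → InTri P Q R (p v) := fun hv => by rw [pB hv]; exact hqB _ hv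
  have triP : ∀ {m}, InTri P Q R m → m ≠ P := fun h e => by
    have := h.2.2; rw [e] at this; simp [det3] at this
  have triQ : ∀ {m}, InTri P Q R m → m ≠ Q := fun h e => by
    have := h.2.2; rw [e] at this; simp [det3, mul_comm] at this
  have edgeB : ∀ u ∈ B, ∀ v, G.Adj u v → InCTri P Q R (p v) ∧ (v ∉ B → p v = P ∨ p v = Q) ∧
      ∃ v', GB.Adj u v' ∧ q v' = p v := by
    intro u hu v huv
    by_cases hv : v ∈ B
    · exact ⟨(tri hv).inCTri, fun h => absurd hv h, v, hBB u hu v hv huv, (pB hv).symm⟩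
    · obtain ⟨h1, h2⟩ := hBA u hu v ⟨hG.right huv, hv⟩ huv
      rw [pA' hv]
      refine ⟨?_, fun _ => h1, h2⟩
      rcases h1 with h1 | h1 <;> rw [h1]
      exacts [inCTri_left, inCTri_mid]
  -- An outer edge meets the slot only in `P`, in `Q`, or as the base. An edge with an end strictly
  -- inside avoids `P` and `Q` unless it ends there, and meets the base only at such an end.
  have mixed : ∀ u v u' v', G.Adj u v → u ∉ B → v ∉ B → G.Adj u' v' → u' ∈ B →
      p u ≠ p v' → p v ≠ p v' → Disjoint (segment ℝ (p u) (p v)) (segment ℝ (p u') (p v')) := by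
    intro u v u' v' huv hu hv huv' hu' n2 n4
    obtain ⟨c1, c2, -⟩ := edgeB u' hu' v' huv'
    have tu := tri hu'
    rw [Set.disjoint_left]
    intro m hm hm'
    have hmT := tu.inCTri.segment c1 hm'
    have hedge := hs.edge u v (hGA u ⟨hG huv, hu⟩ v ⟨hG.right huv, hv⟩ huv) m
      (by rwa [pA' hu, pA' hv] at hm) hmT
    rw [← pA' hu, ← pA' hv] at hedge
    have nP : m = P → P ≠ p v' → False := fun e h => by
      rw [e] at hm'
      exact corner_notMem_segment hs.det_ne tu.inCTri c1 (triP tu) h.symm hm'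
    have nQ : m = Q → Q ≠ p v' → False := fun e h => by
      rw [e] at hm'
      exact corner_notMem_segment (x := Q) (y := R) (z := P) (by rw [← det3_cycle]; exact hs.det_ne)
        tu.inCTri.rotate c1.rotate (triQ tu) h.symm hm'
    have nPQ : P ≠ p v' → Q ≠ p v' → m ∈ segment ℝ P Q → False := fun h1 h2 hPQ => by
      have hv' : v' ∈ B := by
        by_contra hv'
        rcases c2 hv' with h | h
        exacts [h1 h.symm, h2 h.symm]
      have tv := tri hv'
      obtain ⟨t, t0, t1, e1, e2⟩ := mem_seg.1 hm'
      have hz := det3_eq_zero_of_mem_segment hPQ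
      rw [det3_comb₃ P Q m e1 e2] at hz
      have x1 := tu.2.2
      have x2 := tv.2.2
      have : (1 - t) * (det3 P Q (p u') * det3 P Q R) + t * (det3 P Q (p v') * det3 P Q R) = 0 := by
        linear_combination det3 P Q R * hz
      rcases eq_or_lt_of_le t0 with h | h
      · rw [← h] at this; linarith
      · have := mul_pos h x2
        have := mul_nonneg (sub_nonneg.2 t1) x1.le
        linarith
    rcases hedge with ⟨e, h | h⟩ | ⟨e, h | h⟩ | ⟨h1, h2⟩ | ⟨h1, h2⟩
    · exact nP e (h ▸ n2)
    · exact nP e (h ▸ n4)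
    · exact nQ e (h ▸ n2)
    · exact nQ e (h ▸ n4)
    · exact nPQ (h1 ▸ n2) (h2 ▸ n4) (by rwa [h1, h2] at hm)
    · exact nPQ (h2 ▸ n4) (h1 ▸ n2) (by rw [h1, h2, segment_symm] at hm; exact hm)
  have mixed' : ∀ u v u' v', G.Adj u v → u ∉ B → v ∉ B → G.Adj u' v' → (u' ∈ B ∨ v' ∈ B) →
      p u ≠ p u' → p v ≠ p u' →
      p u ≠ p v' → p v ≠ p v' → Disjoint (segment ℝ (p u) (p v)) (segment ℝ (p u') (p v')) := by
    intro u v u' v' huv hu hv huv' h n1 n2 n3 n4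
    rcases h with h | h
    · exact mixed u v u' v' huv hu hv huv' h n3 n4
    · rw [segment_symm ℝ (p u')]
      exact mixed u v v' u' huv hu hv huv'.symm h n1 n2
  -- Only end positions matter: when two attachment vertices coincide, a single vertex of `GB`
  -- represents both.
  have lift : ∀ u v, G.Adj u v → (u ∈ B ∨ v ∈ B) → ∃ x y, GB.Adj x y ∧ q x = p u ∧ q y = p v := by
    rintro u v huv (hu | hv)
    · obtain ⟨-, -, v', h1, h2⟩ := edgeB u hu v huv
      exact ⟨u, v', h1, (pB hu).symm, h2⟩
    · obtain ⟨-, -, u', h1, h2⟩ := edgeB v hv u huv.symm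
      exact ⟨u', v, h1.symm, h2, (pB hv).symm⟩
  refine BagDrawable.of_rooted (p := p) (T := T) ?_ ⟨?_, by simp, ?_⟩ ?_
  · intro u v u' v' e e' n1 n2 n3 n4
    by_cases h : u ∈ B ∨ v ∈ B <;> by_cases h' : u' ∈ B ∨ v' ∈ B
    · obtain ⟨x, y, k1, k2, k3⟩ := lift u v e h
      obtain ⟨x', y', k1', k2', k3'⟩ := lift u' v' e' h'
      have := hq x y x' y' k1 k1'
      rw [k2, k3, k2', k3'] at this
      exact this n1 n2 n3 n4
    · rw [not_or] at h'
      exact (mixed' u' v' u v e' h'.1 h'.2 e h n1.symm n2.symm n3.symm n4.symm).symm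
    · rw [not_or] at h
      exact mixed' u v u' v' e h.1 h.2 e' h' n1 n3 n2 n4
    · rw [not_or] at h h'
      rw [pA' h.1, pA' h.2, pA' h'.1, pA' h'.2] at *
      exact hpA u v u' v' (hGA u ⟨hG e, h.1⟩ v ⟨hG.right e, h.2⟩ e)
        (hGA u' ⟨hG e', h'.1⟩ v' ⟨hG.right e', h'.2⟩ e') n1 n2 n3 n4
  · rw [pA' ha, pA' hb]; exact hr.det_ne
  · intro v hv n1 n2 _
    rw [pA' ha, pA' hb]
    by_cases hvB : v ∈ B
    · exact InTri.trans hs.left hs.mid hs.right (tri hvB)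
    · rw [pA' hvB]; exact hr.inTri v ⟨hv, hvB⟩ n1 n2 (by simp)
  -- Vertices of `B` are inside the slot and no others are, so positions are not shared across the
  -- two parts.
  · have sep : ∀ u ∈ U, ∀ v ∈ U, p u = p v → (u ∈ B ↔ v ∈ B) := by
      have : ∀ u ∈ U, ∀ v ∈ U, p u = p v → u ∈ B → v ∈ B := by
        intro u _ v hv huv hu
        by_contra hvB
        have h1 := hs.vertex v ⟨hv, hvB⟩
        rw [← pA' hvB, ← huv] at h1
        exact h1 (tri hu)
      exact fun u hu v hv huv => ⟨this u hu v hv huv, this v hv u hu huv.symm⟩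
    intro u hu v hv w hw huv huw
    have h1 := sep u hu v hv huv
    have h2 := sep u hu w hw huw
    by_cases huB : u ∈ B
    · rw [pB huB, pB (h1.1 huB)] at huv
      rw [pB huB, pB (h2.1 huB)] at huw
      exact hfB u huB v (h1.1 huB) w (h2.1 huB) huv huw
    · rw [pA' huB, pA' (mt h1.2 huB)] at huv
      rw [pA' huB, pA' (mt h2.2 huB)] at huw
      exact hfA u ⟨hu, huB⟩ v ⟨hv, mt h1.2 huB⟩ w ⟨hw, mt h2.2 huB⟩ huv huw

/-- A bag drawing can be put inside a given triangle, also with the first root at a corner. -/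
lemma BagDrawable.exists_shrink {r w : V} (h : BagDrawable G U r w) {P Q R : ℝ × ℝ} (hD : det3 P Q R ≠ 0) :
    (∃ q, PlaneMap G q ∧ FibresLeTwo q U ∧ q r = P ∧ ∀ v ∈ U, v ≠ r → InTri P Q R (q v)) ∧
    ∃ q, PlaneMap G q ∧ FibresLeTwo q U ∧ ∀ v ∈ U, InTri P Q R (q v) := by
  obtain ⟨p, T, h1, h2, -, h4⟩ := h
  obtain ⟨P₀, Q₀, R₀, t1, t2, t3, d1, d2⟩ := exists_inner_triangle hD
  constructor
  · obtain ⟨L, l1, l2, l3, l4, l5⟩ := exists_affine_inTri inCTri_left t2 t3 d2 h2.det_ne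
    refine ⟨fun v => L (p v), h1.comp l3 l4, h4.comp subset_rfl l3, l1, fun v hv hvr => ?_⟩
    by_cases hvw : v = w
    · rw [hvw]; dsimp only; rwa [l2]
    · exact l5 _ (h2.inTri v hv hvr hvw (by simp))
  · obtain ⟨L, l1, l2, l3, l4, l5⟩ := exists_affine_inTri t1.inCTri t2 t3 d1 h2.det_ne
    refine ⟨fun v => L (p v), h1.comp l3 l4, h4.comp subset_rfl l3, fun v hv => ?_⟩
    by_cases hvr : v = r
    · rw [hvr]; dsimp only; rwa [l1]
    by_cases hvw : v = w
    · rw [hvw]; dsimp only; rwa [l2]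
    · exact l5 _ (h2.inTri v hv hvr hvw (by simp))

end Gluing

end RectilinearCrossing


namespace RectilinearCrossing

/-! ### Drawings with doubled vertices for all `K_{3,3}`-minor-free graphs. -/

section BagDrawings

variable {V : Type*} {G : SimpleGraph V} {U B : Set V} {a b : V}

lemma conn_of_complete {A : Set V} (h : ∀ u ∈ A, ∀ v ∈ A, u ≠ v → G.Adj u v) : Conn G A := by
  rintro M hM ⟨u, hu⟩ ⟨v, hv⟩
  exact ⟨u, hu, v, hv, h u (hM hu) v hv.1 fun e => hv.2 (e ▸ hu)⟩

/-- `K₅` is drawn as a `K₄` with one vertex doubled. -/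
lemma bagDrawable_five [Finite V] (hG : LivesIn G U) (hfree : ¬ HasK33 G) (hab : G.Adj a b)
    (h5 : U.ncard = 5) (hK : ∀ u ∈ U, ∀ v ∈ U, u ≠ v → G.Adj u v) : BagDrawable G U a b := by
  classical
  have haU := hG hab
  have hbU := hG.right hab
  obtain ⟨e, heU, he⟩ := Set.exists_mem_notMem_of_ncard_lt_ncard (s := {a, b}) (t := U)
    (by rw [h5, Set.ncard_pair hab.ne]; norm_num)
  obtain ⟨d, hdU, hd⟩ := Set.exists_mem_notMem_of_ncard_lt_ncard (s := {e, a, b}) (t := U)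
    (lt_of_le_of_lt (Set.ncard_insert_le _ _) (by rw [h5, Set.ncard_pair hab.ne]; norm_num))
  simp only [Set.mem_insert_iff, Set.mem_singleton_iff, not_or] at he hd
  have hK' : ∀ u ∈ U \ {e}, ∀ v ∈ U \ {e}, u ≠ v → (restr G (U \ {e})).Adj u v :=
    fun u hu v hv huv => ⟨hK u hu.1 v hv.1 huv, hu, hv⟩
  have hroot : RootedGraph (restr G (U \ {e})) (U \ {e}) a b ∅ :=
    ⟨restr_livesIn, fun h => hfree (h.mono restr_le),
      fun s t => conn_of_complete fun u hu v hv => hK' u hu.1 v hv.1,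
      fun h => by rw [Set.ncard_sdiff_singleton_of_mem heU, h5] at h; omega, by simp, by simp, by simp,
      by simp, hK' a ⟨haU, Ne.symm he.1⟩ b ⟨hbU, Ne.symm he.2⟩ hab.ne, by simp, by simp,
      conn_of_complete fun u hu v hv => hK' u hu.1 v hv.1⟩
  obtain ⟨p, T, hp, hr, hg, hi⟩ := hroot.drawable
  -- `e` is put at the position of `d`; the edge `ed` degenerates to a point.
  let ρ : V → V := fun v => if v = e then d else v
  have ρe : ρ e = d := if_pos rfl
  have ρn : ∀ {v}, v ≠ e → ρ v = v := fun hv => if_neg hv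
  have ρU : ∀ v ∈ U, ρ v ∈ U \ {e} := fun v hv => by
    by_cases h : v = e
    · rw [h, ρe]; exact ⟨hdU, hd.1⟩
    · rw [ρn h]; exact ⟨hv, h⟩
  have hsub : ∀ u ∈ U, ∀ u' ∈ U, ∀ v' ∈ U, p (ρ u) ≠ p (ρ u') → p (ρ u) ≠ p (ρ v') →
      Disjoint (segment ℝ (p (ρ u)) (p (ρ u))) (segment ℝ (p (ρ u')) (p (ρ v'))) := by
    intro u hu u' hu' v' hv' n1 n2
    rw [segment_same, Set.disjoint_singleton_left]
    intro hm
    by_cases h' : p (ρ u') = p (ρ v')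
    · rw [h', segment_same] at hm; exact n2 hm
    · exact hg _ _ _ h' n1.symm n2.symm (det3_eq_zero_of_mem_segment hm)
  refine BagDrawable.of_rooted (p := fun v => p (ρ v)) (T := T) ?_ ⟨?_, by simp, ?_⟩ ?_
  · intro u v u' v' huv huv' n1 n2 n3 n4
    dsimp only at *
    have hu := hG huv
    have hv := hG.right huv
    have hu' := hG huv'
    have hv' := hG.right huv'
    by_cases h : ρ u = ρ v
    · rw [← h]; exact hsub u hu u' hu' v' hv' n1 n2
    by_cases h' : ρ u' = ρ v'
    · rw [← h']; exact (hsub u' hu' u hu v hv n1.symm n3.symm).symm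
    exact hp _ _ _ _ (hK' _ (ρU u hu) _ (ρU v hv) h) (hK' _ (ρU u' hu') _ (ρU v' hv') h') n1 n2 n3 n4
  · rw [ρn (Ne.symm he.1), ρn (Ne.symm he.2)]; exact hr.det_ne
  · intro v hv n1 n2 _
    rw [ρn (Ne.symm he.1), ρn (Ne.symm he.2)]
    by_cases h : v = e
    · rw [h, ρe]; exact hr.inTri d ⟨hdU, hd.1⟩ hd.2.1 hd.2.2 (by simp)
    · rw [ρn h]; exact hr.inTri v ⟨hv, h⟩ n1 n2 (by simp)
  · intro u hu v hv w hw huv huw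
    have h1 := hi (ρU u hu) (ρU v hv) huv
    have h2 := hi (ρU u hu) (ρU w hw) huw
    by_cases hue : u = e
    · by_cases hve : v = e
      · exact Or.inl (hue.trans hve.symm)
      by_cases hwe : w = e
      · exact Or.inr (Or.inl (hue.trans hwe.symm))
      rw [h1, ρn hve, ρn hwe] at h2
      exact Or.inr (Or.inr h2)
    · by_cases hve : v = e
      · by_cases hwe : w = e
        · exact Or.inr (Or.inr (hve.trans hwe.symm))
        · rw [ρn hue, ρn hwe] at h2
          exact Or.inr (Or.inl h2)
      · rw [ρn hue, ρn hve] at h1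
        exact Or.inl h1

/-- A part attached at no more than one vertex. -/
lemma bagDrawable_of_one_cut [Finite V] (hG : LivesIn G U) (hfree : ¬ HasK33 G) (hab : G.Adj a b)
    (ih : ∀ (G' : SimpleGraph V) (U' : Set V) (a' b' : V), U'.ncard < U.ncard → LivesIn G' U' →
      ¬ HasK33 G' → G'.Adj a' b' → BagDrawable G' U' a' b')
    (hBU : B ⊆ U) (hBne : B.Nonempty) (hB : Conn G B) (ha : a ∉ B) (hb : b ∉ B) {s : V}
    (hs : s ∈ U \ B) (hcut : ∀ u ∈ B, ∀ v ∈ U \ B, G.Adj u v → v = s) : BagDrawable G U a b := by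
  have haU := hG hab
  have hbU := hG.right hab
  have hres : ∀ S, ¬ HasK33 (restr G S) := fun S h => hfree (h.mono restr_le)
  obtain ⟨w₀, hw₀⟩ := hBne
  obtain ⟨pA, T, hpA, hrA, hgA, hfA⟩ := ih (restr G (U \ B)) (U \ B) a b
    (Set.ncard_lt_ncard ⟨Set.sdiff_subset, fun h => (h (hBU hw₀)).2 hw₀⟩ (Set.toFinite U))
    restr_livesIn (hres _) ⟨hab, ⟨haU, ha⟩, hbU, hb⟩
  obtain ⟨Q, R, hslot⟩ := exists_slot_of_vertex restr_livesIn hrA hgA hs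
  have hGA : ∀ u ∈ U \ B, ∀ v ∈ U \ B, G.Adj u v → (restr G (U \ B)).Adj u v :=
    fun u hu v hv huv => ⟨huv, hu, hv⟩
  -- A drawing needs a root edge: `sw` if the part is attached to `s`, otherwise any edge inside
  -- `B`, unless `B` is a single vertex.
  by_cases hsw : ∃ w ∈ B, G.Adj s w
  · obtain ⟨w, hw, hsw⟩ := hsw
    have hlt : (B ∪ {s}).ncard < U.ncard := by
      refine Set.ncard_lt_ncard ⟨Set.union_subset hBU (Set.singleton_subset_iff.2 hs.1), fun h => ?_⟩
        (Set.toFinite U)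
      have h1 := (h haU).resolve_left ha
      have h2 := (h hbU).resolve_left hb
      exact hab.ne (h1.trans h2.symm)
    obtain ⟨⟨q, q1, q2, q3, q4⟩, -⟩ := (ih (restr G (B ∪ {s})) (B ∪ {s}) s w hlt restr_livesIn (hres _)
      ⟨hsw, Or.inr rfl, Or.inl hw⟩).exists_shrink hslot.det_ne
    refine BagDrawable.glue hG ha hb hpA hGA hrA hfA hslot q1
      (fun u hu v hv x hx => q2 u (Or.inl hu) v (Or.inl hv) x (Or.inl hx))
      (fun u hu => q4 u (Or.inl hu) fun e => hs.2 (e ▸ hu))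
      (fun u hu v hv huv => ⟨huv, Or.inl hu, Or.inl hv⟩) fun u hu v hv huv => ?_
    have hvs := hcut u hu v hv huv
    rw [hvs] at huv ⊢
    exact ⟨Or.inl rfl, s, ⟨huv, Or.inl hu, Or.inr rfl⟩, q3⟩
  · push Not at hsw
    have hno : ∀ u ∈ B, ∀ v ∈ U \ B, ¬ G.Adj u v := fun u hu v hv huv => by
      have := hcut u hu v hv huv
      rw [this] at huv
      exact hsw u hu huv.symm
    by_cases hBs : B.Subsingleton
    · obtain ⟨P₀, -, -, t, -⟩ := exists_inner_triangle hslot.det_ne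
      refine BagDrawable.glue (GB := G) (q := fun _ => P₀) hG ha hb hpA hGA hrA hfA hslot
        (fun u v u' v' _ _ n => absurd rfl n) (fun u hu v hv _ _ _ _ => Or.inl (hBs hu hv))
        (fun u hu => t) (fun u hu v hv huv => huv) fun u hu v hv huv => absurd huv (hno u hu v hv)
    · rw [Set.not_subsingleton_iff] at hBs
      obtain ⟨w₁, hw₁, hne⟩ := hBs.exists_ne w₀
      obtain ⟨w, hw, w', hw', hww⟩ := hB {w₀} (Set.singleton_subset_iff.2 hw₀) ⟨w₀, rfl⟩ ⟨w₁, hw₁, hne⟩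
      have hw : w ∈ B := by rw [Set.mem_singleton_iff] at hw; rwa [hw]
      have hlt : B.ncard < U.ncard := Set.ncard_lt_ncard ⟨hBU, fun h => ha (h haU)⟩ (Set.toFinite U)
      obtain ⟨-, q, q1, q2, q3⟩ := (ih (restr G B) B w w' hlt restr_livesIn (hres _)
        ⟨hww, hw, hw'.1⟩).exists_shrink hslot.det_ne
      exact BagDrawable.glue hG ha hb hpA hGA hrA hfA hslot q1 q2 q3
        (fun u hu v hv huv => ⟨huv, hu, hv⟩) fun u hu v hv huv => absurd huv (hno u hu v hv)

/-- A part attached at two vertices. -/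
lemma bagDrawable_of_two_cut [Finite V] (hG : LivesIn G U) (hfree : ¬ HasK33 G) (hab : G.Adj a b)
    (ih : ∀ (G' : SimpleGraph V) (U' : Set V) (a' b' : V), U'.ncard < U.ncard → LivesIn G' U' →
      ¬ HasK33 G' → G'.Adj a' b' → BagDrawable G' U' a' b')
    {s t : V} {K : Set V} (hs : s ∈ U) (ht : t ∈ U) (hst : s ≠ t) (hBU : B ⊆ U \ {s, t})
    (hB : Conn G B) (ha : a ∉ B) (hb : b ∉ B)
    (hcut : ∀ u ∈ B, ∀ v ∈ U \ B, G.Adj u v → v = s ∨ v = t) (hBs : ∃ u ∈ B, G.Adj u s)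
    (hBt : ∃ u ∈ B, G.Adj u t) (hKU : K ⊆ U \ {s, t}) (hKB : Disjoint K B) (hK : Conn G K)
    (hKs : ∃ u ∈ K, G.Adj u s) (hKt : ∃ u ∈ K, G.Adj u t) : BagDrawable G U a b := by
  have haU := hG hab
  have hbU := hG.right hab
  have hsB : s ∉ B := fun h => (hBU h).2 (by simp)
  have htB : t ∉ B := fun h => (hBU h).2 (by simp)
  have hpair : ∀ x ∈ ({s, t} : Set V), ∀ y ∈ ({s, t} : Set V), x ≠ y → x ≠ t → y ≠ t → G.Adj x y := by
    rintro x (rfl | rfl) y (rfl | rfl) h1 h2 h3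
    exacts [absurd rfl h1, absurd rfl h3, absurd rfl h2, absurd rfl h1]
  -- Contracting a connected set on the other side into `t` produces the edge `st`, so both torsos
  -- are minors.
  have hfree' : ∀ S D : Set V, Conn G D → Disjoint D S → (∃ u ∈ D, G.Adj u s) →
      (∃ u ∈ D, G.Adj u t) → ¬ HasK33 (torso G S {s, t}) := by
    rintro S D hD hDS ⟨u, hu, hus⟩ ⟨v, hv, hvt⟩ h
    refine hfree (h.of_torso (z := t) hD hDS ⟨v, hv, hvt.symm⟩ ?_ hpair)
    rintro x (rfl | rfl) hx
    · exact ⟨u, hu, hus.symm⟩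
    · exact absurd rfl hx
  have hfA := hfree' (U \ B) B hB Set.disjoint_sdiff_right hBs hBt
  have hKd : Disjoint K (B ∪ {s, t}) :=
    Set.disjoint_union_right.2 ⟨hKB, Set.disjoint_left.2 fun v hv => (hKU hv).2⟩
  have hfB := hfree' (B ∪ {s, t}) K hK hKd hKs hKt
  obtain ⟨w, hw, hws⟩ := hBs
  obtain ⟨k, hk, -⟩ := hKs
  have hsA : s ∈ U \ B := ⟨hs, hsB⟩
  have htA : t ∈ U \ B := ⟨ht, htB⟩
  have hsS : s ∈ B ∪ {s, t} := by simp
  have htS : t ∈ B ∪ {s, t} := by simp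
  have hstA : (torso G (U \ B) {s, t}).Adj s t := ⟨hst, hsA, htA, Or.inr (by simp)⟩
  have hstB : (torso G (B ∪ {s, t}) {s, t}).Adj s t := ⟨hst, hsS, htS, Or.inr (by simp)⟩
  obtain ⟨pA, T, hpA, hrA, hgA, hfA'⟩ := ih (torso G (U \ B) {s, t}) (U \ B) a b
    (Set.ncard_lt_ncard ⟨Set.sdiff_subset, fun h => (h (hBU hw).1).2 hw⟩ (Set.toFinite U))
    torso_livesIn hfA (torso_adj_of ⟨haU, ha⟩ ⟨hbU, hb⟩ hab)
  have hGA : ∀ u ∈ U \ B, ∀ v ∈ U \ B, G.Adj u v → (torso G (U \ B) {s, t}).Adj u v :=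
    fun u hu v hv huv => torso_adj_of hu hv huv
  have hlt : (B ∪ {s, t}).ncard < U.ncard := by
    refine Set.ncard_lt_ncard ⟨Set.union_subset (hBU.trans Set.sdiff_subset) ?_, fun h => ?_⟩
      (Set.toFinite U)
    · rintro x (rfl | rfl) <;> assumption
    · exact Set.disjoint_left.1 hKd hk (h (hKU hk).1)
  have nBs : ∀ u ∈ B, u ≠ s := fun u hu e => hsB (e ▸ hu)
  have nBt : ∀ u ∈ B, u ≠ t := fun u hu e => htB (e ▸ hu)
  -- Coincident `s`, `t` leave no edge to build a slot on. The part is then drawn with `st`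
  -- contracted, in a slot at their common position; its own vertices stay off that position, so no
  -- third vertex joins the pair.
  by_cases hpst : pA s = pA t
  · obtain ⟨Q, R, hslot⟩ := exists_slot_of_vertex torso_livesIn hrA hgA hsA
    have hsub : B ⊆ (B ∪ {s, t}) \ {t} := fun u hu => ⟨Or.inl hu, nBt u hu⟩
    obtain ⟨⟨q, q1, q2, q3, q4⟩, -⟩ := (ih (contract (torso G (B ∪ {s, t}) {s, t}) s t)
      ((B ∪ {s, t}) \ {t}) s w
      (lt_of_le_of_lt (Set.ncard_le_ncard Set.sdiff_subset (Set.toFinite _)) hlt)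
      (contract_livesIn torso_livesIn hsS) (fun h => hfB (h.of_contract hstB))
      (contract_adj_of (torso_adj_of hsS (Or.inl hw) hws.symm) hst (nBt w hw))).exists_shrink
      hslot.det_ne
    refine BagDrawable.glue hG ha hb hpA hGA hrA hfA' hslot q1
      (fun u hu v hv x hx => q2 u (hsub hu) v (hsub hv) x (hsub hx))
      (fun u hu => q4 u (hsub hu) (nBs u hu))
      (fun u hu v hv huv => contract_adj_of (torso_adj_of (Or.inl hu) (Or.inl hv) huv) (nBt u hu)
        (nBt v hv)) fun u hu v hv huv => ?_
    rcases hcut u hu v hv huv with rfl | rfl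
    · exact ⟨Or.inl rfl, v, contract_adj_of (torso_adj_of (Or.inl hu) hsS huv) (nBt u hu) hst, q3⟩
    · refine ⟨Or.inl hpst.symm, s, ⟨nBs u hu, nBt u hu, hst, Or.inr (Or.inr ⟨rfl, ?_⟩)⟩,
        q3.trans hpst⟩
      exact torso_adj_of htS (Or.inl hu) huv.symm
  · obtain ⟨R, hslot⟩ := exists_slot_of_edge torso_livesIn hpA hrA hgA hstA hpst
    obtain ⟨pB, TB, hpB, hrB, -, hfB'⟩ := ih (torso G (B ∪ {s, t}) {s, t}) (B ∪ {s, t}) s t hlt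
      torso_livesIn hfB hstB
    obtain ⟨L, l1, l2, -, l3, l4, l5⟩ := exists_affine hrB.det_ne hslot.det_ne
    refine BagDrawable.glue hG ha hb hpA hGA hrA hfA' hslot (hpB.comp l3 l4)
      (hfB'.comp Set.subset_union_left l3)
      (fun u hu => l5 _ (hrB.inTri u (Or.inl hu) (nBs u hu) (nBt u hu) (by simp)))
      (fun u hu v hv huv => torso_adj_of (Or.inl hu) (Or.inl hv) huv) fun u hu v hv huv => ?_
    rcases hcut u hu v hv huv with rfl | rfl
    · exact ⟨Or.inl rfl, v, torso_adj_of (Or.inl hu) hsS huv, l1⟩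
    · exact ⟨Or.inr rfl, v, torso_adj_of (Or.inl hu) htS huv, l2⟩

/-- If no part is attached at fewer than two vertices, then the vertices `s`, `t` of a two-vertex cut are
joined outside the part `B`. -/
lemma exists_joining_set (hab : G.Adj a b) (haU : a ∈ U) (hbU : b ∈ U)
    (hone : ∀ B ⊆ U, B.Nonempty → Conn G B → a ∉ B → b ∉ B → ∀ s ∈ U \ B,
      ¬ ∀ u ∈ B, ∀ v ∈ U \ B, G.Adj u v → v = s)
    {s t : V} (hs : s ∈ U) (ht : t ∈ U) (hst : s ≠ t) (hBU : B ⊆ U \ {s, t})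
    (hB : Conn G B) (ha : a ∉ B) (hb : b ∉ B)
    (hcut : ∀ u ∈ B, ∀ v ∈ U \ B, G.Adj u v → v = s ∨ v = t) (hBs : ∃ u ∈ B, G.Adj u s)
    (hBt : ∃ u ∈ B, G.Adj u t) (hne : ((U \ {s, t}) \ B).Nonempty) :
    ∃ K ⊆ U \ {s, t}, Disjoint K B ∧ Conn G K ∧ (∃ u ∈ K, G.Adj u s) ∧ ∃ u ∈ K, G.Adj u t := by
  by_contra hcon
  have mem : ∀ {v}, v ∈ U \ {s, t} ↔ v ∈ U ∧ v ≠ s ∧ v ≠ t := by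
    intro v; simp [Set.mem_sdiff, not_or]
  have hcon : ∀ K ⊆ (U \ {s, t}) \ B, Conn G K → (∀ u ∈ K, ¬ G.Adj u s) ∨ ∀ u ∈ K, ¬ G.Adj u t := by
    intro K hK hKc
    by_contra! h
    exact hcon ⟨K, hK.trans Set.sdiff_subset, Set.disjoint_left.2 fun v hv => (hK hv).2, hKc, h⟩
  have hclosed : ∀ K ⊆ (U \ {s, t}) \ B, (∀ x ∈ K, ∀ y ∈ (U \ {s, t}) \ B, G.Adj x y → y ∈ K) →
      ∀ x ∈ K, ∀ y ∈ U \ K, G.Adj x y → y = s ∨ y = t := by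
    intro K hK hKcl x hx y hy hxy
    by_contra! hyn
    by_cases hyB : y ∈ B
    · rcases hcut y hyB x ⟨(hK hx).1.1, (hK hx).2⟩ hxy.symm with e | e
      exacts [(mem.1 (hK hx).1).2.1 e, (mem.1 (hK hx).1).2.2 e]
    · exact hy.2 (hKcl x hx y ⟨mem.2 ⟨hy.1, hyn⟩, hyB⟩ hxy)
  -- A component avoiding both roots, but not seeing both of `s`, `t`, would be a part attached at
  -- one vertex. As `a` and `b` are adjacent, there is only one component `K`.
  have hroot : ∀ K ⊆ (U \ {s, t}) \ B, K.Nonempty → Conn G K →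
      (∀ x ∈ K, ∀ y ∈ (U \ {s, t}) \ B, G.Adj x y → y ∈ K) → a ∈ K ∨ b ∈ K := by
    intro K hK hKne hKc hKcl
    by_contra! hn
    have hKU : K ⊆ U := fun v hv => (hK hv).1.1
    have hKs : s ∉ K := fun h => (mem.1 (hK h).1).2.1 rfl
    have hKt : t ∉ K := fun h => (mem.1 (hK h).1).2.2 rfl
    rcases hcon K hK hKc with h | h
    · refine hone K hKU hKne hKc hn.1 hn.2 t ⟨ht, hKt⟩ fun u hu v hv huv => ?_
      exact (hclosed K hK hKcl u hu v hv huv).resolve_left fun e => h u hu (e ▸ huv)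
    · refine hone K hKU hKne hKc hn.1 hn.2 s ⟨hs, hKs⟩ fun u hu v hv huv => ?_
      exact (hclosed K hK hKcl u hu v hv huv).resolve_right fun e => h u hu (e ▸ huv)
  obtain ⟨k, hk⟩ := hne
  obtain ⟨K, hKA, hkK, hKc, hKcl⟩ := exists_component G hk
  have hab' : ∀ v ∈ (U \ {s, t}) \ B, v = a ∨ v = b → v ∈ K := by
    intro v hv hvab
    rcases hroot K hKA ⟨k, hkK⟩ hKc hKcl with h | h <;> rcases hvab with rfl | rfl
    exacts [h, hKcl a h v hv hab, hKcl b h v hv hab.symm, h]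
  have hall : (U \ {s, t}) \ B ⊆ K := by
    intro v hv
    obtain ⟨K', hKA', hvK', hKc', hKcl'⟩ := exists_component G hv
    obtain ⟨r, hr, hrK'⟩ : ∃ r, (r = a ∨ r = b) ∧ r ∈ K' := by
      rcases hroot K' hKA' ⟨v, hvK'⟩ hKc' hKcl' with h | h
      exacts [⟨a, Or.inl rfl, h⟩, ⟨b, Or.inr rfl, h⟩]
    exact hKc'.induction hrK' (P := fun x => x ∈ K) (hab' r (hKA' hrK') hr)
      (fun x _ y hy hxy hx => hKcl x hx y (hKA' hy) hxy) v hvK'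
  -- If `K` does not see `t`, then `B ∪ {t}` is a part attached at `s` alone, again excluded by
  -- `hone`.
  have final : ∀ s t : V, s ∈ U → t ∈ U → s ≠ t → s ∉ B → (∃ u ∈ B, G.Adj u t) →
      (∀ v ∈ U, v ∉ B → v ≠ s → v ≠ t → v ∈ K) → s ∉ K → t ∉ K →
      (∀ u ∈ B, ∀ v ∈ U \ B, G.Adj u v → v = s ∨ v = t) →
      (∀ u ∈ K, ¬ G.Adj u t) → False := by
    intro s t hs ht hst hsB hBt hall hsK htK hcut hKt
    obtain ⟨u, hu, hut⟩ := hBt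
    have hsub : B ∪ {t} ⊆ U :=
      Set.union_subset (hBU.trans Set.sdiff_subset) (Set.singleton_subset_iff.2 ht)
    have hrt : a ≠ t ∧ b ≠ t := by
      rcases hroot K hKA ⟨k, hkK⟩ hKc hKcl with h | h
      · exact ⟨fun e => htK (e ▸ h), fun e => hKt a h (e ▸ hab)⟩
      · exact ⟨fun e => hKt b h (e ▸ hab.symm), fun e => htK (e ▸ h)⟩
    refine hone (B ∪ {t}) hsub ⟨u, Or.inl hu⟩ (hB.union (conn_singleton t) hu rfl (Or.inr hut))
      (fun h => h.elim ha hrt.1) (fun h => h.elim hb hrt.2) s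
      ⟨hs, fun h => h.elim hsB hst⟩ ?_
    rintro x (hx | hx) y hy hxy
    · refine (hcut x hx y ⟨hy.1, fun h => hy.2 (Or.inl h)⟩ hxy).resolve_right fun e => ?_
      exact hy.2 (Or.inr e)
    · by_contra hys
      rw [Set.mem_singleton_iff] at hx
      rw [hx] at hxy
      exact hKt y (hall y hy.1 (fun h => hy.2 (Or.inl h)) hys fun e => hy.2 (Or.inr e)) hxy.symm
  have hsB : s ∉ B := fun h => (mem.1 (hBU h)).2.1 rfl
  have htB : t ∉ B := fun h => (mem.1 (hBU h)).2.2 rfl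
  have hsK : s ∉ K := fun h => (mem.1 (hKA h).1).2.1 rfl
  have htK : t ∉ K := fun h => (mem.1 (hKA h).1).2.2 rfl
  rcases hcon K hKA hKc with h | h
  · exact final t s ht hs hst.symm htB hBs
      (fun v hv h1 h2 h3 => hall ⟨mem.2 ⟨hv, h3, h2⟩, h1⟩) htK hsK
      (fun u hu v hv huv => (hcut u hu v hv huv).symm) h
  · exact final s t hs ht hst hsB hBt
      (fun v hv h1 h2 h3 => hall ⟨mem.2 ⟨hv, h2, h3⟩, h1⟩) hsK htK hcut h

/-- Every `K_{3,3}`-minor-free graph has a bag drawing rooted at a given edge. -/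
theorem bagDrawable [Finite V] (hG : LivesIn G U) (hfree : ¬ HasK33 G) (hab : G.Adj a b) :
    BagDrawable G U a b := by
  induction hn : U.ncard using Nat.strong_induction_on generalizing G U a b with
  | _ n ih =>
    subst hn
    have ih' : ∀ (G' : SimpleGraph V) (U' : Set V) (a' b' : V), U'.ncard < U.ncard → LivesIn G' U' →
        ¬ HasK33 G' → G'.Adj a' b' → BagDrawable G' U' a' b' :=
      fun G' U' a' b' hlt h1 h2 h3 => ih _ hlt h1 h2 h3 rfl
    have haU := hG hab
    have hbU := hG.right hab
    by_cases hone : ∀ B ⊆ U, B.Nonempty → Conn G B → a ∉ B → b ∉ B → ∀ s ∈ U \ B,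
        ¬ ∀ u ∈ B, ∀ v ∈ U \ B, G.Adj u v → v = s
    swap
    · push Not at hone
      obtain ⟨B, h1, h2, h3, h4, h5, s, h6, h7⟩ := hone
      exact bagDrawable_of_one_cut hG hfree hab ih' h1 h2 h3 h4 h5 h6 h7
    by_cases hconn : ∀ s t, Conn G (U \ {s, t})
    · by_cases h5 : U.ncard = 5 ∧ ∀ u ∈ U, ∀ v ∈ U, u ≠ v → G.Adj u v
      · exact bagDrawable_five hG hfree hab h5.1 h5.2
      · have hroot : RootedGraph G U a b ∅ := ⟨hG, hfree, hconn, h5, by simp, by simp, by simp, by simp,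
          hab, by simp, by simp, by simpa using hconn a b⟩
        obtain ⟨p, T, h1, h2, h3, h4⟩ := hroot.drawable
        exact ⟨p, T, h1, h2, h3, fun u hu v hv w _ huv _ => Or.inl (h4 hu hv huv)⟩
    push Not at hconn
    obtain ⟨s, t, hconn⟩ := hconn
    unfold Conn at hconn
    push Not at hconn
    obtain ⟨M, hM, hMne, hNne, hMN⟩ := hconn
    -- The adjacent roots are not on different sides of the separation, so one side contains
    -- neither.
    obtain ⟨N, hNU, hNne, hne, haN, hbN, hNcl⟩ : ∃ N ⊆ U \ {s, t}, N.Nonempty ∧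
        ((U \ {s, t}) \ N).Nonempty ∧ a ∉ N ∧ b ∉ N ∧
        ∀ u ∈ N, ∀ v ∈ (U \ {s, t}) \ N, ¬ G.Adj u v := by
      by_cases h : a ∈ M ∨ b ∈ M
      · have e : (U \ {s, t}) \ ((U \ {s, t}) \ M) = M := by
          rw [Set.sdiff_sdiff_right_self]; exact Set.inter_eq_self_of_subset_right hM
        refine ⟨(U \ {s, t}) \ M, Set.sdiff_subset, hNne, by rwa [e], fun haN => ?_, fun hbN => ?_, ?_⟩
        · rcases h with h | h
          exacts [haN.2 h, hMN b h a haN hab.symm]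
        · rcases h with h | h
          exacts [hMN a h b hbN hab, hbN.2 h]
        · rw [e]
          exact fun u hu v hv huv => hMN v hv u hu huv.symm
      · rw [not_or] at h
        exact ⟨M, hM, hMne, hNne, h.1, h.2, hMN⟩
    obtain ⟨w, hw⟩ := hNne
    obtain ⟨B, hBN, hwB, hB, hBcl⟩ := exists_component G hw
    have hBU : B ⊆ U \ {s, t} := hBN.trans hNU
    have hcut : ∀ u ∈ B, ∀ v ∈ U \ B, G.Adj u v → v = s ∨ v = t := by
      intro u hu v hv huv
      by_contra! h
      by_cases hvN : v ∈ N
      · exact hv.2 (hBcl u hu v hvN huv)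
      · exact hNcl u (hBN hu) v ⟨⟨hv.1, by simp [h.1, h.2]⟩, hvN⟩ huv
    have haB : a ∉ B := fun h => haN (hBN h)
    have hbB : b ∉ B := fun h => hbN (hBN h)
    have hatt : ∀ s t, (∀ u ∈ B, ∀ v ∈ U \ B, G.Adj u v → v = s ∨ v = t) → t ∉ B →
        ∃ u ∈ B, G.Adj u s := by
      intro s t hcut htB
      by_contra! h
      have hct : ∀ u ∈ B, ∀ v ∈ U \ B, G.Adj u v → v = t := fun u hu v hv huv =>
        (hcut u hu v hv huv).resolve_left fun e => h u hu (e ▸ huv)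
      by_cases htU : t ∈ U
      · exact hone B (hBU.trans Set.sdiff_subset) ⟨w, hwB⟩ hB haB hbB t ⟨htU, htB⟩ hct
      · exact hone B (hBU.trans Set.sdiff_subset) ⟨w, hwB⟩ hB haB hbB a ⟨haU, haB⟩
          fun u hu v hv huv => absurd (hct u hu v hv huv ▸ hv.1) htU
    have hsB : s ∉ B := fun h => (hBU h).2 (by simp)
    have htB : t ∉ B := fun h => (hBU h).2 (by simp)
    have hBs := hatt s t hcut htB
    have hBt := hatt t s (fun u hu v hv huv => (hcut u hu v hv huv).symm) hsB
    have hsU : s ∈ U := by obtain ⟨u, -, h⟩ := hBs; exact hG.right h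
    have htU : t ∈ U := by obtain ⟨u, -, h⟩ := hBt; exact hG.right h
    have hst : s ≠ t := by
      rintro rfl
      exact hone B (hBU.trans Set.sdiff_subset) ⟨w, hwB⟩ hB haB hbB s ⟨hsU, hsB⟩
        fun u hu v hv huv => (hcut u hu v hv huv).elim id id
    obtain ⟨K, k1, k2, k3, k4, k5⟩ := exists_joining_set hab haU hbU hone hsU htU hst hBU hB haB hbB hcut
      hBs hBt (hne.mono fun v hv => ⟨hv.1, fun h => hv.2 (hBN h)⟩)
    exact bagDrawable_of_two_cut hG hfree hab ih' hsU htU hst hBU hB haB hbB hcut hBs hBt k1 k2 k3 k4 k5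

end BagDrawings

end RectilinearCrossing


namespace RectilinearCrossing

/-! ### The bound `3n - 5` on the number of edges. -/

section EdgeBound

variable {V : Type*} {G : SimpleGraph V} {U : Set V}

lemma sum_ncard_neighborSet [Fintype V] (G : SimpleGraph V) :
    ∑ v, (G.neighborSet v).ncard = 2 * G.edgeSet.ncard := by
  classical
  have h := G.sum_degrees_eq_twice_card_edges
  have h1 : G.edgeSet.ncard = G.edgeFinset.card := by
    rw [SimpleGraph.edgeFinset, Set.ncard_eq_toFinset_card']
  rw [h1, ← h]
  refine Finset.sum_congr rfl fun v _ => ?_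
  rw [Set.ncard_eq_toFinset_card', ← SimpleGraph.card_neighborSet_eq_degree, Set.toFinset_card]

lemma mul_ncard_le [Finite V] {k : ℕ} (h : ∀ v ∈ U, k ≤ (G.neighborSet v).ncard) :
    k * U.ncard ≤ 2 * G.edgeSet.ncard := by
  classical
  have := Fintype.ofFinite V
  rw [← sum_ncard_neighborSet, Set.ncard_eq_toFinset_card', mul_comm, ← smul_eq_mul,
    ← Finset.sum_const]
  exact (Finset.sum_le_sum fun v hv => h v (by simpa using hv)).trans
    (Finset.sum_le_sum_of_subset (Finset.subset_univ _))

lemma two_mul_edges_le [Finite V] (hG : LivesIn G U) {k : ℕ}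
    (h : ∀ v ∈ U, (G.neighborSet v).ncard ≤ k) : 2 * G.edgeSet.ncard ≤ k * U.ncard := by
  classical
  have := Fintype.ofFinite V
  rw [← sum_ncard_neighborSet, Set.ncard_eq_toFinset_card' U, mul_comm, ← smul_eq_mul,
    ← Finset.sum_const]
  rw [← Finset.sum_subset (Finset.subset_univ U.toFinset)]
  · exact Finset.sum_le_sum fun v hv => h v (by simpa using hv)
  · intro v _ hv
    rw [Set.ncard_eq_zero (Set.toFinite _), Set.eq_empty_iff_forall_notMem]
    intro u hu
    exact hv (by simpa using hG hu)

/-- Contracting an edge destroys it and one edge of each triangle that contains it. -/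
lemma ncard_edgeSet_le_contract [Finite V] {x y : V} (hxy : G.Adj x y) :
    G.edgeSet.ncard ≤ (contract G x y).edgeSet.ncard + 1 + {c | G.Adj x c ∧ G.Adj y c}.ncard := by
  classical
  set C := {c | G.Adj x c ∧ G.Adj y c} with hC
  -- Apart from `xy` and the edges `yc` to common neighbours, renaming `y` to `x` is injective on
  -- edges.
  let I : Set (Sym2 V) := (fun c => s(y, c)) '' C
  let F : Set (Sym2 V) := G.edgeSet \ ({s(x, y)} ∪ I)
  have h1 : G.edgeSet.ncard ≤ F.ncard + (1 + C.ncard) := by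
    calc G.edgeSet.ncard ≤ (F ∪ ({s(x, y)} ∪ I)).ncard :=
          Set.ncard_le_ncard (by rw [Set.sdiff_union_self]; exact Set.subset_union_left)
            (Set.toFinite _)
      _ ≤ F.ncard + ({s(x, y)} ∪ I).ncard := Set.ncard_union_le _ _
      _ ≤ F.ncard + (1 + C.ncard) := by
          have := Set.ncard_union_le {s(x, y)} I
          rw [Set.ncard_singleton] at this
          have := Set.ncard_image_le (f := fun c => s(y, c)) (Set.toFinite C)
          simp only [I] at *
          omega
  let ρ : V → V := fun v => if v = y then x else v
  have ρy : ρ y = x := if_pos rfl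
  have ρn : ∀ {v}, v ≠ y → ρ v = v := fun hv => if_neg hv
  have cls : ∀ e ∈ F, (∃ u v, e = s(u, v) ∧ G.Adj u v ∧ u ≠ y ∧ v ≠ y) ∨
      ∃ v, e = s(y, v) ∧ G.Adj y v ∧ v ≠ x ∧ ¬ G.Adj x v := by
    intro e he
    induction e using Sym2.ind with
    | _ u v =>
      obtain ⟨huv, hn⟩ := he
      have huv : G.Adj u v := huv
      have key : ∀ w, G.Adj y w → s(y, w) ∉ ({s(x, y)} ∪ I : Set (Sym2 V)) → w ≠ x ∧ ¬ G.Adj x w := by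
        intro w hw hn
        refine ⟨fun e => hn (Or.inl (by rw [e, Sym2.eq_swap]; rfl)), fun h => hn (Or.inr ⟨w, ⟨h, hw⟩, rfl⟩)⟩
      by_cases hu : u = y
      · rw [hu] at huv hn
        exact Or.inr ⟨v, by rw [hu], huv, key v huv hn⟩
      by_cases hv : v = y
      · rw [hv] at huv hn
        rw [Sym2.eq_swap (a := u)] at hn
        exact Or.inr ⟨u, by rw [hv, Sym2.eq_swap], huv.symm, key u huv.symm hn⟩
      · exact Or.inl ⟨u, v, rfl, huv, hu, hv⟩
  have h2 : F.ncard ≤ (contract G x y).edgeSet.ncard := by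
    refine Set.ncard_le_ncard_of_injOn (Sym2.map ρ) ?_ ?_ (Set.toFinite _)
    · intro e he
      rcases cls e he with ⟨u, v, rfl, huv, hu, hv⟩ | ⟨v, rfl, huv, hvx, -⟩
      · rw [Sym2.map_mk, ρn hu, ρn hv]
        exact contract_adj_of huv hu hv
      · rw [Sym2.map_mk, ρy, ρn huv.ne.symm]
        exact ⟨hvx.symm, hxy.ne, huv.ne.symm, Or.inr (Or.inl ⟨rfl, huv⟩)⟩
    · intro e he e' he' hee
      rcases cls e he with ⟨u, v, rfl, huv, hu, hv⟩ | ⟨v, rfl, huv, hvx, hn⟩ <;>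
      rcases cls e' he' with ⟨u', v', rfl, huv', hu', hv'⟩ | ⟨v', rfl, huv', hvx', hn'⟩
      · simpa only [Sym2.map_mk, ρn hu, ρn hv, ρn hu', ρn hv'] using hee
      · simp only [Sym2.map_mk, ρn hu, ρn hv, ρy, ρn huv'.ne.symm] at hee
        exact absurd (show G.Adj x v' by rw [← SimpleGraph.mem_edgeSet, ← hee]; exact huv) hn'
      · simp only [Sym2.map_mk, ρn hu', ρn hv', ρy, ρn huv.ne.symm] at hee
        exact absurd (show G.Adj x v by rw [← SimpleGraph.mem_edgeSet, hee]; exact huv') hn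
      · simp only [Sym2.map_mk, ρy, ρn huv.ne.symm, ρn huv'.ne.symm, Sym2.congr_right] at hee
        rw [hee]
  omega

lemma exists_subgraph_ncard [Finite V] (G : SimpleGraph V) {k : ℕ} (hk : k ≤ G.edgeSet.ncard) :
    ∃ H ≤ G, H.edgeSet.ncard = k := by
  obtain ⟨E, hE, hEk⟩ := Set.exists_subset_card_eq hk
  refine ⟨SimpleGraph.fromEdgeSet E, ?_, ?_⟩
  · rw [← SimpleGraph.edgeSet_subset_edgeSet, SimpleGraph.edgeSet_fromEdgeSet]
    exact Set.sdiff_subset.trans hE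
  · rw [SimpleGraph.edgeSet_fromEdgeSet, Disjoint.sdiff_eq_left, hEk]
    rw [Set.disjoint_left]
    exact fun e he hd => G.not_isDiag_of_mem_edgeSet (hE he) hd

/-- In five vertices that each miss at most one other, two of them see the other three. -/
lemma exists_pair_of_five [Finite V] {N : Set V} (h5 : N.ncard = 5)
    (hN : ∀ u ∈ N, 3 ≤ {c ∈ N | G.Adj u c}.ncard) :
    ∃ s ∈ N, ∃ t ∈ N, s ≠ t ∧ ∀ c ∈ N, c ≠ s → c ≠ t → G.Adj s c ∧ G.Adj t c := by
  -- At most one other vertex is missed by each `u`, so a nonadjacent pair sees everything else; if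
  -- there is none, any pair will do.
  have miss : ∀ u ∈ N, ∀ s ∈ N, ∀ t ∈ N, s ≠ u → t ≠ u → ¬ G.Adj u s → ¬ G.Adj u t → s = t := by
    intro u hu s hs t ht hsu htu h1 h2
    by_contra hst
    have hsub : {c ∈ N | G.Adj u c} ∪ {u, s, t} ⊆ N := by
      refine Set.union_subset (fun c hc => hc.1) ?_
      rintro c (rfl | rfl | rfl) <;> assumption
    have hd : Disjoint {c ∈ N | G.Adj u c} {u, s, t} := by
      rw [Set.disjoint_right]
      rintro c (rfl | rfl | rfl) h
      exacts [G.loopless.irrefl _ h.2, h1 h.2, h2 h.2]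
    have h3 : ({u, s, t} : Set V).ncard = 3 :=
      Set.ncard_eq_three.2 ⟨u, s, t, hsu.symm, htu.symm, hst, rfl⟩
    have := Set.ncard_le_ncard hsub (Set.toFinite N)
    rw [Set.ncard_union_eq hd (Set.toFinite _) (Set.toFinite _), h3] at this
    have := hN u hu
    omega
  by_cases h : ∃ s ∈ N, ∃ t ∈ N, s ≠ t ∧ ¬ G.Adj s t
  · obtain ⟨s, hs, t, ht, hst, hn⟩ := h
    refine ⟨s, hs, t, ht, hst, fun c hc h1 h2 => ⟨?_, ?_⟩⟩
    · by_contra h'; exact h2 (miss s hs c hc t ht h1 hst.symm h' hn)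
    · by_contra h'; exact h1 (miss t ht c hc s hs h2 hst h' fun e => hn e.symm)
  · push Not at h
    obtain ⟨s, hs, t, ht, hst⟩ := (Set.one_lt_ncard_iff_nontrivial (s := N)).1 (by omega)
    exact ⟨s, hs, t, ht, hst, fun c hc h1 h2 => ⟨h s hs c hc h1.symm, h t ht c hc h2.symm⟩⟩

/-- The edge bound in a graph in which every edge is in three triangles. -/
lemma false_of_triangles [Finite V] (hG : LivesIn G U) (hfree : ¬ HasK33 G) (h3 : 3 ≤ U.ncard)
    (hE : G.edgeSet.ncard + 4 = 3 * U.ncard)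
    (ih : ∀ (G' : SimpleGraph V) (U' : Set V), U'.ncard < U.ncard → LivesIn G' U' → ¬ HasK33 G' →
      2 ≤ U'.ncard → G'.edgeSet.ncard + 5 ≤ 3 * U'.ncard)
    (htri : ∀ x y, G.Adj x y → 3 ≤ {c | G.Adj x c ∧ G.Adj y c}.ncard) : False := by
  -- The average degree is below six. With three triangles on every edge, a nonempty neighbourhood
  -- `N` has four or five vertices.
  obtain ⟨v, hvU, hv⟩ : ∃ v ∈ U, (G.neighborSet v).ncard ≤ 5 := by
    by_contra! h
    have := mul_ncard_le (k := 6) (U := U) fun v hv => h v hv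
    omega
  set N := G.neighborSet v with hN
  have hNU : N ⊆ U := fun u hu => hG.right hu
  have hvN : v ∉ N := G.loopless.irrefl v
  have hNN : ∀ u ∈ N, 3 ≤ {c ∈ N | G.Adj u c}.ncard := fun u hu => htri v u hu
  have hNne : N.Nonempty := by
    rw [Set.nonempty_iff_ne_empty]
    intro h0
    have hG' : LivesIn G (U \ {v}) := fun u w huw => ⟨hG huw, by
      rintro rfl
      have : w ∈ N := huw
      rw [h0] at this; exact this⟩
    have hc := Set.ncard_sdiff_singleton_of_mem hvU
    have := ih G (U \ {v}) (by omega) hG' hfree (by omega)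
    omega
  have hN4 : 4 ≤ N.ncard := by
    obtain ⟨u, hu⟩ := hNne
    have hsub : insert u {c ∈ N | G.Adj u c} ⊆ N := Set.insert_subset hu fun c hc => hc.1
    have := Set.ncard_le_ncard hsub (Set.toFinite N)
    rw [Set.ncard_insert_of_notMem (fun h => G.loopless.irrefl u h.2)] at this
    have := hNN u hu
    omega
  have hcase : N.ncard = 5 ∨ N.ncard = 4 := by omega
  rcases hcase with h5 | h4
  · obtain ⟨s, hs, t, ht, hst, hadj⟩ := exists_pair_of_five h5 hNN
    have hrest : (N \ {s, t}).ncard = 3 := by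
      rw [Set.ncard_sdiff (by rintro c (rfl | rfl) <;> assumption) (Set.toFinite _), h5,
        Set.ncard_pair hst]
    obtain ⟨x, y, z, hxy, hxz, hyz, hR⟩ := Set.ncard_eq_three.1 hrest
    have hR' : ∀ c ∈ [x, y, z], c ∈ N ∧ c ≠ s ∧ c ≠ t := by
      intro c hc
      have : c ∈ N \ {s, t} := by rw [hR]; simpa using hc
      exact ⟨this.1, by simpa [not_or] using this.2⟩
    refine hfree (HasK33.of_three (conn_singleton v) (conn_singleton s) (conn_singleton t)
      (by simpa using fun e : v = s => hvN (e ▸ hs)) (by simpa using fun e : v = t => hvN (e ▸ ht))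
      (by simpa using hst) hxy hxz hyz ?_)
    intro S hS c hc
    obtain ⟨c1, c2, c3⟩ := hR' c hc
    simp only [List.mem_cons, List.not_mem_nil, or_false] at hS
    rcases hS with rfl | rfl | rfl
    · exact ⟨fun e => hvN ((Set.mem_singleton_iff.1 e) ▸ c1), v, rfl, c1⟩
    · exact ⟨c2, s, rfl, (hadj c c1 c2 c3).1⟩
    · exact ⟨c3, t, rfl, (hadj c c1 c2 c3).2⟩
  · have hK : ∀ u ∈ N, ∀ w ∈ N, u ≠ w → G.Adj u w := by
      intro u hu w hw huw
      by_contra hn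
      have hsub : {c ∈ N | G.Adj u c} ∪ {u, w} ⊆ N := by
        refine Set.union_subset (fun c hc => hc.1) ?_
        rintro c (rfl | rfl) <;> assumption
      have hd : Disjoint {c ∈ N | G.Adj u c} {u, w} := by
        rw [Set.disjoint_right]
        rintro c (rfl | rfl) h
        exacts [G.loopless.irrefl _ h.2, hn h.2]
      have := Set.ncard_le_ncard hsub (Set.toFinite N)
      rw [Set.ncard_union_eq hd (Set.toFinite _) (Set.toFinite _), Set.ncard_pair huw] at this
      have := hNN u hu
      omega
    have hNv : (insert v N).ncard = 5 := by rw [Set.ncard_insert_of_notMem hvN, h4]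
    -- `v` and `N` span a `K₅`. If this is everything, there are at most ten edges, but `3 * 5 - 4 =
    -- 11`.
    by_cases hU : U ⊆ insert v N
    · have hUc := Set.ncard_le_ncard hU (Set.toFinite _)
      have h2 := two_mul_edges_le hG (k := U.ncard - 1) fun u hu => by
        have hsub : G.neighborSet u ⊆ U \ {u} := fun w hw => ⟨hG.right hw, fun e => by
          rw [Set.mem_singleton_iff] at e
          exact G.loopless.irrefl u (e ▸ hw)⟩
        have := Set.ncard_le_ncard hsub (Set.toFinite _)
        rwa [Set.ncard_sdiff_singleton_of_mem hu] at this
      have hUc' := Set.ncard_le_ncard (Set.insert_subset hvU hNU) (Set.toFinite U)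
      have : U.ncard = 5 := by omega
      rw [this] at h2 hE
      omega
    · obtain ⟨w, hwU, hw⟩ := Set.not_subset.1 hU
      obtain ⟨D, hDU, hwD, hD, hDcl⟩ := exists_component G
        (show w ∈ U \ insert v N from ⟨hwU, hw⟩)
      have hDN : ∀ d ∈ D, d ∉ N := fun d hd h => (hDU hd).2 (Or.inr h)
      have hDv : v ∉ D := fun h => (hDU h).2 (Or.inl rfl)
      have hDout : ∀ d ∈ D, ∀ u, G.Adj d u → u ∉ D → u ∈ N := by
        intro d hd u hdu huD
        by_contra huN
        refine huD (hDcl d hd u ⟨hG.right hdu, ?_⟩ hdu)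
        rintro (rfl | h)
        · exact hDN d hd hdu.symm
        · exact huN h
      -- A component seeing three vertices of `N` gives a `K_{3,3}` minor with `v` and the fourth
      -- vertex `r` of `N`.
      by_cases hatt : 3 ≤ {u ∈ N | ∃ d ∈ D, G.Adj d u}.ncard
      · obtain ⟨A, hA, hA3⟩ := Set.exists_subset_card_eq hatt
        obtain ⟨x, y, z, hxy, hxz, hyz, hR⟩ := Set.ncard_eq_three.1 hA3
        have hAN : A ⊆ N := fun u hu => (hA hu).1
        have hrest : (N \ A).ncard = 1 := by
          rw [Set.ncard_sdiff hAN (Set.toFinite _), h4, hA3]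
        obtain ⟨r, hr⟩ := Set.ncard_eq_one.1 hrest
        have hrN : r ∈ N \ A := by rw [hr]; rfl
        refine hfree (HasK33.of_three (conn_singleton v) (conn_singleton r) hD
          (by simpa using fun e : v = r => hvN (e ▸ hrN.1)) (by simpa using hDv)
          (by simpa using fun h => hDN r h hrN.1) hxy hxz hyz ?_)
        intro S hS c hc
        have hcA : c ∈ A := by rw [hR]; simpa using hc
        simp only [List.mem_cons, List.not_mem_nil, or_false] at hS
        rcases hS with rfl | rfl | rfl
        · exact ⟨fun e => hvN ((Set.mem_singleton_iff.1 e) ▸ hAN hcA), v, rfl, hAN hcA⟩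
        · have hcr : c ≠ r := fun e => hrN.2 (e ▸ hcA)
          exact ⟨hcr, r, rfl, hK r hrN.1 c (hAN hcA) hcr.symm⟩
        · exact ⟨fun h => hDN c h (hAN hcA), (hA hcA).2⟩
      -- Otherwise its attachments fit into a pair `A` of adjacent vertices. The two pieces share
      -- the edge on `A`, so there are at most `(3(n - d) - 5) + (3(d + 2) - 5) - 1 = 3n - 5` edges,
      -- where `d = |D|`.
      · obtain ⟨A, hA1, hA2, hA3⟩ := Set.exists_subsuperset_card_eq
          (show {u ∈ N | ∃ d ∈ D, G.Adj d u} ⊆ N from fun u hu => hu.1) (n := 2) (by omega) (by omega)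
        obtain ⟨s, t, hst, hAst⟩ := Set.ncard_eq_two.1 hA3
        have hsA : s ∈ A := by simp [hAst]
        have htA : t ∈ A := by simp [hAst]
        have hDA : Disjoint D A := Set.disjoint_left.2 fun d hd h => hDN d hd (hA2 h)
        have hDU' : D ⊆ U := hDU.trans Set.sdiff_subset
        have hDne : 0 < D.ncard := (Set.ncard_pos (Set.toFinite D)).2 ⟨w, hwD⟩
        have c1 : (U \ D).ncard = U.ncard - D.ncard := Set.ncard_sdiff hDU' (Set.toFinite _)
        have c2 : (D ∪ A).ncard = D.ncard + 2 := by
          rw [Set.ncard_union_eq hDA (Set.toFinite _) (Set.toFinite _), hA3]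
        have c3 : 5 ≤ (U \ D).ncard := by
          rw [← hNv]
          refine Set.ncard_le_ncard ?_ (Set.toFinite _)
          rintro u (rfl | hu)
          · exact ⟨hvU, hDv⟩
          · exact ⟨hNU hu, fun h => hDN u h hu⟩
        have e1 := ih (restr G (U \ D)) (U \ D) (by omega) restr_livesIn
          (fun h => hfree (h.mono restr_le)) (by omega)
        have e2 := ih (restr G (D ∪ A)) (D ∪ A) (by omega) restr_livesIn
          (fun h => hfree (h.mono restr_le)) (by omega)
        have hcov : G.edgeSet ⊆ (restr G (U \ D)).edgeSet ∪ (restr G (D ∪ A)).edgeSet := by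
          intro e he
          induction e using Sym2.ind with
          | _ x y =>
            have hxy : G.Adj x y := he
            have side : ∀ x y, G.Adj x y → x ∈ D → y ∈ D ∪ A := by
              intro x y hxy hx
              by_cases hy : y ∈ D
              · exact Or.inl hy
              · exact Or.inr (hA1 ⟨hDout x hx y hxy hy, x, hx, hxy⟩)
            by_cases hx : x ∈ D
            · exact Or.inr ⟨hxy, Or.inl hx, side x y hxy hx⟩
            by_cases hy : y ∈ D
            · exact Or.inr ⟨hxy, side y x hxy.symm hy, Or.inl hy⟩
            · exact Or.inl ⟨hxy, ⟨hG hxy, hx⟩, hG.right hxy, hy⟩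
        have hcommon : 1 ≤ ((restr G (U \ D)).edgeSet ∩ (restr G (D ∪ A)).edgeSet).ncard := by
          refine (Set.ncard_pos (Set.toFinite _)).2 ⟨s(s, t), ?_, ?_⟩
          · exact ⟨hK s (hA2 hsA) t (hA2 htA) hst, ⟨hNU (hA2 hsA), fun h => hDN s h (hA2 hsA)⟩,
              hNU (hA2 htA), fun h => hDN t h (hA2 htA)⟩
          · exact ⟨hK s (hA2 hsA) t (hA2 htA) hst, Or.inr hsA, Or.inr htA⟩
        have hun := Set.ncard_union_add_ncard_inter (restr G (U \ D)).edgeSet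
          (restr G (D ∪ A)).edgeSet (Set.toFinite _) (Set.toFinite _)
        have hle := Set.ncard_le_ncard hcov (Set.toFinite _)
        omega

/-- A `K_{3,3}`-minor-free graph with `n ≥ 2` vertices has at most `3 n - 5` edges. -/
theorem ncard_edgeSet_add_five_le [Finite V] (hG : LivesIn G U) (hfree : ¬ HasK33 G)
    (hU : 2 ≤ U.ncard) : G.edgeSet.ncard + 5 ≤ 3 * U.ncard := by
  induction hn : U.ncard using Nat.strong_induction_on generalizing G U with
  | _ n ih =>
    subst hn
    by_contra! hlt
    rcases Nat.eq_or_lt_of_le hU with h2 | h3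
    · obtain ⟨s, t, hst, rfl⟩ := Set.ncard_eq_two.1 h2.symm
      have hsub : G.edgeSet ⊆ {s(s, t)} := by
        intro e he
        induction e using Sym2.ind with
        | _ x y =>
          have hxy : G.Adj x y := he
          have hne := hxy.ne
          rcases hG hxy with rfl | rfl <;> rcases hG.right hxy with rfl | rfl
          · exact absurd rfl hne
          · rfl
          · rw [Sym2.eq_swap]; rfl
          · exact absurd rfl hne
      have := Set.ncard_le_ncard hsub (Set.toFinite _)
      rw [Set.ncard_singleton] at this
      omega
    -- With exactly `3n - 4` edges, contracting an edge must lose at least four of them to satisfy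
    -- the bound for `n - 1`; so the edge is in at least three triangles.
    · obtain ⟨H, hHG, hHE⟩ := exists_subgraph_ncard G (k := 3 * U.ncard - 4) (by omega)
      have hH : LivesIn H U := fun u v huv => hG (hHG huv)
      have hHfree : ¬ HasK33 H := fun h => hfree (h.mono hHG)
      refine false_of_triangles hH hHfree h3 (by omega)
        (fun G' U' hlt h1 h2 h3 => ih _ hlt h1 h2 h3 rfl) fun x y hxy => ?_
      have h1 := ncard_edgeSet_le_contract hxy
      have hc := Set.ncard_sdiff_singleton_of_mem (hH.right hxy)
      have h2 := ih _ (by omega) (contract_livesIn hH (hH hxy)) (fun h => hHfree (h.of_contract hxy))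
        (by omega) hc
      omega

end EdgeBound

end RectilinearCrossing


namespace RectilinearCrossing

/-! ### From the placement to a rectilinear drawing with few crossings. -/

section FinalDrawing

lemma eq_of_mem_segments_of_common_end {a b c m : ℝ × ℝ} (hD : det3 a b c ≠ 0)
    (h1 : m ∈ segment ℝ a b) (h2 : m ∈ segment ℝ a c) : m = a := by
  have h3 := det3_eq_zero_of_mem_segment h1
  obtain ⟨t, -, -, e1, e2⟩ := mem_seg.1 h2
  have h4 : det3 a b m = t * det3 a b c := by
    rw [det3_comb₃ a b m e1 e2]
    have : det3 a b a = 0 := by unfold det3; ring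
    rw [this]; ring
  have ht : t = 0 := (mul_eq_zero.1 (h4.symm.trans h3)).resolve_right hD
  rw [ht] at e1 e2
  exact Prod.ext (by linarith) (by linarith)

lemma eq_of_mem_segments {a b c d m m' : ℝ × ℝ} (hD : det3 a b c ≠ 0) (h1 : m ∈ segment ℝ a b)
    (h2 : m ∈ segment ℝ c d) (h1' : m' ∈ segment ℝ a b) (h2' : m' ∈ segment ℝ c d) : m = m' := by
  have h3 := det3_eq_zero_of_mem_segment h1
  have h3' := det3_eq_zero_of_mem_segment h1'
  obtain ⟨t, -, -, e1, e2⟩ := mem_seg.1 h2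
  obtain ⟨t', -, -, e1', e2'⟩ := mem_seg.1 h2'
  rw [det3_comb₃ a b m e1 e2] at h3
  rw [det3_comb₃ a b m' e1' e2'] at h3'
  have h4 : (t - t') * det3 a b c = 0 := by
    linear_combination t * h3' - t' * h3
  have ht : t = t' := by
    have := (mul_eq_zero.1 h4).resolve_right hD
    linarith
  rw [ht] at e1 e2
  exact Prod.ext (by linarith) (by linarith)

/-- The coordinate plane as the Euclidean plane. -/
noncomputable def toPlane : (ℝ × ℝ) ≃ₗ[ℝ] Plane :=
  (LinearEquiv.finTwoArrow ℝ ℝ).symm.trans (WithLp.linearEquiv 2 ℝ (Fin 2 → ℝ)).symm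

variable {V : Type*} {G : SimpleGraph V}

lemma mem_edgeSegment {p : V → ℝ × ℝ} {u v : V} {x : Plane} :
    x ∈ edgeSegment (fun v => toPlane (p v)) s(u, v) ↔ toPlane.symm x ∈ segment ℝ (p u) (p v) := by
  have h := image_segment ℝ toPlane.toLinearMap.toAffineMap (p u) (p v)
  simp only [LinearMap.coe_toAffineMap, LinearEquiv.coe_coe] at h
  change x ∈ segment ℝ (toPlane (p u)) (toPlane (p v)) ↔ _
  rw [← h]
  constructor
  · rintro ⟨m, hm, rfl⟩
    simpa using hm
  · exact fun hm => ⟨_, hm, by simp⟩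

section Generic

variable {p : V → ℝ × ℝ}

lemma Generic.injective (hp : Generic p) : Function.Injective p := fun i j hij => by
  by_contra h
  exact hp.1 i j h (by rw [hij])

lemma Generic.eq_of_mem (hp : Generic p) {u w v : V} (huw : u ≠ w)
    (h : p v ∈ segment ℝ (p u) (p w)) : v = u ∨ v = w := by
  by_contra! hn
  exact hp.2.1 u w v huw hn.1.symm hn.2.symm (det3_eq_zero_of_mem_segment h)

/-- Two edges with a common end meet only there. -/
lemma Generic.eq_of_mem_of_common (hp : Generic p) {e f : Sym2 V} (he : e ∈ G.edgeSet)
    (hf : f ∈ G.edgeSet) (hef : e ≠ f) {v : V} (hve : v ∈ e) (hvf : v ∈ f) {x : Plane}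
    (hx : x ∈ edgeSegment (fun v => toPlane (p v)) e)
    (hx' : x ∈ edgeSegment (fun v => toPlane (p v)) f) : toPlane (p v) = x := by
  obtain ⟨w, rfl⟩ := hve
  obtain ⟨w', rfl⟩ := hvf
  have he : G.Adj v w := he
  have hf : G.Adj v w' := hf
  rw [mem_edgeSegment] at hx hx'
  have hww : w ≠ w' := fun h => hef (by rw [h])
  rw [← eq_of_mem_segments_of_common_end (hp.2.1 v w w' he.ne hf.ne hww) hx hx']
  simp

/-- A placement in general position is a rectilinear drawing. -/
noncomputable def Generic.drawing (hp : Generic p) (G : SimpleGraph V) : RectilinearDrawing G where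
  pos v := toPlane (p v)
  pos_injective := toPlane.injective.comp hp.injective
  mem_of_pos_mem := by
    intro e he v hv
    induction e using Sym2.ind with
    | _ u w =>
      have he : G.Adj u w := he
      rw [mem_edgeSegment, LinearEquiv.symm_apply_apply] at hv
      exact Sym2.mem_iff.2 (hp.eq_of_mem he.ne hv)
  no_three := by
    rintro e₁ h₁ e₂ h₂ e₃ h₃ h₁₂ h₁₃ h₂₃ x ⟨⟨x₁, x₂⟩, x₃⟩
    have hmem : ∀ e ∈ G.edgeSet, ∀ v, toPlane (p v) ∈ edgeSegment (fun v => toPlane (p v)) e →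
        v ∈ e := by
      intro e he v hv
      induction e using Sym2.ind with
      | _ u w =>
        have he : G.Adj u w := he
        rw [mem_edgeSegment, LinearEquiv.symm_apply_apply] at hv
        exact Sym2.mem_iff.2 (hp.eq_of_mem he.ne hv)
    by_contra hno
    -- The common point is not a vertex, so the three edges have six distinct ends, and general
    -- position forbids their concurrence.
    have hvert : ∀ v, toPlane (p v) ≠ x := by
      rintro v rfl
      exact hno ⟨v, hmem e₁ h₁ v x₁, hmem e₂ h₂ v x₂, hmem e₃ h₃ v x₃, rfl⟩
    have d₁₂ : ∀ v, v ∈ e₁ → v ∉ e₂ := fun v h h' =>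
      hvert v (hp.eq_of_mem_of_common h₁ h₂ h₁₂ h h' x₁ x₂)
    have d₁₃ : ∀ v, v ∈ e₁ → v ∉ e₃ := fun v h h' =>
      hvert v (hp.eq_of_mem_of_common h₁ h₃ h₁₃ h h' x₁ x₃)
    have d₂₃ : ∀ v, v ∈ e₂ → v ∉ e₃ := fun v h h' =>
      hvert v (hp.eq_of_mem_of_common h₂ h₃ h₂₃ h h' x₂ x₃)
    induction e₁ using Sym2.ind with
    | _ u₁ w₁ =>
    induction e₂ using Sym2.ind with
    | _ u₂ w₂ =>
    induction e₃ using Sym2.ind with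
    | _ u₃ w₃ =>
      have h₁ : G.Adj u₁ w₁ := h₁
      have h₂ : G.Adj u₂ w₂ := h₂
      have h₃ : G.Adj u₃ w₃ := h₃
      rw [mem_edgeSegment] at x₁ x₂ x₃
      have a1 := d₁₂ u₁ (by simp)
      have a2 := d₁₂ w₁ (by simp)
      have b1 := d₁₃ u₁ (by simp)
      have b2 := d₁₃ w₁ (by simp)
      have c1 := d₂₃ u₂ (by simp)
      have c2 := d₂₃ w₂ (by simp)
      have n1 := h₁.ne
      have n2 := h₂.ne
      have n3 := h₃.ne
      simp only [Sym2.mem_iff, not_or] at a1 a2 b1 b2 c1 c2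
      have hs : Function.Injective ![u₁, w₁, u₂, w₂, u₃, w₃] := by
        rw [← List.nodup_ofFn]
        simp [n1, n2, n3, a1, a2, b1, b2, c1, c2]
      exact hp.2.2 _ hs (conc_eq_zero (det3_eq_zero_of_mem_segment x₁)
        (det3_eq_zero_of_mem_segment x₂) (det3_eq_zero_of_mem_segment x₃))

lemma Generic.drawing_pos (hp : Generic p) (G : SimpleGraph V) :
    (hp.drawing G).pos = fun v => toPlane (p v) := rfl

lemma Generic.notMem_of_crossAt (hp : Generic p) {e f : Sym2 V} {x : Plane}
    (h : (hp.drawing G).CrossAt e f x) {v : V} (hve : v ∈ e) : v ∉ f := by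
  intro hvf
  obtain ⟨h1, h2, h3, h4, h5, h6⟩ := h
  rw [hp.drawing_pos] at h4 h5 h6
  exact h6 ⟨v, hve, hvf, hp.eq_of_mem_of_common h1 h2 h3 hve hvf h4 h5⟩

lemma Generic.crossAt_unique (hp : Generic p) {e f : Sym2 V} {x y : Plane}
    (hx : (hp.drawing G).CrossAt e f x) (hy : (hp.drawing G).CrossAt e f y) : x = y := by
  have hn := fun v => hp.notMem_of_crossAt hx (v := v)
  obtain ⟨he, hf, -, x1, x2, -⟩ := hx
  obtain ⟨-, -, -, y1, y2, -⟩ := hy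
  rw [hp.drawing_pos] at x1 x2 y1 y2
  induction e using Sym2.ind with
  | _ u w =>
  induction f using Sym2.ind with
  | _ u' w' =>
    have he : G.Adj u w := he
    have h1 := hn u (by simp)
    have h2 := hn w (by simp)
    simp only [Sym2.mem_iff, not_or] at h1 h2
    rw [mem_edgeSegment] at x1 x2 y1 y2
    exact toPlane.symm.injective (eq_of_mem_segments (hp.2.1 u w u' he.ne h1.1 h2.1) x1 x2 y1 y2)

end Generic

lemma _root_.RectilinearCrossing.RectilinearDrawing.CrossAt.symm {D : RectilinearDrawing G}
    {e f : Sym2 V} {x : Plane} (h : D.CrossAt e f x) : D.CrossAt f e x :=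
  ⟨h.2.1, h.1, h.2.2.1.symm, h.2.2.2.2.1, h.2.2.2.1, fun ⟨v, h1, h2, h3⟩ =>
    h.2.2.2.2.2 ⟨v, h2, h1, h3⟩⟩

/-- A bag drawing, without reference to a root. -/
lemma exists_bag [Fintype V] (hfree : ¬ HasK33 G) :
    ∃ p : V → ℝ × ℝ, PlaneMap G p ∧ FibresLeTwo p Set.univ := by
  by_cases hE : ∃ a b, G.Adj a b
  · obtain ⟨a, b, hab⟩ := hE
    obtain ⟨p, T, h1, -, -, h2⟩ := bagDrawable (U := Set.univ) (fun _ _ _ => trivial) hfree hab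
    exact ⟨p, h1, h2⟩
  -- Without edges there is no root, and any injective placement serves.
  · push Not at hE
    obtain ⟨p, -, hp⟩ := exists_generic (ι := V) isOpen_univ (p := 0) trivial
    exact ⟨p, fun u v _ _ h => absurd h (hE u v), fun u _ v _ w _ h _ => Or.inl (hp.injective h)⟩

/-- A drawing in which crossing edges have ends that are close to each other. -/
lemma exists_drawing [Fintype V] (hfree : ¬ HasK33 G) :
    ∃ (p q : V → ℝ × ℝ) (hq : Generic q), FibresLeTwo p Set.univ ∧
      ∀ e f, (hq.drawing G).Cross e f → ∃ u ∈ e, ∃ z ∈ f, z ≠ u ∧ p u = p z := by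
  obtain ⟨p, h1, h2⟩ := exists_bag hfree
  -- Unlike the earlier perturbations, this one separates twins; only pairs of edges with no common
  -- end position in `p` remain disjoint.
  obtain ⟨q, hqO, hq⟩ := exists_generic (isOpen_planeMap G p) h1
  refine ⟨p, q, hq, h2, fun e f ⟨x, hx⟩ => ?_⟩
  have hn := fun v => hq.notMem_of_crossAt hx (v := v)
  obtain ⟨he, hf, -, x1, x2, -⟩ := hx
  rw [hq.drawing_pos] at x1 x2
  by_contra hcon
  have key : ∀ u ∈ e, ∀ z ∈ f, p u ≠ p z := fun u hu z hz h =>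
    hcon ⟨u, hu, z, hz, fun e => hn u hu (e ▸ hz), h⟩
  induction e using Sym2.ind with
  | _ u v =>
  induction f using Sym2.ind with
  | _ u' v' =>
    exact Set.disjoint_left.1 (hqO u v u' v' he hf (key u (by simp) u' (by simp))
      (key u (by simp) v' (by simp)) (key v (by simp) u' (by simp)) (key v (by simp) v' (by simp)))
      (mem_edgeSegment.1 x1) (mem_edgeSegment.1 x2)

/-- The drawing has few crossings on every edge, and thus few crossings in total. -/
theorem exists_drawing_crossings_le [Fintype V] (hfree : ¬ HasK33 G) {Δ : ℕ}
    (hΔ : ∀ v, (G.incidenceSet v).ncard ≤ Δ) :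
    ∃ D : RectilinearDrawing G, (∀ e ∈ G.edgeSet, {f | D.Cross e f}.ncard ≤ 2 * Δ) ∧
      D.crossings.Finite ∧ D.crossings.ncard ≤ Δ * G.edgeSet.ncard := by
  classical
  obtain ⟨p, q, hq, hfib, hcross⟩ := exists_drawing hfree
  -- `u` has at most one twin `z`, and the edges in question are incident with `z`.
  have hI : ∀ u, {f | f ∈ G.edgeSet ∧ ∃ z ∈ f, z ≠ u ∧ p u = p z}.ncard ≤ Δ := by
    intro u
    by_cases h : ∃ z, z ≠ u ∧ p u = p z
    · obtain ⟨z, hz, hz'⟩ := h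
      refine le_trans (Set.ncard_le_ncard ?_ (Set.toFinite _)) (hΔ z)
      rintro f ⟨hf, z', hz'f, h1, h2⟩
      rcases hfib u trivial z trivial z' trivial hz' h2 with e | e | e
      · exact absurd e.symm hz
      · exact absurd e.symm h1
      · exact ⟨hf, e ▸ hz'f⟩
    · have : {f | f ∈ G.edgeSet ∧ ∃ z ∈ f, z ≠ u ∧ p u = p z} = ∅ := by
        rw [Set.eq_empty_iff_forall_notMem]
        rintro f ⟨-, z, -, h1, h2⟩
        exact h ⟨z, h1, h2⟩
      rw [this, Set.ncard_empty]; exact Nat.zero_le _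
  have hedge : ∀ e ∈ G.edgeSet, {f | (hq.drawing G).Cross e f}.ncard ≤ 2 * Δ := by
    intro e he
    induction e using Sym2.ind with
    | _ u v =>
      have hsub : {f | (hq.drawing G).Cross s(u, v) f} ⊆
          {f | f ∈ G.edgeSet ∧ ∃ z ∈ f, z ≠ u ∧ p u = p z} ∪
          {f | f ∈ G.edgeSet ∧ ∃ z ∈ f, z ≠ v ∧ p v = p z} := by
        intro f hf
        obtain ⟨w, hw, z, hz, h1, h2⟩ := hcross _ f hf
        obtain ⟨x, hx⟩ := hf
        rcases Sym2.mem_iff.1 hw with rfl | rfl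
        · exact Or.inl ⟨hx.2.1, z, hz, h1, h2⟩
        · exact Or.inr ⟨hx.2.1, z, hz, h1, h2⟩
      have h1 := Set.ncard_le_ncard hsub (Set.toFinite _)
      have h2 := Set.ncard_union_le {f | f ∈ G.edgeSet ∧ ∃ z ∈ f, z ≠ u ∧ p u = p z}
        {f | f ∈ G.edgeSet ∧ ∃ z ∈ f, z ≠ v ∧ p v = p z}
      have := hI u
      have := hI v
      omega
  set D := hq.drawing G with hD
  have hch : ∀ x : D.crossings, ∃ ef : Sym2 V × Sym2 V, D.CrossAt ef.1 ef.2 x := fun ⟨x, e, f, h⟩ =>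
    ⟨(e, f), h⟩
  choose g hg using hch
  have ginj : Function.Injective g := fun x y hxy => by
    have hx := hg x
    rw [hxy] at hx
    exact Subtype.ext (hq.crossAt_unique hx (hg y))
  have hfin : D.crossings.Finite := Finite.of_injective g ginj
  refine ⟨D, hedge, hfin, ?_⟩
  have : Finite D.crossings := hfin
  -- Ordered pairs of crossing edges. A pair crosses at one point only, and every crossing yields
  -- two ordered pairs, which cancels the factor two in `2 * Δ`.
  let S : Finset (Σ _ : Sym2 V, Sym2 V) :=
    G.edgeFinset.sigma fun e => Finset.univ.filter fun f => D.Cross e f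
  have hS : S.card ≤ G.edgeSet.ncard * (2 * Δ) := by
    rw [Finset.card_sigma, Set.ncard_eq_toFinset_card', ← smul_eq_mul]
    refine Finset.sum_le_card_nsmul _ _ _ fun e he => ?_
    have := hedge e (by simpa using he)
    rwa [Set.ncard_eq_toFinset_card', Set.toFinset_ofPred] at this
  have h2 : 2 * D.crossings.ncard ≤ S.card := by
    have hinj : Function.Injective fun z : D.crossings × Bool =>
        (if z.2 then ⟨(g z.1).1, (g z.1).2⟩ else ⟨(g z.1).2, (g z.1).1⟩ : Σ _ : Sym2 V, Sym2 V) := by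
      have mixed : ∀ x y : D.crossings, (g x).1 = (g y).2 → (g x).2 = (g y).1 → False := by
        intro x y h1 h2
        have hx := (hg x).symm
        rw [h1, h2] at hx
        have hxy : x = y := Subtype.ext (hq.crossAt_unique hx (hg y))
        rw [hxy] at h1
        exact (hg y).2.2.1 h1
      rintro ⟨x, i⟩ ⟨y, j⟩ hxy
      cases i <;> cases j <;> simp only [if_true, if_false, Sigma.mk.injEq, heq_eq_eq,
        Bool.false_eq_true] at hxy
      · rw [ginj (Prod.ext hxy.2 hxy.1)]
      · exact (mixed y x hxy.1.symm hxy.2.symm).elim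
      · exact (mixed x y hxy.1 hxy.2).elim
      · rw [ginj (Prod.ext hxy.1 hxy.2)]
    have := Fintype.ofFinite D.crossings
    have hc := Finset.card_le_card_of_injOn (s := (Finset.univ : Finset (D.crossings × Bool))) (t := S)
      _ (fun z _ => ?_) hinj.injOn
    · rw [Finset.card_univ, Fintype.card_prod, Fintype.card_bool, ← Nat.card_eq_fintype_card] at hc
      rw [← Nat.card_coe_set_eq]; omega
    · have h := hg z.1
      have h' := h.symm
      split_ifs
      · simpa [S] using ⟨h.1, _, h⟩
      · simpa [S] using ⟨h'.1, _, h'⟩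
  have : 2 * D.crossings.ncard ≤ 2 * (Δ * G.edgeSet.ncard) := by
    calc _ ≤ _ := h2.trans hS
      _ = _ := by ring
  omega

end FinalDrawing

end RectilinearCrossing


namespace RectilinearCrossing

/-! ### The bounds in terms of the maximum degree. -/

section Main

variable {V : Type*} [Fintype V] [DecidableEq V] (G : SimpleGraph V) [DecidableRel G.Adj]

lemma ncard_incidenceSet_le_maxDegree (v : V) : (G.incidenceSet v).ncard ≤ G.maxDegree := by
  rw [Set.ncard_eq_toFinset_card', Set.toFinset_card, SimpleGraph.card_incidenceSet_eq_degree]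
  exact G.degree_le_maxDegree v

lemma ncard_edgeSet_eq_card : G.edgeSet.ncard = G.edgeFinset.card := by
  rw [SimpleGraph.edgeFinset, Set.ncard_eq_toFinset_card']

lemma maxDegree_mul_card_edgeFinset_le (h : ¬ HasK33 G) :
    ((G.maxDegree * G.edgeFinset.card : ℕ) : ℤ) ≤
      (G.maxDegree : ℤ) * (3 * (Fintype.card V : ℤ) - 5) := by
  by_cases hV : 2 ≤ Fintype.card V
  · have hb := ncard_edgeSet_add_five_le (G := G) (U := Set.univ) (fun _ _ _ => trivial) h
      (by rwa [Set.ncard_univ, Nat.card_eq_fintype_card])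
    rw [Set.ncard_univ, Nat.card_eq_fintype_card, ncard_edgeSet_eq_card] at hb
    push_cast
    refine mul_le_mul_of_nonneg_left ?_ (by positivity)
    omega
  -- Here `3n - 5` is negative, but the maximum degree is zero.
  · have : Subsingleton V := Fintype.card_le_one_iff_subsingleton.1 (by omega)
    simp

theorem exists_drawing_cross_le_and_rcr_le (h : K33MinorFree G) :
    (∃ D : RectilinearDrawing G, ∀ e ∈ G.edgeSet,
      {f | D.Cross e f}.encard ≤ ((2 * G.maxDegree : ℕ) : ℕ∞)) ∧
    rcr G ≤ ((G.maxDegree * G.edgeFinset.card : ℕ) : ℕ∞) := by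
  obtain ⟨D, h1, h2, h3⟩ := exists_drawing_crossings_le (k33MinorFree_iff.1 h)
    (ncard_incidenceSet_le_maxDegree G)
  refine ⟨⟨D, fun e he => ?_⟩, (iInf_le _ D).trans ?_⟩
  · rw [← (Set.toFinite {f | D.Cross e f}).cast_ncard_eq]
    exact_mod_cast h1 e he
  · rw [← h2.cast_ncard_eq, ← ncard_edgeSet_eq_card]
    exact_mod_cast h3

end Main

end RectilinearCrossing

theorem mainTheorem4 :
    (∀ Δ : ℕ, ∃ c : ℕ, ∀ (V : Type*) [Fintype V] (G : SimpleGraph V) [DecidableRel G.Adj],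
      RectilinearCrossing.K33MinorFree G → G.maxDegree ≤ Δ →
        RectilinearCrossing.rcr G ≤ ((c * Fintype.card V : ℕ) : ℕ∞)) ∧
    (∀ (V : Type*) [Fintype V] [DecidableEq V] (G : SimpleGraph V) [DecidableRel G.Adj],
      RectilinearCrossing.K33MinorFree G →
        (∃ D : RectilinearCrossing.RectilinearDrawing G, ∀ e ∈ G.edgeSet,
          {f | D.Cross e f}.encard ≤ ((2 * G.maxDegree : ℕ) : ℕ∞)) ∧
        RectilinearCrossing.rcr G ≤ ((G.maxDegree * G.edgeFinset.card : ℕ) : ℕ∞) ∧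
        ((G.maxDegree * G.edgeFinset.card : ℕ) : ℤ) ≤
          (G.maxDegree : ℤ) * (3 * (Fintype.card V : ℤ) - 5)) := by
  -- The constant `3Δ` comes from discarding the `- 5` in the edge bound.
  refine ⟨fun Δ => ⟨3 * Δ, fun V _ G _ h hΔ => ?_⟩, fun V _ _ G _ h => ?_⟩
  · classical
    refine (RectilinearCrossing.exists_drawing_cross_le_and_rcr_le G h).2.trans ?_
    have hb := RectilinearCrossing.maxDegree_mul_card_edgeFinset_le G
      (RectilinearCrossing.k33MinorFree_iff.1 h)
    have h1 : (G.maxDegree : ℤ) * Fintype.card V ≤ Δ * Fintype.card V :=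
      mul_le_mul_of_nonneg_right (by exact_mod_cast hΔ) (by positivity)
    have h2 : G.maxDegree * G.edgeFinset.card ≤ 3 * Δ * Fintype.card V := by
      zify
      push_cast at hb
      have : (0 : ℤ) ≤ G.maxDegree := by positivity
      linarith
    exact_mod_cast h2
  · exact ⟨(RectilinearCrossing.exists_drawing_cross_le_and_rcr_le G h).1,
      (RectilinearCrossing.exists_drawing_cross_le_and_rcr_le G h).2,
      RectilinearCrossing.maxDegree_mul_card_edgeFinset_le G (RectilinearCrossing.k33MinorFree_iff.1 h)⟩
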